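/- Let $\mathcal X\subset\mathbb R^d$, $\sigma^2>0$, and let $k:\mathcal X\times\mathcal X\to\mathbb R$ be a kernel with $k(x,x')\le 1$ on $\mathcal X\times\mathcal X$. The objective $f\sim\mathcal{GP}(0,k)$ is a zero-mean Gaussian process on $\mathcal X$ with continuous sample paths, and the noise variables $\epsilon_1,\epsilon_2,\dots$ are i.i.d. $\mathcal N(0,\sigma^2)$, independent of $f$. Gaussian process Thompson sampling (GP-TS) works as follows: in round $t\ge 1$, given the data $\mathcal D_{t-1}=\{(x_s,y_s)\}_{s<t}$, it draws a path $g_t\sim p(f\mid\mathcal D_{t-1})$ from the posterior (conditionally on $\mathcal D_{t-1}$ independent of $f$, of the noise and of the earlier draws), queries $x_t\in\operatorname{argmax}_{x\in\mathcal X}g_t(x)$ (ties are broken by a measurable rule depending on $t$, $\mathcal D_{t-1}$ and $g_t$), and observes $y_t=f(x_t)+\epsilon_t$. Let $R_T=\sum_{t=1}^T\bigl(\max_{x\in\mathcal X} f(x)-f(x_t)\bigr)$, let $\gamma_T=\sup_{a_1,\dots,a_T\in\mathcal X} I(\mathbf y_A;\mathbf f_A)$ be the maximum information gain, where $\mathbf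 f_A=(f(a_i))_{i\le T}$, $\mathbf y_A=\mathbf f_A+(\epsilon_i)_{i\le T}$ and $I$ is Shannon mutual information, and let $C_1=2/\log(1+\sigma^{-2})$. (1) Finite domain. If $|\mathcal X|<\infty$, put $\beta_T=\max\{1,\,2\log(24|\mathcal X|T^2/\sqrt{2\pi})\}$. Then for every $T\ge 1$ $$\mathbb E[R_T^2]\le 12\,C_1T(\beta_T+1)\gamma_T+\beta_T^{1/2}.$$ (2) Continuous domain. Let $\mathcal X\subset[0,r]^d$ be compact, $r>0$, and let $k$ be the linear kernel $x^\top x'$, the squared exponential kernel $\exp(-\|x-x'\|_2^2/(2\ell^2))$ with $\ell>0$, or the Matérn kernel with length scale $\ell>0$ and smoothness $\nu>1$. Suppose that there are $a,b>0$ such that almost every sample path is differentiable and $\Pr\bigl(\sup|\partial f/\partial x_j|>u\bigr)\le a\exp(-(u/b)^2)$ for all $j\in\{1,\dots,d\}$ and $u>0$; the supremum is over $\mathcal X$ if $\mathcal X$ is convex, and otherwise over the convex hull of $\mathcal X$, for some extension of the path to the convex hull. Let $L_\sigma$ be $1$, $\sqrt2/\ell$, or $\frac{\sqrt2}{\ell}\sqrt{\nu/(\nu-1)}$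 for the three kernels respectively, $L=\max\{L_\sigma,\,b\sqrt{\log(ad)+1}\}$ (the square root is read as $0$ if $\log(ad)+1<0$), and $\beta_T=\max\{1,\,2\log(36\lceil drLT\rceil^dT^2/\sqrt{2\pi})\}$. Then for every $T\ge1$ $$\mathbb E[R_T^2]\le 27+\beta_T^{1/2}+18\,T(\beta_T+1)(2+C_1\gamma_T).$$ In both cases $\beta_T=O(\log T)$, and there is a constant $C$ that depends only on $\mathcal X$, $k$, $\sigma^2$ (and on $r,a,b$ in case (2)), but not on $T$ or $\delta$, such that for all $T\ge 2$: $\mathbb E[R_T^2]\le C\,T\beta_T\gamma_T$, $\mathbb E[R_T^2]\le C\,T\gamma_T\log T$, and for every $\delta\in(0,1)$ $$\Pr\Bigl(R_T\le C\sqrt{T\gamma_T\log T/\delta}\Bigr)\ge 1-\delta .$$ -/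

import Mathlib

open MeasureTheory ProbabilityTheory InformationTheory Set Filter Asymptotics
universe u

open scoped ENNReal NNReal

namespace GPTS

/-- The ambient space `ℝᵈ`. -/
abbrev E (d : ℕ) : Type := EuclideanSpace ℝ (Fin d)

/-- The cylinder σ-algebra on a space of continuous paths, generated by the evaluation maps.
For a compact metrizable `α` it is the Borel σ-algebra of the sup norm. -/
instance pathMeasurableSpace (α : Type*) [TopologicalSpace α] : MeasurableSpace C(α, ℝ) :=
  MeasurableSpace.comap (fun (h : C(α, ℝ)) (p : α) => h p) MeasurableSpace.pi

/-! ### Kernels on `ℝᵈ` -/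

/-- Modified Bessel function of the second kind, for `z > 0`. -/
noncomputable def besselK (ν z : ℝ) : ℝ :=
  (1 / 2) * (z / 2) ^ ν * ∫ t in Ioi (0 : ℝ), Real.exp (-t - z ^ 2 / (4 * t)) * t ^ (-(ν + 1))

/-- The kernels for which the continuous-domain result is stated. -/
inductive StdKernel : Type
  | linear : StdKernel
  | squaredExp (ℓ : ℝ) : StdKernel
  | matern (ν ℓ : ℝ) : StdKernel

namespace StdKernel

/-- The parameter ranges: `ℓ > 0`, and `ν > 1` for Matérn kernels. -/
def Admissible : StdKernel → Prop
  | linear => True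
  | squaredExp ℓ => 0 < ℓ
  | matern ν ℓ => 1 < ν ∧ 0 < ℓ

/-- The kernel function. The Matérn formula is continued by its limit `1` on the diagonal. -/
noncomputable def toFun {d : ℕ} : StdKernel → E d → E d → ℝ
  | linear, x, y => inner ℝ x y
  | squaredExp ℓ, x, y => Real.exp (-‖x - y‖ ^ 2 / (2 * ℓ ^ 2))
  | matern ν ℓ, x, y =>
      open Classical in
      if x = y then 1
      else 2 ^ (1 - ν) / Real.Gamma ν * (Real.sqrt (2 * ν) * ‖x - y‖ / ℓ) ^ ν
        * besselK ν (Real.sqrt (2 * ν) * ‖x - y‖ / ℓ)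

/-- The constant `L_σ` attached to the kernel. -/
noncomputable def lipSigma : StdKernel → ℝ
  | linear => 1
  | squaredExp ℓ => Real.sqrt 2 / ℓ
  | matern ν ℓ => Real.sqrt 2 / ℓ * Real.sqrt (ν / (ν - 1))

end StdKernel

/-! ### Maximum information gain -/

/-- Shannon mutual information of the two components of a joint law. -/
noncomputable def mutualInfo {α β : Type*} [MeasurableSpace α] [MeasurableSpace β]
    (μ : Measure (α × β)) : ℝ≥0∞ :=
  klDiv μ (μ.fst.prod μ.snd)

/-- The information `I(y_A ; f_A)`, where `A = (a_1, …, a_T)`, `f_A ∼ N(0, (k(a_i, a_j))_{i,j})`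
and `y_A = f_A + ε_A` with `ε_A ∼ N(0, v I)` independent of `f_A`. -/
noncomputable def infoGain {d : ℕ} (k : E d → E d → ℝ) (v : ℝ≥0) {T : ℕ} (A : Fin T → E d) :
    ℝ≥0∞ :=
  mutualInfo
    (((multivariateGaussian (0 : EuclideanSpace ℝ (Fin T))
          (Matrix.of fun i j => k (A i) (A j))).prod
        (multivariateGaussian (0 : EuclideanSpace ℝ (Fin T))
          ((v : ℝ) • (1 : Matrix (Fin T) (Fin T) ℝ)))).map
      fun p => (p.1 + p.2, p.1))

/-- The maximum information gain `γ_T` over the domain `X`. -/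
noncomputable def maxInfoGain {d : ℕ} (X : Set (E d)) (k : E d → E d → ℝ) (v : ℝ≥0) (T : ℕ) : ℝ :=
  (⨆ A : Fin T → X, infoGain k v (fun i => (A i : E d))).toReal

/-! ### The Gaussian process prior and Thompson sampling -/

section Model

variable {d : ℕ} {X : Set (E d)} {Ω : Type*} [MeasurableSpace Ω]

/-- The prior: `f ∼ GP(0, k)` on `X` with continuous sample paths, `k ≤ 1` on `X × X`, and
i.i.d. noise `ε_t ∼ N(0, v)` independent of `f`. -/
structure IsGPModel (k : E d → E d → ℝ) (v : ℝ≥0) (f : Ω → C(X, ℝ)) (ε : ℕ → Ω → ℝ)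
    (P : Measure Ω) : Prop where
  measurable_f : Measurable f
  gaussian : IsGaussianProcess (fun (p : X) ω => f ω p) P
  mean_zero : ∀ p : X, ∫ ω, f ω p ∂P = 0
  covariance : ∀ p q : X, cov[fun ω => f ω p, fun ω => f ω q; P] = k p q
  kernel_le_one : ∀ p q : X, k p q ≤ 1
  noise_law : ∀ t, HasLaw (ε t) (gaussianReal 0 v) P
  noise_indep : iIndepFun ε P
  noise_indep_f : IndepFun f (fun ω t => ε t ω) P

/-- The data set of the first `t` queries, `(x_s, f(x_s) + ε_s)` for `s < t`. -/
def data (f : Ω → C(X, ℝ)) (ε : ℕ → Ω → ℝ) (x : ℕ → Ω → X) (t : ℕ) (ω : Ω) : Fin t → X × ℝ :=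
  fun s => (x s ω, f ω (x s ω) + ε s ω)

/-- Everything that is independent of the draw of `g_t` once the data `D_t` are known (the objective
`f`, all noise variables, the earlier draws `g_s` for `s < t`), paired with `D_t`. -/
def history (f : Ω → C(X, ℝ)) (ε : ℕ → Ω → ℝ) (g : ℕ → Ω → C(X, ℝ)) (x : ℕ → Ω → X) (t : ℕ)
    (ω : Ω) : (C(X, ℝ) × (ℕ → ℝ) × (Fin t → C(X, ℝ))) × (Fin t → X × ℝ) :=
  ((f ω, fun s => ε s ω, fun s => g s ω), data f ε x t ω)

/-- The query points `x_t` are produced by Gaussian process Thompson sampling (time starts at `0`):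
* given everything that happened before round `t` (and given `f` and all noise variables), the path
  `g_t` is drawn from the posterior law `p(f | D_t)`, a regular conditional law of `f` given the
  data `D_t` of the first `t` queries;
* `x_t` is a maximizer of `g_t` over `X`, where ties are broken by some measurable rule, which may
  use the round, the data and `g_t`. -/
structure IsThompsonSampling (f : Ω → C(X, ℝ)) (ε : ℕ → Ω → ℝ) (g : ℕ → Ω → C(X, ℝ))
    (x : ℕ → Ω → X) (P : Measure Ω) : Prop where
  posterior_sample : ∀ t, ∃ post : Kernel (Fin t → X × ℝ) C(X, ℝ), IsMarkovKernel post ∧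
    HasCondDistrib f (data f ε x t) post P ∧
    HasCondDistrib (g t) (history f ε g x t) (post.comap Prod.snd (by fun_prop)) P
  argmax : ∀ t, ∃ select : (Fin t → X × ℝ) × C(X, ℝ) → X, Measurable select ∧
    (∀ (D : Fin t → X × ℝ) (h : C(X, ℝ)) (p : X), h p ≤ h (select (D, h))) ∧
    ∀ ω, x t ω = select (data f ε x t ω, g t ω)

/-- The tail condition on the derivatives of the sample paths: almost every path is differentiable
and `P(sup |∂f/∂x_j| > L) ≤ a exp(-(L/b)²)` for every coordinate `j` and every `L > 0`.
The derivatives are taken on the convex hull of `X` (which is `X` itself if `X` is convex); if `X`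
is not convex, then `F` is an extension of the path to the convex hull. -/
def DerivativeTail (f : Ω → C(X, ℝ)) (P : Measure Ω) (a b : ℝ) : Prop :=
  ∃ (F : Ω → E d → ℝ) (F' : Ω → E d → (E d →L[ℝ] ℝ)),
    (∀ ω (p : X), F ω p = f ω p) ∧
    (∀ᵐ ω ∂P, ∀ z ∈ convexHull ℝ X, HasFDerivWithinAt (F ω) (F' ω z) (convexHull ℝ X) z) ∧
    ∀ (j : Fin d) (L : ℝ), 0 < L →
      P {ω | ∃ z ∈ convexHull ℝ X, L < |F' ω z (EuclideanSpace.single j 1)|} ≤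
        ENNReal.ofReal (a * Real.exp (-(L / b) ^ 2))

end Model

/-- A Gaussian process model together with a run of Thompson sampling on it, on some probability
space. -/
structure Run {d : ℕ} (X : Set (E d)) (k : E d → E d → ℝ) (v : ℝ≥0) where
  /-- the sample space -/
  Ω : Type u
  /-- its σ-algebra -/
  mΩ : MeasurableSpace Ω
  /-- the probability measure -/
  P : Measure Ω
  isProb : IsProbabilityMeasure P
  /-- the objective function -/
  f : Ω → C(X, ℝ)
  /-- the observation noise -/
  ε : ℕ → Ω → ℝ
  /-- the posterior sample paths -/
  g : ℕ → Ω → C(X, ℝ)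
  /-- the query points -/
  x : ℕ → Ω → X
  model : IsGPModel k v f ε P
  sampling : IsThompsonSampling f ε g x P

attribute [instance] Run.mΩ Run.isProb

/-- Cumulative regret `R_T = ∑_{t ≤ T} (f(x⋆) - f(x_t))`, where `f(x⋆) = max_X f`. -/
noncomputable def Run.regret {d : ℕ} {X : Set (E d)} {k : E d → E d → ℝ} {v : ℝ≥0}
    (A : Run X k v) (T : ℕ) (ω : A.Ω) : ℝ :=
  ∑ t ∈ Finset.range T, ((⨆ p : X, A.f ω p) - A.f ω (A.x t ω))

/-! ### The constants of the bounds -/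

/-- `C₁ = 2 / log(1 + σ⁻²)`, with `v = σ²`. -/
noncomputable def C₁ (v : ℝ≥0) : ℝ := 2 / Real.log (1 + (v : ℝ)⁻¹)

/-- `β_T` for a finite domain with `n` points. -/
noncomputable def betaFinite (n : ℕ) (T : ℕ) : ℝ :=
  max 1 (2 * Real.log (24 * n * (T : ℝ) ^ 2 / Real.sqrt (2 * Real.pi)))

/-- `L = max {L_σ, b √(log(a d) + 1)}`. -/
noncomputable def lipConst (d : ℕ) (K : StdKernel) (a b : ℝ) : ℝ :=
  max K.lipSigma (b * Real.sqrt (Real.log (a * d) + 1))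

/-- `β_T` for a continuous domain in `[0, r]ᵈ`. -/
noncomputable def betaContinuous (d : ℕ) (r L : ℝ) (T : ℕ) : ℝ :=
  max 1 (2 * Real.log
    (36 * (⌈(d : ℝ) * r * L * T⌉₊ : ℝ) ^ d * (T : ℝ) ^ 2 / Real.sqrt (2 * Real.pi)))

/-- The order-of-magnitude conclusions, with one constant for all horizons, all confidence levels
and all runs that satisfy `Q`. -/
def RegretOrder {d : ℕ} (X : Set (E d)) (k : E d → E d → ℝ) (v : ℝ≥0) (β : ℕ → ℝ)
    (Q : Run X k v → Prop) : Prop :=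
  ∃ C : ℝ, 0 < C ∧ ∀ A : Run X k v, Q A → ∀ T : ℕ, 2 ≤ T →
    ∫ ω, A.regret T ω ^ 2 ∂A.P ≤ C * (T * β T * maxInfoGain X k v T) ∧
    ∫ ω, A.regret T ω ^ 2 ∂A.P ≤ C * (T * maxInfoGain X k v T * Real.log T) ∧
    ∀ δ : ℝ, 0 < δ → δ < 1 →
      ENNReal.ofReal (1 - δ) ≤
        A.P {ω | A.regret T ω ≤ C * Real.sqrt (T * maxInfoGain X k v T * Real.log T / δ)}

end GPTS

/-! Conditionally on the data `D_t`, the objective `f` and the draw `g_t` are independent with the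
same law, so exchanging them preserves every expectation (`lintegral_exchange`). Let `x*` be the
maximizer of `f` picked by the tie-breaking rule of round `t`, and `m` the posterior mean. As `g_t
x* ≤ g_t x_t`, the gap `f x* - f x_t` is at most the sum of the four deviations of `f` and `g_t`
from `m` at `x*` and `x_t`; on an infinite domain the points are moved to a finite grid, at the
price of four discretization errors.

For `f` at `x_t` and `g_t` at `x*` the point is independent of the path given the data, so the mean
squared deviation is exactly the mean posterior variance (`lintegral_sq_draw`). For `f` at `x*` and
`g_t` at `x_t` the point depends on the path: the square is at most `β` times the variance plus an
excess, and the excess is summed over all grid points by a Gaussian tail integral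
(`lintegral_sq_objective_le`); `β` is chosen so that these sums stay small over all rounds. Exchange
also replaces the variance at `x*` by that at `x_t`. By Cauchy–Schwarz over the rounds, only the sum
of the posterior variances at the queried points remains.

That sum is bounded along every sequence of queries. The information gain is half a log-determinant
(`infoGain_eq_log_det`), which factors over the rounds through the posterior variances
(`det_eq_prod_postCov`); concavity of the logarithm then gives the bound `C₁ γ_T`
(`sum_postCov_le`).

The sampling hypothesis only provides some regular conditional law of `f`. Its one-point marginals
enter through a change of measure: the joint law of `f` and `D_t` has the likelihood as density
relative to a product (`exists_law_data`), and tilting a Gaussian process by a Gaussian likelihood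
gives a Gaussian process with the usual updates (`IsGP.tilted`).

On a continuous domain, conditioning contracts the canonical metric of the kernel, so posterior
standard deviations are `L_σ`-Lipschitz, and the derivative tail bounds the mean squared oscillation
of `f` over a grid cell. The orders of magnitude follow because `γ_T` is bounded below unless the
process vanishes, and the tail bound is Markov's inequality for `R_T²`. -/

namespace GPTS

/-! ### Gaussian conditioning as exponential tilting -/

/-- The logarithm of the density of `N(w, v)` with respect to `N(0, v)` at `y`. -/
noncomputable def logLik (v : ℝ≥0) (y w : ℝ) : ℝ := (2 * y * w - w ^ 2) / (2 * v)

lemma measurable_logLik (v : ℝ≥0) (y : ℝ) : Measurable (logLik v y) := by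
  unfold logLik; fun_prop

/-- The bound is uniform in `w`, so likelihood weights are bounded and every tilt below is by an
integrable density. -/
lemma logLik_le (v : ℝ≥0) (y w : ℝ) : logLik v y w ≤ y ^ 2 / (2 * v) := by
  unfold logLik
  gcongr
  nlinarith [sq_nonneg (y - w)]

lemma gaussianReal_eq_withDensity_logLik {v : ℝ≥0} (hv : 0 < v) (w : ℝ) :
    gaussianReal w v =
      (gaussianReal 0 v).withDensity (fun y => ENNReal.ofReal (Real.exp (logLik v y w))) := by
  rw [gaussianReal_of_var_ne_zero _ hv.ne', gaussianReal_of_var_ne_zero _ hv.ne',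
    ← withDensity_mul _ (by fun_prop) (by unfold logLik; fun_prop)]
  congr 1
  ext y
  have hv' : (0 : ℝ) < v := hv
  rw [Pi.mul_apply, gaussianPDF, gaussianPDF, ← ENNReal.ofReal_mul (gaussianPDFReal_nonneg _ _ _),
    gaussianPDFReal, gaussianPDFReal, mul_assoc (√(2 * Real.pi * v))⁻¹, ← Real.exp_add]
  congr 3
  unfold logLik
  field_simp
  ring

lemma integrable_exp_logLik {Ω : Type*} {mΩ : MeasurableSpace Ω} {ν : Measure Ω}
    [IsFiniteMeasure ν] {W : Ω → ℝ} (hW : AEMeasurable W ν) (v : ℝ≥0) (y : ℝ) :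
    Integrable (fun ω => Real.exp (logLik v y (W ω))) ν := by
  refine Integrable.of_bound (C := Real.exp (y ^ 2 / (2 * v))) ?_ ?_
  · exact (Real.measurable_exp.comp_aemeasurable
      ((measurable_logLik v y).comp_aemeasurable hW)).aestronglyMeasurable
  · refine ae_of_all _ fun ω => ?_
    rw [Real.norm_eq_abs, abs_of_pos (Real.exp_pos _)]
    exact Real.exp_le_exp.2 (logLik_le _ _ _)

/-- Conjugacy: the tilt of a Gaussian by a Gaussian likelihood is Gaussian. -/
lemma gaussianReal_tilted_logLik {v : ℝ≥0} (hv : 0 < v) (m : ℝ) (c : ℝ≥0) (y : ℝ) :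
    (gaussianReal m c).tilted (logLik v y) =
      gaussianReal (m + c / (c + v) * (y - m)) (c * v / (c + v)) := by
  have hv' : (0 : ℝ) < v := hv
  -- On a point mass the likelihood is constant, so tilting changes nothing.
  rcases eq_or_ne c 0 with rfl | hc
  · simp only [NNReal.coe_zero, zero_div, zero_mul, add_zero, gaussianReal_zero_var]
    have h1 : (Measure.dirac m).tilted (logLik v y) =
        (Measure.dirac m).tilted (fun _ => logLik v y m) := by
      refine tilted_congr ?_
      rw [Filter.EventuallyEq, ae_dirac_eq]
      simp
    rw [h1, tilted_const]
  have hc0 : 0 < c := pos_iff_ne_zero.2 hc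
  have hc' : (0 : ℝ) < c := hc0
  set m' : ℝ := m + c / (c + v) * (y - m) with hm'
  set c' : ℝ≥0 := c * v / (c + v) with hc'def
  have hc'0 : c' ≠ 0 := by positivity
  have hc'r : (c' : ℝ) = c * v / (c + v) := by simp [hc'def]
  have hc'pos : (0 : ℝ) < c' := by rw [hc'r]; positivity
  -- Completing the square in `w`. The constant `K` is the evidence: the density of `N(m, c + v)` at
  -- `y` divided by that of `N(0, v)`.
  obtain ⟨K, hK, hKeq⟩ : ∃ K : ℝ, 0 < K ∧ ∀ w, gaussianPDFReal m c w * Real.exp (logLik v y w) =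
      K * gaussianPDFReal m' c' w := by
    refine ⟨(√(2 * Real.pi * c))⁻¹ * √(2 * Real.pi * c') *
      Real.exp (y ^ 2 / (2 * v) - (y - m) ^ 2 / (2 * (c + v))), by positivity, fun w => ?_⟩
    rw [gaussianPDFReal, gaussianPDFReal]
    have h1 : √(2 * Real.pi * c') ≠ 0 := by positivity
    rw [mul_assoc, ← Real.exp_add]
    calc _ = (√(2 * Real.pi * c))⁻¹ * (Real.exp (y ^ 2 / (2 * v) - (y - m) ^ 2 / (2 * (c + v)))
          * Real.exp (-(w - m') ^ 2 / (2 * c'))) := by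
          rw [← Real.exp_add]
          congr 2
          rw [hm', hc'r, logLik]
          field_simp
          ring
      _ = _ := by field_simp
  have hint : ∫ w, Real.exp (logLik v y w) ∂(gaussianReal m c) = K := by
    rw [integral_gaussianReal_eq_integral_smul hc]
    simp only [smul_eq_mul, hKeq]
    rw [integral_const_mul, integral_gaussianPDFReal_eq_one _ hc'0, mul_one]
  rw [Measure.tilted, hint, gaussianReal_of_var_ne_zero _ hc, gaussianReal_of_var_ne_zero _ hc'0,
    ← withDensity_mul _ (by fun_prop) (by unfold logLik; fun_prop)]
  congr 1
  ext w
  rw [Pi.mul_apply, gaussianPDF, gaussianPDF, ← ENNReal.ofReal_mul (gaussianPDFReal_nonneg _ _ _),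
    ← mul_div_assoc, hKeq]
  congr 1
  field_simp

section Tilt

variable {Ω : Type*} {mΩ : MeasurableSpace Ω} {ν : Measure Ω}

lemma map_tilted_comp {α : Type*} [MeasurableSpace α] {W : Ω → α} (hW : Measurable W)
    {ℓ : α → ℝ} (hℓ : Measurable ℓ) :
    (ν.tilted (fun ω => ℓ (W ω))).map W = (ν.map W).tilted ℓ := by
  have hI : ∫ x, Real.exp (ℓ x) ∂(ν.map W) = ∫ ω, Real.exp (ℓ (W ω)) ∂ν :=
    integral_map hW.aemeasurable (by fun_prop)
  ext s hs
  rw [Measure.map_apply hW hs, tilted_apply' _ _ (hW hs), tilted_apply' _ _ hs, hI,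
    setLIntegral_map hs (by fun_prop) hW]

/-- A weight that depends on `W` alone leaves `R` its law and its independence of `W`. With
regression residuals as `R`, this carries scalar conjugacy over to a whole process. -/
lemma map_prod_tilted_of_indepFun {α : Type*} [MeasurableSpace α] [IsProbabilityMeasure ν]
    {R : Ω → α} {W : Ω → ℝ} (hR : Measurable R) (hW : Measurable W) (h : IndepFun R W ν)
    {ℓ : ℝ → ℝ} (hℓ : Measurable ℓ) :
    (ν.tilted (fun ω => ℓ (W ω))).map (fun ω => (R ω, W ω)) =
      (ν.map R).prod ((ν.map W).tilted ℓ) := by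
  have : IsProbabilityMeasure (ν.map R) := Measure.isProbabilityMeasure_map hR.aemeasurable
  have : IsProbabilityMeasure (ν.map W) := Measure.isProbabilityMeasure_map hW.aemeasurable
  have h1 := map_tilted_comp (ν := ν) (hR.prodMk hW) (ℓ := fun p => ℓ p.2) (by fun_prop)
  simp only at h1
  rw [h1, (indepFun_iff_map_prod_eq_prod_map_map hR.aemeasurable hW.aemeasurable).1 h,
    Measure.tilted, Measure.tilted, prod_withDensity_right (by fun_prop)]
  congr 1
  ext p
  congr 2
  have := integral_fun_snd (μ := ν.map R) (ν := ν.map W) (f := fun w => Real.exp (ℓ w))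
  simpa using this

end Tilt

/-! ### Gaussian processes with prescribed mean and covariance -/

/-- `Y` is a Gaussian process with mean function `m` and covariance function `c`. -/
structure IsGP {ι Ω : Type*} {mΩ : MeasurableSpace Ω} (Y : ι → Ω → ℝ) (m : ι → ℝ) (c : ι → ι → ℝ)
    (ν : Measure Ω) : Prop where
  gaussian : IsGaussianProcess Y ν
  mean : ∀ p, ∫ ω, Y p ω ∂ν = m p
  cov : ∀ p q, cov[Y p, Y q; ν] = c p q

/-- The posterior covariance after one noisy observation at `x`. -/
noncomputable def condCov {ι : Type*} (v : ℝ≥0) (c : ι → ι → ℝ) (x p q : ι) : ℝ :=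
  c p q - c p x * c x q / (c x x + v)

/-- The posterior mean after observing `y` at `x`. -/
noncomputable def condMean {ι : Type*} (v : ℝ≥0) (c : ι → ι → ℝ) (m : ι → ℝ) (x : ι) (y : ℝ)
    (p : ι) : ℝ :=
  m p + c p x / (c x x + v) * (y - m x)

namespace IsGP

variable {ι Ω : Type*} {mΩ : MeasurableSpace Ω} {Y : ι → Ω → ℝ} {m : ι → ℝ} {c : ι → ι → ℝ}
  {ν : Measure Ω}

lemma isProb (h : IsGP Y m c ν) : IsProbabilityMeasure ν := h.gaussian.isProbabilityMeasure

lemma memLp (h : IsGP Y m c ν) (p : ι) : MemLp (Y p) 2 ν :=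
  (h.gaussian.hasGaussianLaw_eval p).memLp_two

lemma var (h : IsGP Y m c ν) (p : ι) : Var[Y p; ν] = c p p := by
  rw [← covariance_self (h.gaussian.aemeasurable p), h.cov]

lemma nonneg (h : IsGP Y m c ν) (p : ι) : 0 ≤ c p p := by
  rw [← h.var]; exact variance_nonneg _ _

lemma symm (h : IsGP Y m c ν) (p q : ι) : c p q = c q p := by
  rw [← h.cov, ← h.cov, covariance_comm]

lemma map_eval (h : IsGP Y m c ν) (p : ι) : ν.map (Y p) = gaussianReal (m p) (c p p).toNNReal := by
  rw [(h.gaussian.hasGaussianLaw_eval p).map_eq_gaussianReal, h.mean, h.var]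

lemma sum_sum_nonneg (h : IsGP Y m c ν) {κ : Type*} (s : Finset κ) (a : κ → ℝ) (A : κ → ι) :
    0 ≤ ∑ i ∈ s, ∑ j ∈ s, a i * a j * c (A i) (A j) := by
  have := h.isProb
  have hm : ∀ i ∈ s, MemLp (fun ω => a i * Y (A i) ω) 2 ν := fun i _ => (h.memLp (A i)).const_mul _
  have := variance_nonneg (∑ i ∈ s, fun ω => a i * Y (A i) ω) ν
  rw [variance_sum' hm] at this
  refine this.trans_eq ?_
  refine Finset.sum_congr rfl fun i _ => Finset.sum_congr rfl fun j _ => ?_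
  rw [covariance_const_mul_left, covariance_const_mul_right, h.cov, mul_assoc]

/-- Cauchy–Schwarz, from the nonnegativity of the quadratic form of `c` on two points. -/
lemma cov_sq_le (h : IsGP Y m c ν) (p q : ι) : c p q ^ 2 ≤ c p p * c q q := by
  have h1 : ∀ s t : ℝ, 0 ≤ s ^ 2 * c p p + 2 * s * t * c p q + t ^ 2 * c q q := fun s t => by
    have := h.sum_sum_nonneg (Finset.univ : Finset (Fin 2)) ![s, t] ![p, q]
    simp only [Fin.sum_univ_two, Matrix.cons_val_zero, Matrix.cons_val_one] at this
    rw [h.symm q p] at this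
    linarith
  have hp := h.nonneg p
  have hq := h.nonneg q
  rcases hp.eq_or_lt with hp0 | hp0
  -- With `c p p = 0` the form takes the value `-(c q q + 2) * c p q ^ 2` at this vector, which
  -- forces `c p q = 0`.
  · have h2 := h1 (-(c q q + 1)) (c p q)
    have h3 := h1 (-c p q * (c q q + 1)) 1
    rw [← hp0] at h3 ⊢
    nlinarith [sq_nonneg (c p q)]
  · have h2 := h1 (-c p q) (c p p)
    have : 0 ≤ c p p * (c p p * c q q - c p q ^ 2) := by nlinarith
    nlinarith [nonneg_of_mul_nonneg_right this hp0]

/-- The reverse triangle inequality in L²: `√(c p p)` is the norm of the centred variable, and the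
right-hand side is the canonical distance of `p` and `q`. -/
lemma abs_sqrt_sub_sqrt_le (h : IsGP Y m c ν) (p q : ι) :
    |√(c p p) - √(c q q)| ≤ √(c p p - 2 * c p q + c q q) := by
  refine Real.abs_le_sqrt ?_
  have h1 : c p q ≤ √(c p p) * √(c q q) := by
    rw [← Real.sqrt_mul (h.nonneg p)]
    exact Real.le_sqrt_of_sq_le (h.cov_sq_le p q)
  nlinarith [Real.sq_sqrt (h.nonneg p), Real.sq_sqrt (h.nonneg q)]

end IsGP

end GPTS

/-! ### Conditioning a Gaussian process on one noisy observation. -/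

namespace GPTS

namespace IsGP

variable {ι Ω : Type*} {mΩ : MeasurableSpace Ω} {Y : ι → Ω → ℝ} {m : ι → ℝ} {c : ι → ι → ℝ}
  {ν : Measure Ω}

/-- The residual of `Y p` after linear regression on `Y x`. -/
noncomputable def resid (Y : ι → Ω → ℝ) (c : ι → ι → ℝ) (x p : ι) (ω : Ω) : ℝ :=
  Y p ω - c p x / c x x * Y x ω

lemma measurable_resid (hY : ∀ p, Measurable (Y p)) (x p : ι) : Measurable (resid Y c x p) :=
  (hY p).sub ((hY x).const_mul _)

lemma cov_resid_left (h : IsGP Y m c ν) (x p : ι) (Z : Ω → ℝ) (hZ : MemLp Z 2 ν) :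
    cov[resid Y c x p, Z; ν] = cov[Y p, Z; ν] - c p x / c x x * cov[Y x, Z; ν] := by
  have := h.isProb
  have h1 : resid Y c x p = Y p - fun ω => c p x / c x x * Y x ω := rfl
  rw [h1, covariance_sub_left (h.memLp p) ((h.memLp x).const_mul _) hZ, covariance_const_mul_left]

lemma memLp_resid (h : IsGP Y m c ν) (x p : ι) : MemLp (resid Y c x p) 2 ν :=
  (h.memLp p).sub ((h.memLp x).const_mul _)

/-- Makes the convention `z / 0 = 0` harmless in the regression coefficient `c p x / c x x`: where
the denominator vanishes there is nothing to regress. -/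
lemma cross_eq_zero (h : IsGP Y m c ν) {x : ι} (hx : c x x = 0) (p : ι) : c p x = 0 := by
  have := h.cov_sq_le p x
  rw [hx, mul_zero] at this
  exact pow_eq_zero_iff two_ne_zero |>.1 (le_antisymm this (sq_nonneg _))

lemma cov_resid_self (h : IsGP Y m c ν) (x p : ι) : cov[resid Y c x p, Y x; ν] = 0 := by
  rw [h.cov_resid_left _ _ _ (h.memLp x), h.cov, h.cov]
  by_cases hx : c x x = 0
  · simp [hx, h.cross_eq_zero hx]
  · field_simp
    simp

/-- Residuals and `Y x` form a linear image of a Gaussian vector, hence are jointly Gaussian, and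
they are uncorrelated. -/
lemma indepFun_resid (h : IsGP Y m c ν) (x : ι) (I : Finset ι) :
    IndepFun (fun ω (i : I) => resid Y c x i ω) (Y x) ν := by
  classical
  have hL : HasGaussianLaw (fun ω => ((fun i : I => resid Y c x i ω), fun _ : Unit => Y x ω)) ν := by
    let J := insert x I
    let px : (J → ℝ) →L[ℝ] ℝ := ContinuousLinearMap.proj ⟨x, Finset.mem_insert_self _ _⟩
    let pI : (i : I) → (J → ℝ) →L[ℝ] ℝ := fun i =>
      ContinuousLinearMap.proj ⟨i.1, Finset.mem_insert_of_mem i.2⟩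
    let L : (J → ℝ) →L[ℝ] (I → ℝ) × (Unit → ℝ) :=
      (ContinuousLinearMap.pi fun i : I => pI i - (c i x / c x x) • px).prod
        (ContinuousLinearMap.pi fun _ => px)
    exact (h.gaussian.hasGaussianLaw J).map L
  have := hL.indepFun_of_covariance_eval (X := fun i : I => resid Y c x i) (Y := fun _ : Unit => Y x)
    (fun i _ => h.cov_resid_self x i)
  exact this.comp (φ := id) (ψ := fun u : Unit → ℝ => u ()) measurable_id (measurable_pi_apply _)

lemma map_tilted (h : IsGP Y m c ν) (hY : ∀ p, Measurable (Y p)) {v : ℝ≥0} (hv : 0 < v) (x : ι)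
    (y : ℝ) : (ν.tilted (fun ω => logLik v y (Y x ω))).map (Y x) =
      gaussianReal (m x + c x x / (c x x + v) * (y - m x))
        ((c x x).toNNReal * v / ((c x x).toNNReal + v)) := by
  rw [map_tilted_comp (hY x) (measurable_logLik v y), h.map_eval, gaussianReal_tilted_logLik hv,
    Real.coe_toNNReal _ (h.nonneg x)]

lemma map_prod_tilted (h : IsGP Y m c ν) (hY : ∀ p, Measurable (Y p)) (v : ℝ≥0) (x : ι) (y : ℝ)
    (I : Finset ι) :
    (ν.tilted (fun ω => logLik v y (Y x ω))).map
        (fun ω => ((fun i : I => resid Y c x i ω), Y x ω)) =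
      (ν.map (fun ω (i : I) => resid Y c x i ω)).prod
        ((ν.tilted (fun ω => logLik v y (Y x ω))).map (Y x)) := by
  have := h.isProb
  rw [map_tilted_comp (hY x) (measurable_logLik v y)]
  exact map_prod_tilted_of_indepFun
    (measurable_pi_lambda (fun ω (i : I) => resid Y c x i ω) fun i => measurable_resid hY x i) (hY x)
    (h.indepFun_resid x I) (measurable_logLik v y)

/-- Conditioning a Gaussian process on a noisy observation. -/
theorem tilted (h : IsGP Y m c ν) (hY : ∀ p, Measurable (Y p)) {v : ℝ≥0} (hv : 0 < v) (x : ι)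
    (y : ℝ) :
    IsGP Y (condMean v c m x y) (condCov v c x) (ν.tilted (fun ω => logLik v y (Y x ω))) := by
  have := h.isProb
  have hv' : (0 : ℝ) < v := hv
  set ν' := ν.tilted (fun ω => logLik v y (Y x ω)) with hν'
  have hprob : IsProbabilityMeasure ν' :=
    isProbabilityMeasure_tilted (integrable_exp_logLik (hY x).aemeasurable v y)
  have hR : ∀ I : Finset ι, Measurable (fun ω (i : I) => resid Y c x i ω) := fun I =>
    measurable_pi_lambda _ fun i => measurable_resid hY x i
  have hpair := fun I => h.map_prod_tilted hY v x y I
  have hW := h.map_tilted hY hv x y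
  rw [← hν'] at hpair hW
  have hWg : HasGaussianLaw (Y x) ν' := ⟨by rw [hW]; infer_instance⟩
  -- The weight sees only `Y x`, so the residuals keep their prior law.
  have hRlaw : ∀ I : Finset ι, ν'.map (fun ω (i : I) => resid Y c x i ω) =
      ν.map (fun ω (i : I) => resid Y c x i ω) := fun I => by
    have : IsProbabilityMeasure (ν'.map (Y x)) :=
      Measure.isProbabilityMeasure_map (hY x).aemeasurable
    have h1 := congrArg Measure.fst (hpair I)
    rwa [Measure.fst_map_prodMk (hY x), Measure.fst_prod] at h1
  have hRg : ∀ I : Finset ι, HasGaussianLaw (fun ω (i : I) => resid Y c x i ω) ν' := fun I => by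
    refine ⟨?_⟩
    rw [hRlaw]
    have hg : HasGaussianLaw (fun ω (i : I) => resid Y c x i ω) ν := by
      classical
      let J := insert x I
      let px : (J → ℝ) →L[ℝ] ℝ := ContinuousLinearMap.proj ⟨x, Finset.mem_insert_self _ _⟩
      let pI : (i : I) → (J → ℝ) →L[ℝ] ℝ := fun i =>
        ContinuousLinearMap.proj ⟨i.1, Finset.mem_insert_of_mem i.2⟩
      let L : (J → ℝ) →L[ℝ] (I → ℝ) :=
        ContinuousLinearMap.pi fun i : I => pI i - (c i x / c x x) • px
      exact (h.gaussian.hasGaussianLaw J).map L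
    exact hg.isGaussian_map
  have hindep : ∀ I : Finset ι, IndepFun (fun ω (i : I) => resid Y c x i ω) (Y x) ν' := fun I => by
    rw [indepFun_iff_map_prod_eq_prod_map_map (hR I).aemeasurable (hY x).aemeasurable, hpair I,
      hRlaw I]
  -- Each value is a residual, with its prior law, plus a multiple of an independent variable whose
  -- tilted law is known. Gaussianity, mean and covariance under the tilt all come from this
  -- splitting.
  have hYdec : ∀ p ω, Y p ω = resid Y c x p ω + c p x / c x x * Y x ω := fun p ω => by
    simp [resid]
  have hevR : ∀ p, ν'.map (resid Y c x p) = ν.map (resid Y c x p) := fun p => by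
    have h1 := congrArg (Measure.map fun z : ({p} : Finset ι) → ℝ => z ⟨p, by simp⟩) (hRlaw {p})
    rw [Measure.map_map (measurable_pi_apply _) (hR _),
      Measure.map_map (measurable_pi_apply _) (hR _)] at h1
    exact h1
  have hRL2 : ∀ p, MemLp (resid Y c x p) 2 ν' := fun p =>
    ((hRg {p}).eval ⟨p, by simp⟩).memLp_two
  have hWL2 : MemLp (Y x) 2 ν' := hWg.memLp_two
  have hint : ∀ p, ∫ ω, resid Y c x p ω ∂ν' = m p - c p x / c x x * m x := fun p => by
    have hme := measurable_resid (c := c) hY x p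
    have h1 : ∫ ω, resid Y c x p ω ∂ν' = ∫ ω, resid Y c x p ω ∂ν := by
      have h2 := congrArg (fun μ => ∫ z, z ∂μ) (hevR p)
      rwa [integral_map hme.aemeasurable (by fun_prop),
        integral_map hme.aemeasurable (by fun_prop)] at h2
    rw [h1]
    unfold resid
    rw [integral_sub ((h.memLp p).integrable (by norm_num))
      (((h.memLp x).integrable (by norm_num)).const_mul _), integral_const_mul, h.mean, h.mean]
  have hWmean : ∫ ω, Y x ω ∂ν' = m x + c x x / (c x x + v) * (y - m x) := by
    have h2 := congrArg (fun μ => ∫ z, z ∂μ) hW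
    rwa [integral_map (hY x).aemeasurable (by fun_prop), integral_id_gaussianReal] at h2
  have hWvar : Var[Y x; ν'] = c x x * v / (c x x + v) := by
    have h2 := congrArg (fun μ => Var[id; μ]) hW
    rw [variance_map (by fun_prop) (hY x).aemeasurable, variance_id_gaussianReal] at h2
    simpa [Real.coe_toNNReal _ (h.nonneg x)] using h2
  have hpe : ∀ (I : Finset ι) (i : I), Measurable (fun z : I → ℝ => z i) := fun I i =>
    measurable_pi_apply i
  have hRW : ∀ p, cov[resid Y c x p, Y x; ν'] = 0 := fun p => by
    have h1 := (hindep {p}).comp (φ := fun z : ({p} : Finset ι) → ℝ => z ⟨p, by simp⟩) (ψ := id)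
      (hpe _ _) measurable_id
    exact IndepFun.covariance_eq_zero h1 (hRL2 p) hWL2
  have hRR : ∀ p q, cov[resid Y c x p, resid Y c x q; ν'] = c p q - c p x / c x x * c x q := by
    intro p q
    classical
    have h1 : cov[resid Y c x p, resid Y c x q; ν'] = cov[resid Y c x p, resid Y c x q; ν] := by
      let I : Finset ι := {p, q}
      have h2 := congrArg (fun μ => cov[fun z : I → ℝ => z ⟨p, by simp [I]⟩,
        fun z : I → ℝ => z ⟨q, by simp [I]⟩; μ]) (hRlaw I)
      rwa [covariance_map (hpe _ _).aestronglyMeasurable (hpe _ _).aestronglyMeasurable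
          (hR I).aemeasurable,
        covariance_map (hpe _ _).aestronglyMeasurable (hpe _ _).aestronglyMeasurable
          (hR I).aemeasurable] at h2
    rw [h1, h.cov_resid_left _ _ _ (h.memLp_resid x q), covariance_comm (Y x), h.cov_resid_self,
      covariance_comm (Y p), h.cov_resid_left _ _ _ (h.memLp p), h.cov, h.cov, h.symm q p,
      h.symm q x, h.symm x p]
    ring
  refine ⟨⟨fun I => ?_⟩, fun p => ?_, fun p q => ?_⟩
  · have hj := (hindep I).hasGaussianLaw (hRg I) hWg
    let L : (I → ℝ) × ℝ →L[ℝ] (I → ℝ) := ContinuousLinearMap.pi fun i : I =>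
      (ContinuousLinearMap.proj i).comp (ContinuousLinearMap.fst ℝ (I → ℝ) ℝ) +
        (c i x / c x x) • ContinuousLinearMap.snd ℝ (I → ℝ) ℝ
    have := hj.map L
    refine this.congr (ae_of_all _ fun ω => ?_)
    funext i
    simp [L, hYdec i ω]
  · simp_rw [hYdec p]
    rw [integral_add ((hRL2 p).integrable (by norm_num)) ((hWL2.integrable (by norm_num)).const_mul _),
      integral_const_mul, hint, hWmean, condMean]
    by_cases hx : c x x = 0
    · simp [hx, h.cross_eq_zero hx]
    · field_simp
      ring
  · have h1 : ∀ p, Y p = resid Y c x p + fun ω => c p x / c x x * Y x ω := fun p => by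
      funext ω; exact hYdec p ω
    have h2 : ∀ p, MemLp (fun ω => c p x / c x x * Y x ω) 2 ν' := fun p => hWL2.const_mul _
    rw [h1 p, h1 q, covariance_add_left (hRL2 p) (h2 p) ((hRL2 q).add (h2 q)),
      covariance_add_right (hRL2 p) (hRL2 q) (h2 q), covariance_add_right (h2 p) (hRL2 q) (h2 q),
      covariance_const_mul_left, covariance_const_mul_left, covariance_const_mul_right,
      covariance_const_mul_right, covariance_comm (Y x) (resid Y c x q), hRW, hRW, hRR,
      covariance_self (hY x).aemeasurable, hWvar, condCov, h.symm q x]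
    by_cases hx : c x x = 0
    · simp [hx, h.cross_eq_zero hx]
    · have : c x x + v ≠ 0 := by have := h.nonneg x; positivity
      field_simp
      ring

end IsGP

end GPTS

/-! ### Posterior mean and covariance after several observations, and the determinant identity. -/

namespace GPTS

section Recursion

variable {α : Type*}

/-- The posterior covariance after noisy observations at `xs 0, …, xs (t - 1)`. -/
noncomputable def postCov (v : ℝ≥0) (k : α → α → ℝ) : (t : ℕ) → (Fin t → α) → α → α → ℝ
  | 0, _ => k
  | t + 1, xs => condCov v (postCov v k t fun i => xs i.castSucc) (xs (Fin.last t))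

/-- The posterior mean given the data `D`, for a centred prior. -/
noncomputable def postMean (v : ℝ≥0) (k : α → α → ℝ) : (t : ℕ) → (Fin t → α × ℝ) → α → ℝ
  | 0, _ => fun _ => 0
  | t + 1, D => condMean v (postCov v k t fun i => (D i.castSucc).1)
      (postMean v k t fun i => D i.castSucc) (D (Fin.last t)).1 (D (Fin.last t)).2

/-- The log-likelihood ratio of the data `D` for the objective `h`, relative to pure noise. -/
noncomputable def dataLogLik (v : ℝ≥0) {t : ℕ} (D : Fin t → α × ℝ) (h : α → ℝ) : ℝ :=
  ∑ s, logLik v (D s).2 (h (D s).1)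

lemma dataLogLik_succ (v : ℝ≥0) {t : ℕ} (D : Fin (t + 1) → α × ℝ) (h : α → ℝ) :
    dataLogLik v D h = dataLogLik v (fun i => D i.castSucc) h +
      logLik v (D (Fin.last t)).2 (h (D (Fin.last t)).1) := by
  unfold dataLogLik
  rw [Fin.sum_univ_castSucc]

lemma dataLogLik_le (v : ℝ≥0) {t : ℕ} (D : Fin t → α × ℝ) (h : α → ℝ) :
    dataLogLik v D h ≤ ∑ s, (D s).2 ^ 2 / (2 * v) :=
  Finset.sum_le_sum fun _ _ => logLik_le _ _ _

/-- The recursion conditions on the last point, whereas elimination in the determinant starts with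
the first one; this lemma reconciles the two orders. -/
lemma postCov_cons (v : ℝ≥0) (k : α → α → ℝ) (t : ℕ) (x : ℕ → α) :
    postCov v k (t + 1) (fun i => x i) =
      postCov v (condCov v k (x 0)) t (fun i => x (i + 1)) := by
  induction t with
  | zero => rfl
  | succ t ih =>
    change condCov v (postCov v k (t + 1) fun i => x i) (x (t + 1)) =
      condCov v (postCov v (condCov v k (x 0)) t fun i => x (i + 1)) (x (t + 1))
    rw [ih]

variable [MeasurableSpace α]

lemma measurable_postCov {v : ℝ≥0} {k : α → α → ℝ} (hk : Measurable fun z : α × α => k z.1 z.2)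
    (t : ℕ) : Measurable fun z : (Fin t → α) × α × α => postCov v k t z.1 z.2.1 z.2.2 := by
  induction t with
  | zero => exact hk.comp measurable_snd
  | succ t ih =>
    have h0 : Measurable fun z : (Fin (t + 1) → α) × α × α => fun i : Fin t => z.1 i.castSucc := by
      fun_prop
    have h1 : Measurable fun z : (Fin (t + 1) → α) × α × α => z.1 (Fin.last t) := by fun_prop
    have h2 : ∀ {f g : (Fin (t + 1) → α) × α × α → α}, Measurable f → Measurable g →
        Measurable fun z => postCov v k t (fun i => z.1 i.castSucc) (f z) (g z) := fun hf hg =>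
      ih.comp (h0.prodMk (hf.prodMk hg))
    simp only [postCov, condCov]
    exact (h2 (by fun_prop) (by fun_prop)).sub (((h2 (by fun_prop) h1).mul (h2 h1 (by fun_prop))).div
      ((h2 h1 h1).add_const _))

lemma measurable_postMean {v : ℝ≥0} {k : α → α → ℝ} (hk : Measurable fun z : α × α => k z.1 z.2)
    (t : ℕ) : Measurable fun z : (Fin t → α × ℝ) × α => postMean v k t z.1 z.2 := by
  induction t with
  | zero => exact measurable_const
  | succ t ih =>
    have h0 : Measurable fun z : (Fin (t + 1) → α × ℝ) × α => fun i : Fin t => z.1 i.castSucc := by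
      fun_prop
    have h0' : Measurable fun z : (Fin (t + 1) → α × ℝ) × α =>
        fun i : Fin t => (z.1 i.castSucc).1 := by
      fun_prop
    have h1 : Measurable fun z : (Fin (t + 1) → α × ℝ) × α => (z.1 (Fin.last t)).1 := by fun_prop
    have h2 : ∀ {f g : (Fin (t + 1) → α × ℝ) × α → α}, Measurable f → Measurable g →
        Measurable fun z => postCov v k t (fun i => (z.1 i.castSucc).1) (f z) (g z) := fun hf hg =>
      (measurable_postCov hk t).comp (h0'.prodMk (hf.prodMk hg))
    have h3 : ∀ {f : (Fin (t + 1) → α × ℝ) × α → α}, Measurable f →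
        Measurable fun z => postMean v k t (fun i => z.1 i.castSucc) (f z) := fun hf =>
      ih.comp (h0.prodMk hf)
    simp only [postMean, condMean]
    exact (h3 (by fun_prop)).add (((h2 (by fun_prop) h1).div ((h2 h1 h1).add_const _)).mul
      (Measurable.sub (by fun_prop) (h3 h1)))

end Recursion

namespace IsGP

variable {α Ω : Type*} {mΩ : MeasurableSpace Ω} {Y : α → Ω → ℝ} {m : α → ℝ} {k : α → α → ℝ}
  {ν : Measure Ω} {v : ℝ≥0}

lemma measurable_dataLogLik (hY : ∀ p, Measurable (Y p)) (v : ℝ≥0) {t : ℕ} (D : Fin t → α × ℝ) :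
    Measurable fun ω => dataLogLik v D (fun p => Y p ω) :=
  Finset.measurable_sum _ fun _ _ => (measurable_logLik v _).comp (hY _)

lemma integrable_exp_dataLogLik [IsFiniteMeasure ν] (hY : ∀ p, Measurable (Y p)) (v : ℝ≥0) {t : ℕ}
    (D : Fin t → α × ℝ) :
    Integrable (fun ω => Real.exp (dataLogLik v D (fun p => Y p ω))) ν := by
  refine Integrable.of_bound (C := Real.exp (∑ s, (D s).2 ^ 2 / (2 * v)))
    (measurable_dataLogLik hY v D).exp.aestronglyMeasurable (ae_of_all _ fun ω => ?_)
  rw [Real.norm_eq_abs, abs_of_pos (Real.exp_pos _)]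
  exact Real.exp_le_exp.2 (dataLogLik_le _ _ _)

/-- The posterior of a centred Gaussian process given noisy data. -/
theorem posterior (h : IsGP Y (fun _ => 0) k ν) (hY : ∀ p, Measurable (Y p)) (hv : 0 < v) (t : ℕ)
    (D : Fin t → α × ℝ) :
    IsGP Y (postMean v k t D) (postCov v k t fun i => (D i).1)
      (ν.tilted fun ω => dataLogLik v D (fun p => Y p ω)) := by
  have := h.isProb
  induction t with
  | zero =>
    have h0 : (fun ω => dataLogLik v D (fun p => Y p ω)) = fun _ => (0 : ℝ) := by
      funext ω; simp [dataLogLik]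
    rw [h0, tilted_const]
    exact h
  | succ t ih =>
    have h1 := (ih fun i => D i.castSucc).tilted hY hv (D (Fin.last t)).1 (D (Fin.last t)).2
    rw [tilted_tilted (integrable_exp_dataLogLik hY v _)] at h1
    have h2 : (fun ω => dataLogLik v D (fun p => Y p ω)) =
        (fun ω => dataLogLik v (fun i => D i.castSucc) (fun p => Y p ω)) +
          fun ω => logLik v (D (Fin.last t)).2 (Y (D (Fin.last t)).1 ω) := by
      funext ω; exact dataLogLik_succ _ _ _
    rw [h2]
    exact h1

/-- The observed value `0` is arbitrary, since the covariance update does not depend on it. What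
matters is that posterior covariances are again covariances, so the inequalities for `IsGP` remain
available in inductions. -/
lemma condCov_isGP (h : IsGP Y m k ν) (hY : ∀ p, Measurable (Y p)) (hv : 0 < v) (x : α) :
    ∃ (m' : α → ℝ) (ν' : Measure Ω), IsGP Y m' (condCov v k x) ν' :=
  ⟨_, _, h.tilted hY hv x 0⟩

lemma postCov_isGP (h : IsGP Y m k ν) (hY : ∀ p, Measurable (Y p)) (hv : 0 < v) (t : ℕ)
    (xs : Fin t → α) : ∃ (m' : α → ℝ) (ν' : Measure Ω), IsGP Y m' (postCov v k t xs) ν' := by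
  induction t with
  | zero => exact ⟨m, ν, h⟩
  | succ t ih =>
    obtain ⟨m', ν', h'⟩ := ih fun i => xs i.castSucc
    exact h'.condCov_isGP hY hv _

lemma postCov_nonneg (h : IsGP Y m k ν) (hY : ∀ p, Measurable (Y p)) (hv : 0 < v) (t : ℕ)
    (xs : Fin t → α) (p : α) : 0 ≤ postCov v k t xs p p := by
  obtain ⟨m', ν', h'⟩ := h.postCov_isGP hY hv t xs
  exact h'.nonneg p

lemma condCov_le (h : IsGP Y m k ν) (v : ℝ≥0) (x p : α) : condCov v k x p p ≤ k p p := by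
  unfold condCov
  rw [h.symm x p]
  have := h.nonneg x
  have : 0 ≤ k p x * k p x / (k x x + v) := by
    have := mul_self_nonneg (k p x)
    positivity
  linarith

lemma postCov_le (h : IsGP Y m k ν) (hY : ∀ p, Measurable (Y p)) (hv : 0 < v) (t : ℕ)
    (xs : Fin t → α) (p : α) : postCov v k t xs p p ≤ k p p := by
  induction t with
  | zero => exact le_rfl
  | succ t ih =>
    obtain ⟨m', ν', h'⟩ := h.postCov_isGP hY hv t fun i => xs i.castSucc
    exact (h'.condCov_le v _ p).trans (ih _)

/-- One conditioning step lowers the squared canonical distance by `(c p x - c q x) ^ 2 / (c x x +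
v)`, so the prior distance dominates at all times. -/
lemma postCov_dist_le (h : IsGP Y m k ν) (hY : ∀ p, Measurable (Y p)) (hv : 0 < v) (t : ℕ)
    (xs : Fin t → α) (p q : α) :
    postCov v k t xs p p - 2 * postCov v k t xs p q + postCov v k t xs q q ≤
      k p p - 2 * k p q + k q q := by
  induction t with
  | zero => exact le_rfl
  | succ t ih =>
    obtain ⟨m', ν', h'⟩ := h.postCov_isGP hY hv t fun i => xs i.castSucc
    refine le_trans ?_ (ih fun i => xs i.castSucc)
    set c := postCov v k t fun i => xs i.castSucc
    set x := xs (Fin.last t)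
    change condCov v c x p p - 2 * condCov v c x p q + condCov v c x q q ≤ _
    unfold condCov
    rw [h'.symm x p, h'.symm x q]
    have h1 := h'.nonneg x
    have h2 : 0 ≤ (c p x - c q x) ^ 2 / (c x x + v) := by positivity
    have h3 : (c p x - c q x) ^ 2 / (c x x + v) = c p x * c p x / (c x x + v)
      - 2 * (c p x * c q x / (c x x + v)) + c q x * c q x / (c x x + v) := by ring
    linarith

lemma abs_sqrt_postCov_sub_le (h : IsGP Y m k ν) (hY : ∀ p, Measurable (Y p)) (hv : 0 < v) (t : ℕ)
    (xs : Fin t → α) (p q : α) :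
    |√(postCov v k t xs p p) - √(postCov v k t xs q q)| ≤ √(k p p - 2 * k p q + k q q) := by
  obtain ⟨m', ν', h'⟩ := h.postCov_isGP hY hv t xs
  exact (h'.abs_sqrt_sub_sqrt_le p q).trans
    (Real.sqrt_le_sqrt (h.postCov_dist_le hY hv t xs p q))

/-- Gaussian elimination in the first column: the pivot is the prior variance plus noise, and the
Schur complement is the same matrix for the process conditioned on the first point. -/
lemma det_eq_prod_postCov (h : IsGP Y m k ν) (hY : ∀ p, Measurable (Y p)) (hv : 0 < v) (T : ℕ)
    (x : ℕ → α) :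
    ((v : ℝ) • (1 : Matrix (Fin T) (Fin T) ℝ) + Matrix.of fun i j : Fin T => k (x i) (x j)).det =
      ∏ s ∈ Finset.range T, (v + postCov v k s (fun i => x i) (x s) (x s)) := by
  induction T generalizing k m ν x with
  | zero => simp
  | succ T ih =>
    obtain ⟨m', ν', h'⟩ := h.condCov_isGP hY hv (x 0)
    have h0 : k (x 0) (x 0) + v ≠ 0 := by
      have := h.nonneg (x 0)
      have : (0 : ℝ) < v := hv
      positivity
    rw [Finset.prod_range_succ']
    have h1 := ih h' (fun n => x (n + 1))
    have h2 : ∀ s, postCov v k (s + 1) (fun i => x i) (x (s + 1)) (x (s + 1)) =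
        postCov v (condCov v k (x 0)) s (fun i => x (i + 1)) (x (s + 1)) (x (s + 1)) := fun s => by
      rw [postCov_cons]
    simp only [h2]
    rw [← h1]
    set M : Matrix (Fin (T + 1)) (Fin (T + 1)) ℝ :=
      (v : ℝ) • (1 : Matrix (Fin (T + 1)) (Fin (T + 1)) ℝ) +
        Matrix.of fun i j : Fin (T + 1) => k (x i) (x j)
    have hM : ∀ i j, M i j = (if i = j then (v : ℝ) else 0) + k (x i) (x j) := fun i j => by
      simp [M, Matrix.one_apply]
    -- Multipliers of the row operations: subtracting `a i` times row `0` clears the first column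
    -- below the pivot and turns the remaining entries into those of `condCov`.
    let a : Fin (T + 1) → ℝ := fun i => if i = 0 then 0 else k (x i) (x 0) / (k (x 0) (x 0) + v)
    let N : Matrix (Fin (T + 1)) (Fin (T + 1)) ℝ := fun i j => M i j - a i * M 0 j
    have hMN : M.det = N.det := by
      refine Matrix.det_eq_of_forall_row_eq_smul_add_const a 0 (by simp [a]) fun i j => ?_
      simp [N, a]
    rw [hMN, Matrix.det_succ_column_zero, Fin.sum_univ_succ]
    have hN0 : N 0 0 = v + k (x 0) (x 0) := by simp [N, a, hM]
    have hNs : ∀ i : Fin T, N i.succ 0 = 0 := fun i => by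
      simp only [N, a, hM, Fin.succ_ne_zero, if_false, if_true, zero_add, Fin.val_succ, Fin.val_zero]
      field_simp
      ring
    simp only [hNs, hN0, mul_zero, zero_mul, Finset.sum_const_zero, add_zero, Fin.val_zero, pow_zero,
      one_mul]
    rw [mul_comm]
    congr 2
    ext i j
    have hNij : N i.succ j.succ = (if i = j then (v : ℝ) else 0) +
        condCov v k (x 0) (x (i + 1)) (x (j + 1)) := by
      simp only [N, a, hM, Fin.succ_ne_zero, if_false, condCov, Fin.succ_inj, Fin.val_succ,
        Fin.val_zero, (Fin.succ_ne_zero _).symm]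
      ring
    rw [Matrix.submatrix_apply, Fin.succAbove_zero, hNij]
    simp [Matrix.one_apply]

end IsGP

end GPTS

namespace GPTS

/-! ### Independence -/

section Indep

variable {Ω α β γ : Type*} {mΩ : MeasurableSpace Ω} [MeasurableSpace α] [MeasurableSpace β]
  [MeasurableSpace γ] {P : Measure Ω} [IsProbabilityMeasure P]

lemma indepFun_prodMk_left {A : Ω → α} {B : Ω → β} {C : Ω → γ} (hA : AEMeasurable A P)
    (hB : AEMeasurable B P) (hC : AEMeasurable C P) (h : IndepFun A (fun ω => (B ω, C ω)) P)
    (hBC : IndepFun B C P) : IndepFun (fun ω => (A ω, B ω)) C P := by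
  have hAB : IndepFun A B P := h.comp measurable_id measurable_fst
  have h1 := (indepFun_iff_map_prod_eq_prod_map_map hA (hB.prodMk hC)).1 h
  rw [(indepFun_iff_map_prod_eq_prod_map_map hB hC).1 hBC] at h1
  rw [indepFun_iff_map_prod_eq_prod_map_map (hA.prodMk hB) hC,
    (indepFun_iff_map_prod_eq_prod_map_map hA hB).1 hAB]
  have h2 := congrArg (Measure.map (MeasurableEquiv.prodAssoc (α := α) (β := β) (γ := γ)).symm) h1
  have := Measure.isProbabilityMeasure_map hA
  have := Measure.isProbabilityMeasure_map hB
  have := Measure.isProbabilityMeasure_map hC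
  rw [← Measure.prodAssoc_prod, MeasurableEquiv.map_symm_map,
    AEMeasurable.map_map_of_aemeasurable (by fun_prop) (by fun_prop)] at h2
  exact h2

/-- Drawing `G` by a kernel that reads only `S` brings in no information on `N`; this is how a
posterior draw stays independent of the future noise. -/
lemma indepFun_of_hasCondDistrib {S : Ω → α} {N : Ω → β} {G : Ω → γ} (hS : AEMeasurable S P)
    (hN : AEMeasurable N P) (h : IndepFun S N P) {κ : Kernel α γ} [IsMarkovKernel κ]
    (hG : HasCondDistrib G (fun ω => (S ω, N ω)) (κ.comap (Prod.fst : α × β → α) (by fun_prop)) P) :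
    IndepFun (fun ω => (S ω, G ω)) N P := by
  have hGm : AEMeasurable G P := hG.aemeasurable_snd
  have hlaw : HasCondDistrib G S κ P := hG.comp_right
  have := Measure.isProbabilityMeasure_map hS
  have := Measure.isProbabilityMeasure_map hN
  rw [indepFun_iff_map_prod_eq_prod_map_map (hS.prodMk hGm) hN, hlaw.map_eq]
  have h1 := hG.map_eq
  rw [(indepFun_iff_map_prod_eq_prod_map_map hS hN).1 h] at h1
  have h2 : P.map (fun ω => ((S ω, G ω), N ω)) =
      (P.map (fun ω => ((S ω, N ω), G ω))).map (fun z => ((z.1.1, z.2), z.1.2)) := by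
    rw [AEMeasurable.map_map_of_aemeasurable (by fun_prop) (by fun_prop)]
    rfl
  rw [h2, h1]
  refine Measure.ext_of_lintegral _ fun φ hφ => ?_
  rw [lintegral_map hφ (by fun_prop), Measure.lintegral_compProd (by fun_prop),
    lintegral_prod _ (by
      refine Measurable.aemeasurable ?_
      exact Measurable.lintegral_kernel_prod_right' (κ := κ.comap (Prod.fst : α × β → α) (by fun_prop))
        (f := fun z : (α × β) × γ => φ ((z.1.1, z.2), z.1.2)) (by fun_prop)),
    lintegral_prod _ hφ.aemeasurable, Measure.lintegral_compProd (by
      exact hφ.lintegral_prod_right')]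
  refine lintegral_congr fun s => ?_
  simp only [Kernel.comap_apply]
  rw [lintegral_lintegral_swap]
  exact (by fun_prop : Measurable _).aemeasurable

end Indep

/-! ### The path space -/

section Path

variable {d : ℕ} {X : Set (E d)}

lemma measurable_eval_path (p : X) : Measurable fun h : C(X, ℝ) => h p :=
  (measurable_pi_apply p).comp (comap_measurable _)

/-- Continuity in the point and measurability in the path suffice for joint measurability, because
`X` is a separable metrizable space. -/
lemma measurable_uncurry_path : Measurable fun z : C(X, ℝ) × X => z.1 z.2 := by
  have h := measurable_uncurry_of_continuous_of_measurable (α := C(X, ℝ)) (β := ℝ) (ι := X)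
    (u := fun p h => h p) (fun h => h.continuous) (fun p => measurable_eval_path p)
  exact h.comp measurable_swap

lemma Measurable.path_apply {α : Type*} [MeasurableSpace α] {h : α → C(X, ℝ)} {p : α → X}
    (hh : Measurable h) (hp : Measurable p) : Measurable fun a => h a (p a) :=
  measurable_uncurry_path.comp (hh.prodMk hp)

lemma measurable_snoc {t : ℕ} {α : Type*} [MeasurableSpace α] :
    Measurable fun z : (Fin t → α) × α => (Fin.snoc z.1 z.2 : Fin (t + 1) → α) := by
  refine measurable_pi_iff.2 fun i => ?_
  refine Fin.lastCases ?_ (fun i => ?_) i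
  · simpa using measurable_snd
  · simp only [Fin.snoc_castSucc]
    fun_prop

/-- The likelihood ratio of data `D` for an objective `h`. -/
noncomputable def lik (v : ℝ≥0) {t : ℕ} (z : C(X, ℝ) × (Fin t → X × ℝ)) : ℝ≥0∞ :=
  ENNReal.ofReal (Real.exp (dataLogLik v z.2 z.1))

lemma measurable_dataLogLik_path (v : ℝ≥0) {t : ℕ} :
    Measurable fun z : C(X, ℝ) × (Fin t → X × ℝ) => dataLogLik v z.2 z.1 := by
  refine Finset.measurable_sum _ fun s _ => ?_
  have h1 : Measurable fun z : C(X, ℝ) × (Fin t → X × ℝ) => z.1 (z.2 s).1 :=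
    Measurable.path_apply measurable_fst (by fun_prop)
  have h2 : Measurable fun z : C(X, ℝ) × (Fin t → X × ℝ) => (z.2 s).2 := by fun_prop
  unfold logLik
  exact (((h2.const_mul 2).mul h1).sub (h1.pow_const 2)).div_const _

lemma measurable_lik (v : ℝ≥0) {t : ℕ} : Measurable (lik (X := X) v (t := t)) :=
  (measurable_dataLogLik_path v).exp.ennreal_ofReal

variable {Ω : Type*} [MeasurableSpace Ω] {k : E d → E d → ℝ} {v : ℝ≥0} {f : Ω → C(X, ℝ)}
  {ε : ℕ → Ω → ℝ} {P : Measure Ω}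

/-- The prior is transported to path space, with evaluations as the process, so that the path can be
integrated while the data are held fixed. -/
lemma IsGPModel.isGP (h : IsGPModel k v f ε P) :
    IsGP (fun (p : X) (h : C(X, ℝ)) => h p) (fun _ => 0) (fun p q => k p q) (P.map f) where
  gaussian := ⟨fun I => by
    refine ⟨?_⟩
    have hm : Measurable fun (h : C(X, ℝ)) => I.restrict (fun p => h p) :=
      measurable_pi_lambda _ fun i => measurable_eval_path _
    rw [Measure.map_map hm h.measurable_f]
    exact (h.gaussian.hasGaussianLaw I).isGaussian_map⟩
  mean p := by
    rw [integral_map h.measurable_f.aemeasurable (measurable_eval_path p).aestronglyMeasurable,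
      h.mean_zero]
  cov p q := by
    rw [covariance_map (measurable_eval_path p).aestronglyMeasurable
      (measurable_eval_path q).aestronglyMeasurable h.measurable_f.aemeasurable]
    exact h.covariance p q

/-- No regularity of `k` is assumed; on `X × X` it is an expectation of products of jointly
measurable path values. -/
lemma IsGPModel.measurable_kernel [IsProbabilityMeasure P] (h : IsGPModel k v f ε P) :
    Measurable fun z : X × X => k z.1 z.2 := by
  have hfp : ∀ p : X, Measurable fun ω => f ω p := fun p =>
    (measurable_eval_path p).comp h.measurable_f
  have h1 : (fun z : X × X => k z.1 z.2) = fun z => ∫ ω, f ω z.1 * f ω z.2 ∂P := by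
    funext z
    rw [← h.covariance, covariance_eq_sub, h.mean_zero, zero_mul, sub_zero]
    · rfl
    · exact (h.gaussian.hasGaussianLaw_eval z.1).memLp_two
    · exact (h.gaussian.hasGaussianLaw_eval z.2).memLp_two
  rw [h1]
  refine StronglyMeasurable.measurable ?_
  refine StronglyMeasurable.integral_prod_right (f := fun (z : X × X) ω => f ω z.1 * f ω z.2)
    (Measurable.stronglyMeasurable ?_)
  have hf2 : Measurable fun y : (X × X) × Ω => f y.2 := h.measurable_f.comp measurable_snd
  exact (Measurable.path_apply hf2 (by fun_prop)).mul (Measurable.path_apply hf2 (by fun_prop))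

end Path

end GPTS

/-! ### The joint law of objective and data, and the posterior. -/

namespace GPTS

/-- The normalizing constant of the tilt is the total mass of the weight, so a weighted integral is
this mass times an integral under the tilted law. -/
lemma lintegral_exp_mul_comp {α : Type*} {mα : MeasurableSpace α} {μ : Measure α}
    [IsProbabilityMeasure μ] {ℓ Y : α → ℝ} (hℓ : Measurable ℓ)
    (hexp : Integrable (fun h => Real.exp (ℓ h)) μ) (hY : Measurable Y) {ψ : ℝ → ℝ≥0∞}
    (hψ : Measurable ψ) {G : Measure ℝ} (hG : (μ.tilted ℓ).map Y = G) :
    ∫⁻ h, ENNReal.ofReal (Real.exp (ℓ h)) * ψ (Y h) ∂μ =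
      (∫⁻ h, ENNReal.ofReal (Real.exp (ℓ h)) ∂μ) * ∫⁻ z, ψ z ∂G := by
  have hZpos : 0 < ∫ h, Real.exp (ℓ h) ∂μ := integral_exp_pos hexp
  have hm : Measurable fun h =>
      ENNReal.ofReal (Real.exp (ℓ h) / ∫ x, Real.exp (ℓ x) ∂μ) * ψ (Y h) :=
    ((hℓ.exp.div_const _).ennreal_ofReal).mul (hψ.comp hY)
  rw [← ofReal_integral_eq_lintegral_ofReal hexp (ae_of_all _ fun h => (Real.exp_pos _).le), ← hG,
    lintegral_map hψ hY, lintegral_tilted ℓ (fun h => ψ (Y h)), ← lintegral_const_mul _ hm]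
  refine lintegral_congr fun h => ?_
  rw [← mul_assoc, ← ENNReal.ofReal_mul hZpos.le, mul_div_cancel₀ _ hZpos.ne']

/-- Bayes' rule in integrated form: relative to the product `μ.prod Q` an identity for each fixed
data set `b` suffices, and no conditional law has to be named. -/
lemma lintegral_of_fibre {Ω α β : Type*} {mΩ : MeasurableSpace Ω} [MeasurableSpace α]
    [MeasurableSpace β] {P : Measure Ω} {μ : Measure α} {Q : Measure β} [SFinite μ] [SFinite Q]
    {f : Ω → α} {D : Ω → β} (hfD : AEMeasurable (fun ω => (f ω, D ω)) P) {l : α × β → ℝ≥0∞}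
    (hlaw : P.map (fun ω => (f ω, D ω)) = (μ.prod Q).withDensity l) (hl : Measurable l)
    {Y : α × β → ℝ≥0∞} {Z : β → ℝ≥0∞} (hY : Measurable Y) (hZ : Measurable Z)
    (h : ∀ b, ∫⁻ a, l (a, b) * Y (a, b) ∂μ = (∫⁻ a, l (a, b) ∂μ) * Z b) :
    ∫⁻ ω, Y (f ω, D ω) ∂P = ∫⁻ ω, Z (D ω) ∂P := by
  have hZ' : Measurable fun z : α × β => Z z.2 := hZ.comp measurable_snd
  rw [← lintegral_map' hY.aemeasurable hfD,
    ← lintegral_map' (f := fun z : α × β => Z z.2) hZ'.aemeasurable hfD, hlaw,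
    lintegral_withDensity_eq_lintegral_mul _ hl hY, lintegral_withDensity_eq_lintegral_mul _ hl hZ',
    lintegral_prod_symm' _ (hl.mul hY), lintegral_prod_symm' _ (hl.mul hZ')]
  refine lintegral_congr fun b => ?_
  simp only [Pi.mul_apply]
  have hlb : Measurable fun a => l (a, b) := hl.comp (by fun_prop)
  rw [h, lintegral_mul_const _ hlb]

lemma data_succ {d : ℕ} {X : Set (E d)} {Ω : Type*} (f : Ω → C(X, ℝ)) (ε : ℕ → Ω → ℝ)
    (x : ℕ → Ω → X) (t : ℕ) (ω : Ω) :
    data f ε x (t + 1) ω = Fin.snoc (data f ε x t ω) (x t ω, f ω (x t ω) + ε t ω) := by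
  funext i
  refine Fin.lastCases ?_ (fun i => ?_) i
  · simp [data]
  · simp [data]

section RunLaw

variable {d : ℕ} {X : Set (E d)} {Ω : Type*} [MeasurableSpace Ω] {k : E d → E d → ℝ} {v : ℝ≥0}
  {f : Ω → C(X, ℝ)} {ε : ℕ → Ω → ℝ} {g : ℕ → Ω → C(X, ℝ)} {x : ℕ → Ω → X} {P : Measure Ω}

namespace IsThompsonSampling

lemma aemeasurable_history (hs : IsThompsonSampling f ε g x P) (t : ℕ) :
    AEMeasurable (history f ε g x t) P := by
  obtain ⟨post, _, _, h⟩ := hs.posterior_sample t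
  exact h.aemeasurable_fst

lemma aemeasurable_f (hs : IsThompsonSampling f ε g x P) : AEMeasurable f P :=
  (hs.aemeasurable_history 0).fst.fst

lemma aemeasurable_data (hs : IsThompsonSampling f ε g x P) (t : ℕ) :
    AEMeasurable (data f ε x t) P :=
  (hs.aemeasurable_history t).snd

variable [IsProbabilityMeasure P]

/-- The draw `g_t` given the objective, the data and the future noise. -/
lemma hasCondDistrib_noise (t : ℕ) (I : Finset ℕ)
    {post : Kernel (Fin t → X × ℝ) C(X, ℝ)} [IsMarkovKernel post]
    (hg : HasCondDistrib (g t) (history f ε g x t) (post.comap Prod.snd (by fun_prop)) P) :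
    HasCondDistrib (g t) (fun ω => ((f ω, data f ε x t ω), fun i : I => ε i ω))
      ((post.comap (Prod.snd : C(X, ℝ) × (Fin t → X × ℝ) → _) (by fun_prop)).comap
        (Prod.fst : _ × (I → ℝ) → _) (by fun_prop)) P := by
  let ψ : (C(X, ℝ) × (ℕ → ℝ) × (Fin t → C(X, ℝ))) × (Fin t → X × ℝ) →
      (C(X, ℝ) × (Fin t → X × ℝ)) × (I → ℝ) := fun z => ((z.1.1, z.2), fun i => z.1.2.1 i)
  have hψ : Measurable ψ := by
    refine Measurable.prodMk (by fun_prop) (measurable_pi_lambda _ fun i => ?_)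
    exact (measurable_pi_apply _).comp (by fun_prop)
  exact HasCondDistrib.comp_right (f := ψ) (hf := hψ)
    (κ := (post.comap (Prod.snd : C(X, ℝ) × (Fin t → X × ℝ) → _) (by fun_prop)).comap
        (Prod.fst : _ × (I → ℝ) → _) (by fun_prop)) hg

lemma hasCondDistrib_pair (t : ℕ)
    {post : Kernel (Fin t → X × ℝ) C(X, ℝ)} [IsMarkovKernel post]
    (hg : HasCondDistrib (g t) (history f ε g x t) (post.comap Prod.snd (by fun_prop)) P) :
    HasCondDistrib (g t) (fun ω => (f ω, data f ε x t ω))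
      (post.comap (Prod.snd : C(X, ℝ) × (Fin t → X × ℝ) → _) (by fun_prop)) P :=
  (hasCondDistrib_noise t ∅ hg).comp_right

/-- The map sending `((f, D_t), g_t, ε_t)` to `(f, D_{t+1})`. -/
def nextState {t : ℕ} (select : (Fin t → X × ℝ) × C(X, ℝ) → X)
    (z : ((C(X, ℝ) × (Fin t → X × ℝ)) × C(X, ℝ)) × ℝ) : C(X, ℝ) × (Fin (t + 1) → X × ℝ) :=
  (z.1.1.1, Fin.snoc z.1.1.2
    (select (z.1.1.2, z.1.2), z.1.1.1 (select (z.1.1.2, z.1.2)) + z.2))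

lemma measurable_nextState {t : ℕ} {select : (Fin t → X × ℝ) × C(X, ℝ) → X}
    (hsel : Measurable select) : Measurable (nextState select) := by
  have h1 : Measurable fun z : ((C(X, ℝ) × (Fin t → X × ℝ)) × C(X, ℝ)) × ℝ =>
      select (z.1.1.2, z.1.2) := hsel.comp (by fun_prop)
  have h2 : Measurable fun z : ((C(X, ℝ) × (Fin t → X × ℝ)) × C(X, ℝ)) × ℝ =>
      z.1.1.1 (select (z.1.1.2, z.1.2)) := Measurable.path_apply (by fun_prop) h1
  have h3 : Measurable fun z : ((C(X, ℝ) × (Fin t → X × ℝ)) × C(X, ℝ)) × ℝ => z.1.1.2 := by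
    fun_prop
  have h4 := measurable_snoc.comp (h3.prodMk (h1.prodMk (h2.add measurable_snd)))
  exact Measurable.prodMk (by fun_prop) h4

lemma measurable_restrict_apply (I : Finset ℕ) (i : I) : Measurable fun z : I → ℝ => z i :=
  measurable_pi_apply i

/-- Future noise is independent of the objective and the past data. -/
lemma indepFun_noise (hm : IsGPModel k v f ε P) (hs : IsThompsonSampling f ε g x P) (t N : ℕ) :
    IndepFun (fun ω => (f ω, data f ε x t ω)) (fun ω (i : Finset.Ico t N) => ε i ω) P := by
  have hεm : ∀ I : Finset ℕ, AEMeasurable (fun ω (i : I) => ε i ω) P := fun I =>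
    aemeasurable_pi_lambda _ fun i => (hm.noise_law i).aemeasurable
  induction t generalizing N with
  | zero =>
    have h := hm.noise_indep_f.comp (φ := fun h : C(X, ℝ) => (h, (Fin.elim0 : Fin 0 → X × ℝ)))
      (ψ := fun (e : ℕ → ℝ) (i : Finset.Ico 0 N) => e i) (by fun_prop) (by fun_prop)
    refine h.congr (ae_of_all _ fun ω => ?_) (ae_of_all _ fun ω => rfl)
    exact Prod.ext rfl (Subsingleton.elim _ _)
  | succ t ih =>
    obtain ⟨post, _, -, hg⟩ := hs.posterior_sample t
    obtain ⟨select, hsel, -, hx⟩ := hs.argmax t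
    -- The block of noise must contain index `t` even when `N ≤ t`, since round `t` consumes it.
    let M := max N (t + 1)
    have htM : t < M := lt_of_lt_of_le (Nat.lt_succ_self t) (le_max_right _ _)
    have h1 := indepFun_of_hasCondDistrib
      (hs.aemeasurable_f.prodMk (hs.aemeasurable_data t)) (hεm _) (ih M)
      (hasCondDistrib_noise t _ hg)
    have h2 := h1.comp (φ := id) (ψ := fun e : Finset.Ico t M → ℝ =>
        (e ⟨t, by simp [htM]⟩, fun i : Finset.Ico (t + 1) N => e ⟨i, by
          have := Finset.mem_Ico.1 i.2
          exact Finset.mem_Ico.2 ⟨by omega, lt_of_lt_of_le this.2 (le_max_left _ _)⟩⟩))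
      measurable_id (Measurable.prodMk (measurable_restrict_apply _ _)
        (measurable_pi_lambda _ fun i => measurable_restrict_apply _ _))
    have h3 : IndepFun (ε t) (fun ω (i : Finset.Ico (t + 1) N) => ε i ω) P := by
      have := hm.noise_indep.indepFun_finset₀ {t} (Finset.Ico (t + 1) N) (by simp)
        (fun i => (hm.noise_law i).aemeasurable)
      exact this.comp (φ := fun e : ({t} : Finset ℕ) → ℝ => e ⟨t, by simp⟩) (ψ := id)
        (measurable_restrict_apply _ _) measurable_id
    have h4 := indepFun_prodMk_left
      ((hs.aemeasurable_f.prodMk (hs.aemeasurable_data t)).prodMk hg.aemeasurable_snd)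
      (hm.noise_law t).aemeasurable (hεm _) h2 h3
    have h5 := h4.comp (measurable_nextState hsel) measurable_id
    refine h5.congr (ae_of_all _ fun ω => ?_) (ae_of_all _ fun ω => rfl)
    simp only [Function.comp_apply, nextState, data_succ, hx ω]

lemma indepFun_draw_noise (hm : IsGPModel k v f ε P) (hs : IsThompsonSampling f ε g x P) (t : ℕ)
    {post : Kernel (Fin t → X × ℝ) C(X, ℝ)} [IsMarkovKernel post]
    (hg : HasCondDistrib (g t) (history f ε g x t) (post.comap Prod.snd (by fun_prop)) P) :
    IndepFun (fun ω => ((f ω, data f ε x t ω), g t ω)) (ε t) P := by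
  have hεm : ∀ I : Finset ℕ, AEMeasurable (fun ω (i : I) => ε i ω) P := fun I =>
    aemeasurable_pi_lambda _ fun i => (hm.noise_law i).aemeasurable
  have h1 := indepFun_of_hasCondDistrib
    (hs.aemeasurable_f.prodMk (hs.aemeasurable_data t)) (hεm _) (indepFun_noise hm hs t (t + 1))
    (hasCondDistrib_noise t _ hg)
  exact h1.comp (φ := id) (ψ := fun e : Finset.Ico t (t + 1) → ℝ => e ⟨t, by simp⟩)
    measurable_id (measurable_restrict_apply _ _)

lemma lik_snoc (v : ℝ≥0) {t : ℕ} (h : C(X, ℝ)) (D : Fin t → X × ℝ) (p : X) (y : ℝ) :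
    lik v (h, (Fin.snoc D (p, y) : Fin (t + 1) → X × ℝ)) =
      lik v (h, D) * ENNReal.ofReal (Real.exp (logLik v y (h p))) := by
  unfold lik
  rw [dataLogLik_succ, Real.exp_add, ENNReal.ofReal_mul (Real.exp_pos _).le]
  simp

/-- Change of measure: relative to a law under which the data are independent of the objective,
the joint law of objective and data has the likelihood ratio as density. -/
theorem exists_law_data (hm : IsGPModel k v f ε P) (hs : IsThompsonSampling f ε g x P) (hv : 0 < v)
    (t : ℕ) : ∃ Q : Measure (Fin t → X × ℝ), IsProbabilityMeasure Q ∧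
      P.map (fun ω => (f ω, data f ε x t ω)) = ((P.map f).prod Q).withDensity (lik v) := by
  have hfprob := Measure.isProbabilityMeasure_map (μ := P) hs.aemeasurable_f
  induction t with
  | zero =>
    refine ⟨Measure.dirac Fin.elim0, inferInstance, ?_⟩
    have h0 : (lik v : C(X, ℝ) × (Fin 0 → X × ℝ) → ℝ≥0∞) = 1 := by
      funext z; simp [lik, dataLogLik]
    rw [h0, withDensity_one]
    have h1 : (fun ω => (f ω, data f ε x 0 ω)) =
        (fun h : C(X, ℝ) => (h, (Fin.elim0 : Fin 0 → X × ℝ))) ∘ f := by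
      funext ω; exact Prod.ext rfl (Subsingleton.elim _ _)
    rw [h1, ← AEMeasurable.map_map_of_aemeasurable (by fun_prop) hs.aemeasurable_f,
      Measure.prod_dirac]
  | succ t ih =>
    obtain ⟨Q, hQ, hlaw⟩ := ih
    obtain ⟨post, _, -, hg⟩ := hs.posterior_sample t
    obtain ⟨select, hsel, -, hx⟩ := hs.argmax t
    let step : ((Fin t → X × ℝ) × C(X, ℝ)) × ℝ → (Fin (t + 1) → X × ℝ) :=
      fun z => Fin.snoc z.1.1 (select z.1, z.2)
    have hstep : Measurable step := measurable_snoc.comp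
      (Measurable.prodMk (by fun_prop) ((hsel.comp measurable_fst).prodMk measurable_snd))
    -- The reference law runs the same algorithm on pure noise: the draw and the query are made as
    -- before, but the observation is `N(0, v)` without the objective.
    refine ⟨((Q ⊗ₘ post).prod (gaussianReal 0 v)).map step,
      Measure.isProbabilityMeasure_map hstep.aemeasurable, ?_⟩
    have hfD := hs.aemeasurable_f.prodMk (hs.aemeasurable_data t)
    have hnext := measurable_nextState hsel
    have h1 : (fun ω => (f ω, data f ε x (t + 1) ω)) =
        nextState select ∘ fun ω => (((f ω, data f ε x t ω), g t ω), ε t ω) := by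
      funext ω
      simp only [Function.comp_apply, nextState, data_succ, hx ω]
    have hεt := (hm.noise_law t).aemeasurable
    rw [h1, ← AEMeasurable.map_map_of_aemeasurable hnext.aemeasurable
        ((hfD.prodMk hg.aemeasurable_snd).prodMk hεt),
      (indepFun_iff_map_prod_eq_prod_map_map (hfD.prodMk hg.aemeasurable_snd) hεt).1
        (indepFun_draw_noise hm hs t hg), (hm.noise_law t).map_eq,
      (hasCondDistrib_pair t hg).map_eq, hlaw]
    refine Measure.ext_of_lintegral _ fun φ hφ => ?_
    have hlm := measurable_lik (X := X) v (t := t)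
    have hlm' := measurable_lik (X := X) v (t := t + 1)
    have := Measure.isFiniteMeasure_map P (fun ω => (f ω, data f ε x t ω))
    rw [hlaw] at this
    rw [lintegral_map hφ hnext, lintegral_prod (fun a => φ (nextState select a))
        (hφ.comp hnext).aemeasurable,
      Measure.lintegral_compProd (by exact (hφ.comp hnext).lintegral_prod_right'),
      lintegral_withDensity_eq_lintegral_mul _ hlm (by
        exact Measurable.lintegral_kernel_prod_right'
          (κ := post.comap (Prod.snd : C(X, ℝ) × (Fin t → X × ℝ) → _) (by fun_prop))
          ((hφ.comp hnext).lintegral_prod_right')),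
      lintegral_withDensity_eq_lintegral_mul _ hlm' hφ]
    rw [lintegral_prod _ (by
        refine (hlm.mul ?_).aemeasurable
        exact Measurable.lintegral_kernel_prod_right'
          (κ := post.comap (Prod.snd : C(X, ℝ) × (Fin t → X × ℝ) → _) (by fun_prop))
          ((hφ.comp hnext).lintegral_prod_right')),
      lintegral_prod _ (hlm'.mul hφ).aemeasurable]
    refine lintegral_congr fun h => ?_
    have hF : Measurable fun D : Fin (t + 1) → X × ℝ => (lik v * φ : C(X, ℝ) × (Fin (t + 1) → X × ℝ) → ℝ≥0∞) (h, D) :=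
      (hlm'.mul hφ).comp (by fun_prop)
    rw [lintegral_map hF hstep, lintegral_prod (fun a => (lik v *
        φ : C(X, ℝ) × (Fin (t + 1) → X × ℝ) → ℝ≥0∞) (h, step a)) (hF.comp hstep).aemeasurable,
      Measure.lintegral_compProd (by exact (hF.comp hstep).lintegral_prod_right')]
    refine lintegral_congr fun D => ?_
    simp only [Pi.mul_apply, Kernel.comap_apply]
    rw [← lintegral_const_mul _ (by
      have : Measurable fun b : C(X, ℝ) => ((h, D), b) := by fun_prop
      exact ((hφ.comp hnext).lintegral_prod_right').comp this)]
    refine lintegral_congr fun b => ?_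
    have hφp : Measurable fun y : ℝ => φ (h, Fin.snoc D (select (D, b), y)) :=
      hφ.comp (measurable_const.prodMk (measurable_snoc.comp
        (measurable_const.prodMk (measurable_const.prodMk measurable_id))))
    simp only [nextState, step, lik_snoc]
    have hmap := gaussianReal_map_const_add (μ := 0) (v := v) (h (select (D, b)))
    rw [zero_add, gaussianReal_eq_withDensity_logLik hv (h (select (D, b)))] at hmap
    have hllm : Measurable fun y => ENNReal.ofReal (Real.exp (logLik v y (h (select (D, b))))) := by
      unfold logLik; fun_prop
    -- Shifting the noise by the value of the objective at the query is the same as weighting pure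
    -- noise by the likelihood ratio, which is the new factor of `lik`.
    have h2 : ∫⁻ e, φ (h, Fin.snoc D (select (D, b), h (select (D, b)) + e)) ∂(gaussianReal 0 v) =
        ∫⁻ y, ENNReal.ofReal (Real.exp (logLik v y (h (select (D, b))))) *
          φ (h, Fin.snoc D (select (D, b), y)) ∂(gaussianReal 0 v) := by
      rw [← lintegral_map (f := fun y => φ (h, Fin.snoc D (select (D, b), y)))
        (g := fun e => h (select (D, b)) + e) hφp (by fun_prop), hmap,
        lintegral_withDensity_eq_lintegral_mul _ hllm hφp]
      rfl
    have h3 : Measurable fun y => ENNReal.ofReal (Real.exp (logLik v y (h (select (D, b))))) *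
      φ (h, Fin.snoc D (select (D, b), y)) := hllm.mul hφp
    rw [h2, ← lintegral_const_mul _ h3]
    refine lintegral_congr fun y => ?_
    rw [mul_assoc]

/-- Bayes' rule for fixed data: weighting the prior by the likelihood gives the posterior. -/
lemma lintegral_lik_mul (hm : IsGPModel k v f ε P) (hv : 0 < v) {t : ℕ} (D : Fin t → X × ℝ)
    (p : X) {ψ : ℝ → ℝ≥0∞} (hψ : Measurable ψ) :
    ∫⁻ h, lik v (h, D) * ψ (h p) ∂(P.map f) = (∫⁻ h, lik v (h, D) ∂(P.map f)) *
      ∫⁻ z, ψ z ∂(gaussianReal (postMean v (fun p q : X => k p q) t D p)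
        (postCov v (fun p q : X => k p q) t (fun i => (D i).1) p p).toNNReal) := by
  have hfprob := Measure.isProbabilityMeasure_map (μ := P) hm.measurable_f.aemeasurable
  exact lintegral_exp_mul_comp (IsGP.measurable_dataLogLik measurable_eval_path v D)
    (IsGP.integrable_exp_dataLogLik measurable_eval_path v D) (measurable_eval_path p) hψ
    ((hm.isGP.posterior measurable_eval_path hv t D).map_eval p)

/-- Given the data `D_t`, the value `f(p)` is Gaussian with the posterior mean and variance. -/
theorem lintegral_posterior (hm : IsGPModel k v f ε P) (hs : IsThompsonSampling f ε g x P)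
    (hv : 0 < v) (t : ℕ) (p : X) {φ : ℝ × (Fin t → X × ℝ) → ℝ≥0∞} (hφ : Measurable φ) :
    ∫⁻ ω, φ (f ω p, data f ε x t ω) ∂P = ∫⁻ ω, ∫⁻ z, φ (z, data f ε x t ω)
      ∂(gaussianReal (postMean v (fun p q : X => k p q) t (data f ε x t ω) p)
        (postCov v (fun p q : X => k p q) t (fun i => (data f ε x t ω i).1) p p).toNNReal) ∂P := by
  obtain ⟨Q, hQ, hlaw⟩ := exists_law_data hm hs hv t
  have hfD := hs.aemeasurable_f.prodMk (hs.aemeasurable_data t)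
  have hfprob := Measure.isProbabilityMeasure_map (μ := P) hs.aemeasurable_f
  have hlm := measurable_lik (X := X) v (t := t)
  have hfib : ∀ D : Fin t → X × ℝ, ∫⁻ h, lik v (h, D) * φ (h p, D) ∂(P.map f) = _ := fun D =>
    lintegral_lik_mul hm hv D p (ψ := fun z => φ (z, D)) (hφ.comp (by fun_prop))
  have hmean : Measurable fun D : Fin t → X × ℝ => postMean v (fun p q : X => k p q) t D p :=
    (measurable_postMean hm.measurable_kernel t).comp (measurable_id.prodMk measurable_const)
  have hfst : Measurable fun (D : Fin t → X × ℝ) (i : Fin t) => (D i).1 :=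
    measurable_pi_lambda _ fun i => by fun_prop
  have hvar : Measurable fun D : Fin t → X × ℝ =>
      postCov v (fun p q : X => k p q) t (fun i => (D i).1) p p :=
    (measurable_postCov hm.measurable_kernel t).comp
      (hfst.prodMk (measurable_const (a := (p, p))))
  -- The posterior normal laws are packed into one kernel, which makes their integrals measurable in
  -- the data.
  obtain ⟨N, hN⟩ : ∃ N : Kernel (Fin t → X × ℝ) ℝ, ∀ D, N D =
      gaussianReal (postMean v (fun p q : X => k p q) t D p)
        (postCov v (fun p q : X => k p q) t (fun i => (D i).1) p p).toNNReal :=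
    ⟨⟨_, measurable_gaussianReal.comp (hmean.prodMk hvar.real_toNNReal)⟩, fun _ => rfl⟩
  have : IsMarkovKernel N := ⟨fun D => by rw [hN]; infer_instance⟩
  simp only [← hN] at hfib ⊢
  clear hN hmean hvar
  exact lintegral_of_fibre hfD hlaw hlm (Y := fun z => φ (z.1 p, z.2))
    (Z := fun D => ∫⁻ z, φ (z, D) ∂(N D))
    (hφ.comp (((measurable_eval_path p).comp measurable_fst).prodMk measurable_snd))
    (Measurable.lintegral_kernel_prod_right' (κ := N) (f := fun z => φ (z.2, z.1))
      (hφ.comp measurable_swap)) hfib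

end IsThompsonSampling

end RunLaw

end GPTS

namespace GPTS

/-! ### Exchangeability of the objective and a posterior draw -/

section Exchange

variable {Ω α β : Type*} {mΩ : MeasurableSpace Ω} [MeasurableSpace α] [MeasurableSpace β]
  {P : Measure Ω} [IsProbabilityMeasure P] {f g : Ω → α} {D : Ω → β} {post : Kernel β α}
  [IsMarkovKernel post]

/-- Replaces the draw by an integral against `post`, so that afterwards only the objective and the
data are random. -/
lemma lintegral_draw (hg : HasCondDistrib g (fun ω => (f ω, D ω))
      (post.comap (Prod.snd : α × β → β) (by fun_prop)) P)
    {φ : (α × β) × α → ℝ≥0∞} (hφ : Measurable φ) :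
    ∫⁻ ω, φ ((f ω, D ω), g ω) ∂P = ∫⁻ ω, ∫⁻ a, φ ((f ω, D ω), a) ∂(post (D ω)) ∂P := by
  have h1 : ∫⁻ ω, φ ((f ω, D ω), g ω) ∂P =
      ∫⁻ z, φ z ∂(P.map fun ω => ((f ω, D ω), g ω)) := by
    rw [lintegral_map' hφ.aemeasurable (hg.aemeasurable_fst.prodMk hg.aemeasurable_snd)]
  have h2 : Measurable fun z : α × β => ∫⁻ a, φ (z, a)
      ∂((post.comap (Prod.snd : α × β → β) (by fun_prop)) z) :=
    Measurable.lintegral_kernel_prod_right' hφ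
  rw [h1, hg.map_eq, Measure.lintegral_compProd hφ, lintegral_map' h2.aemeasurable
    hg.aemeasurable_fst]
  rfl

/-- Given the data, the objective and a posterior draw have the same law. -/
theorem lintegral_exchange (hf : HasCondDistrib f D post P)
    (hg : HasCondDistrib g (fun ω => (f ω, D ω))
      (post.comap (Prod.snd : α × β → β) (by fun_prop)) P)
    {φ : (α × β) × α → ℝ≥0∞} (hφ : Measurable φ) :
    ∫⁻ ω, φ ((f ω, D ω), g ω) ∂P = ∫⁻ ω, φ ((g ω, D ω), f ω) ∂P := by
  -- Given the data, objective and draw are two independent samples from `post`; in the iterated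
  -- integral they can be swapped by Tonelli.
  have key : ∀ {φ : (α × β) × α → ℝ≥0∞}, Measurable φ → ∫⁻ ω, φ ((f ω, D ω), g ω) ∂P =
      ∫⁻ d, ∫⁻ b, ∫⁻ a, φ ((b, d), a) ∂(post d) ∂(post d) ∂(P.map D) := fun {φ} hφ => by
    have h2 : Measurable fun z : β × α => ∫⁻ a, φ ((z.2, z.1), a) ∂(post z.1) :=
      Measurable.lintegral_kernel_prod_right' (κ := post.comap (Prod.fst : β × α → β) (by fun_prop))
        (f := fun y : (β × α) × α => φ ((y.1.2, y.1.1), y.2)) (by fun_prop)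
    have h3 : ∫⁻ ω, ∫⁻ a, φ ((f ω, D ω), a) ∂(post (D ω)) ∂P =
        ∫⁻ z, ∫⁻ a, φ ((z.2, z.1), a) ∂(post z.1) ∂(P.map fun ω => (D ω, f ω)) := by
      rw [lintegral_map' h2.aemeasurable (hf.aemeasurable_fst.prodMk hf.aemeasurable_snd)]
    rw [lintegral_draw hg hφ, h3, hf.map_eq, Measure.lintegral_compProd h2]
  have h4 := key (φ := fun z => φ ((z.2, z.1.2), z.1.1)) (by fun_prop)
  simp only at h4
  rw [key hφ, h4]
  refine lintegral_congr fun d => ?_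
  exact lintegral_lintegral_swap (by
    refine Measurable.aemeasurable ?_
    exact hφ.comp (by fun_prop : Measurable fun z : α × α => ((z.1, d), z.2)))

end Exchange

/-! ### Moments of Gaussian laws -/

section GaussianMoments

lemma lintegral_sq_sub_gaussianReal (m : ℝ) (s : ℝ≥0) :
    ∫⁻ z, ENNReal.ofReal ((z - m) ^ 2) ∂(gaussianReal m s) = s := by
  have h1 := variance_id_gaussianReal (μ := m) (v := s)
  rw [variance_eq_integral aemeasurable_id] at h1
  simp only [id_eq, integral_id_gaussianReal] at h1
  rw [← ofReal_integral_eq_lintegral_ofReal, h1, ENNReal.ofReal_coe_nnreal]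
  · exact ((memLp_id_gaussianReal 2).sub (memLp_const m)).integrable_sq
  · exact ae_of_all _ fun _ => sq_nonneg _

/-- The standard normal density. -/
noncomputable def stdPDF (z : ℝ) : ℝ := Real.exp (-z ^ 2 / 2) / √(2 * Real.pi)

lemma gaussianPDFReal_zero_one (z : ℝ) : gaussianPDFReal 0 1 z = stdPDF z := by
  simp [gaussianPDFReal, stdPDF, div_eq_inv_mul, mul_comm]

lemma stdPDF_pos (z : ℝ) : 0 < stdPDF z := by
  unfold stdPDF
  positivity

lemma hasDerivAt_stdPDF (z : ℝ) : HasDerivAt stdPDF (-z * stdPDF z) z := by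
  have h1 : HasDerivAt (fun z : ℝ => -z ^ 2 / 2) (-z) z := by
    have := ((hasDerivAt_pow 2 z).neg).div_const 2
    refine this.congr_deriv ?_
    push_cast
    ring
  refine ((h1.exp).div_const (√(2 * Real.pi))).congr_deriv ?_
  unfold stdPDF
  ring

lemma tendsto_mul_stdPDF : Tendsto (fun z => z * stdPDF z) atTop (nhds 0) := by
  have h1 : Tendsto (fun z : ℝ => z * Real.exp (-z)) atTop (nhds 0) := by
    simpa using Real.tendsto_pow_mul_exp_neg_atTop_nhds_zero 1
  have h2 := h1.div_const (√(2 * Real.pi))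
  rw [zero_div] at h2
  refine squeeze_zero' (eventually_atTop.2 ⟨0, fun z hz => mul_nonneg hz (stdPDF_pos z).le⟩)
    (eventually_atTop.2 ⟨2, fun z hz => ?_⟩) h2
  unfold stdPDF
  rw [mul_div_assoc]
  have : Real.exp (-z ^ 2 / 2) ≤ Real.exp (-z) := Real.exp_le_exp.2 (by nlinarith)
  gcongr

/-- The function `-(z * stdPDF z)` is a primitive of the integrand, which is nonnegative on the
half-line because `1 ≤ u`. -/
lemma lintegral_Ioi_sq_sub_one {u : ℝ} (hu : 1 ≤ u) :
    ∫⁻ z in Ioi u, ENNReal.ofReal ((z ^ 2 - 1) * stdPDF z) = ENNReal.ofReal (u * stdPDF u) := by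
  have hd : ∀ z : ℝ, HasDerivAt (fun z => -(z * stdPDF z)) ((z ^ 2 - 1) * stdPDF z) z := fun z => by
    have := ((hasDerivAt_id z).mul (hasDerivAt_stdPDF z)).neg
    refine this.congr_deriv ?_
    simp only [id_eq]
    ring
  have hpos : ∀ z ∈ Ioi u, 0 ≤ (z ^ 2 - 1) * stdPDF z := fun z hz => by
    have : u < z := hz
    exact mul_nonneg (by nlinarith) (stdPDF_pos z).le
  have ht : Tendsto (fun z => -(z * stdPDF z)) atTop (nhds 0) := by
    simpa using tendsto_mul_stdPDF.neg
  have h1 := integral_Ioi_of_hasDerivAt_of_nonneg' (fun z _ => hd z) hpos ht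
  have h2 := integrableOn_Ioi_deriv_of_nonneg' (fun z _ => hd z) hpos ht
  rw [← ofReal_integral_eq_lintegral_ofReal h2
    ((ae_restrict_iff' measurableSet_Ioi).2 (ae_of_all _ hpos)), h1]
  simp

/-- The integrand lives on two symmetric tails beyond `√β`, and there `z ^ 2 - β ≤ z ^ 2 - 1`, which
integrates in closed form. -/
lemma lintegral_sq_sub_stdGaussian {β : ℝ} (hβ : 1 ≤ β) :
    ∫⁻ z, ENNReal.ofReal (z ^ 2 - β) ∂(gaussianReal 0 1) ≤
      ENNReal.ofReal (2 * √β * stdPDF (√β)) := by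
  have hβ0 : 0 ≤ β := by linarith
  have h1 : 1 ≤ √β := Real.one_le_sqrt.2 hβ
  have hm : Measurable fun z : ℝ => ENNReal.ofReal (z ^ 2 - β) := by fun_prop
  have hIoi : ∫⁻ z in Ioi (√β), ENNReal.ofReal (z ^ 2 - β) ∂(gaussianReal 0 1) ≤
      ENNReal.ofReal (√β * stdPDF (√β)) := by
    rw [← lintegral_Ioi_sq_sub_one h1, gaussianReal_of_var_ne_zero _ one_ne_zero,
      restrict_withDensity measurableSet_Ioi,
      lintegral_withDensity_eq_lintegral_mul _ (measurable_gaussianPDF 0 1) hm]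
    refine setLIntegral_mono' measurableSet_Ioi fun z hz => ?_
    have hz' : √β < z := hz
    simp only [Pi.mul_apply, gaussianPDF, gaussianPDFReal_zero_one]
    rw [← ENNReal.ofReal_mul (stdPDF_pos z).le, mul_comm]
    refine ENNReal.ofReal_le_ofReal ?_
    have := (stdPDF_pos z).le
    gcongr
  have hIio : ∫⁻ z in Iio (-√β), ENNReal.ofReal (z ^ 2 - β) ∂(gaussianReal 0 1) =
      ∫⁻ z in Ioi (√β), ENNReal.ofReal (z ^ 2 - β) ∂(gaussianReal 0 1) := by
    have h2 : (gaussianReal 0 1).map (fun z : ℝ => -z) = gaussianReal 0 1 := by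
      rw [gaussianReal_map_neg, neg_zero]
    conv_lhs => rw [← h2]
    rw [setLIntegral_map measurableSet_Iio hm measurable_neg]
    have h3 : (fun z : ℝ => -z) ⁻¹' Iio (-√β) = Ioi (√β) := by
      ext z; simp
    rw [h3]
    simp
  calc ∫⁻ z, ENNReal.ofReal (z ^ 2 - β) ∂(gaussianReal 0 1)
      = ∫⁻ z in Iio (-√β) ∪ Ioi (√β), ENNReal.ofReal (z ^ 2 - β) ∂(gaussianReal 0 1) := by
        rw [← lintegral_indicator (measurableSet_Iio.union measurableSet_Ioi)]
        refine lintegral_congr fun z => ?_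
        rw [indicator_apply]
        split_ifs with hz
        · rfl
        · simp only [mem_union, mem_Iio, mem_Ioi, not_or, not_lt] at hz
          refine ENNReal.ofReal_of_nonpos ?_
          have := sq_le_sq' hz.1 hz.2
          rw [Real.sq_sqrt hβ0] at this
          linarith
    _ ≤ _ := lintegral_union_le _ _ _
    _ ≤ ENNReal.ofReal (√β * stdPDF (√β)) + ENNReal.ofReal (√β * stdPDF (√β)) := by
        rw [hIio]
        gcongr
    _ = _ := by
        have : 0 ≤ √β * stdPDF (√β) := mul_nonneg (Real.sqrt_nonneg _) (stdPDF_pos _).le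
        rw [← ENNReal.ofReal_add this this]
        congr 1
        ring

/-- Truncated second moment of a Gaussian variable of variance at most one. -/
theorem lintegral_sq_sub_excess {β : ℝ} (hβ : 1 ≤ β) (m : ℝ) {s : ℝ≥0} (hs : s ≤ 1) :
    ∫⁻ z, ENNReal.ofReal ((z - m) ^ 2 - β * s) ∂(gaussianReal m s) ≤
      ENNReal.ofReal (2 * √β * stdPDF (√β)) := by
  have h1 : gaussianReal m s = (gaussianReal 0 1).map (fun z => √s * z + m) := by
    have h2 := gaussianReal_map_const_mul (μ := 0) (v := 1) (√s)
    have h3 := gaussianReal_map_add_const (μ := √s * 0)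
      (v := (NNReal.mk ((√(s : ℝ)) ^ 2) (sq_nonneg _)) * 1) m
    rw [← h2, Measure.map_map (by fun_prop) (by fun_prop)] at h3
    rw [show (fun z => √s * z + m) = (fun x => x + m) ∘ fun x => √s * x from rfl, h3]
    congr 1
    · simp
    · ext; simp
  rw [h1, lintegral_map (by fun_prop) (by fun_prop)]
  refine le_trans (lintegral_mono fun z => ENNReal.ofReal_le_ofReal_iff'.2 ?_)
    (lintegral_sq_sub_stdGaussian hβ)
  have hs' : (s : ℝ) ≤ 1 := by exact_mod_cast hs
  -- After rescaling, the excess is `s` times the standard one: where that is positive, `s ≤ 1`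
  -- allows the factor to be dropped; where it is negative, both truncate to zero.
  have h4 : (√(s : ℝ) * z + m - m) ^ 2 - β * s = s * (z ^ 2 - β) := by
    rw [add_sub_cancel_right, mul_pow, Real.sq_sqrt s.coe_nonneg]
    ring
  rw [h4]
  rcases le_total 0 (z ^ 2 - β) with h | h
  · left
    nlinarith [s.coe_nonneg]
  · right
    nlinarith [s.coe_nonneg]

end GaussianMoments

end GPTS

/-! ### Posterior deviations at randomly selected points. -/

namespace GPTS

section Posterior

variable {d : ℕ} {X : Set (E d)} {Ω : Type*} [MeasurableSpace Ω] {k : E d → E d → ℝ} {v : ℝ≥0}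
  {f : Ω → C(X, ℝ)} {ε : ℕ → Ω → ℝ} {g : ℕ → Ω → C(X, ℝ)} {x : ℕ → Ω → X} {P : Measure Ω}

/-- The posterior mean of the objective at `p`, given the data `D`. -/
noncomputable def meanAt (k : E d → E d → ℝ) (v : ℝ≥0) {t : ℕ} (D : Fin t → X × ℝ) (p : X) : ℝ :=
  postMean v (fun p q : X => k p q) t D p

/-- The posterior variance of the objective at `p`, given the data `D`. -/
noncomputable def varAt (k : E d → E d → ℝ) (v : ℝ≥0) {t : ℕ} (D : Fin t → X × ℝ) (p : X) : ℝ :=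
  postCov v (fun p q : X => k p q) t (fun i => (D i).1) p p

namespace IsGPModel

lemma varAt_nonneg (hm : IsGPModel k v f ε P) (hv : 0 < v) {t : ℕ} (D : Fin t → X × ℝ) (p : X) :
    0 ≤ varAt k v D p :=
  hm.isGP.postCov_nonneg measurable_eval_path hv t _ p

lemma varAt_le_kernel (hm : IsGPModel k v f ε P) (hv : 0 < v) {t : ℕ} (D : Fin t → X × ℝ) (p : X) :
    varAt k v D p ≤ k p p :=
  hm.isGP.postCov_le measurable_eval_path hv t _ p

lemma varAt_le_one (hm : IsGPModel k v f ε P) (hv : 0 < v) {t : ℕ} (D : Fin t → X × ℝ) (p : X) :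
    varAt k v D p ≤ 1 :=
  (hm.varAt_le_kernel hv D p).trans (hm.kernel_le_one p p)

variable [IsProbabilityMeasure P]

lemma measurable_meanAt (hm : IsGPModel k v f ε P) (t : ℕ) :
    Measurable fun z : (Fin t → X × ℝ) × X => meanAt k v z.1 z.2 :=
  measurable_postMean hm.measurable_kernel t

lemma measurable_varAt (hm : IsGPModel k v f ε P) (t : ℕ) :
    Measurable fun z : (Fin t → X × ℝ) × X => varAt k v z.1 z.2 := by
  have hfst : Measurable fun (z : (Fin t → X × ℝ) × X) (i : Fin t) => (z.1 i).1 :=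
    measurable_pi_lambda _ fun i => by fun_prop
  exact (measurable_postCov hm.measurable_kernel t).comp
    (hfst.prodMk (measurable_snd.prodMk measurable_snd))

end IsGPModel

namespace IsThompsonSampling

variable [IsProbabilityMeasure P]

/-- The weight `W` will be the posterior probability that the draw selects `p`, a function of the
data alone. -/
lemma lintegral_sq_sub_mul (hm : IsGPModel k v f ε P) (hs : IsThompsonSampling f ε g x P)
    (hv : 0 < v) (t : ℕ) (p : X) {W : (Fin t → X × ℝ) → ℝ≥0∞} (hW : Measurable W) :
    ∫⁻ ω, W (data f ε x t ω) *
        ENNReal.ofReal ((f ω p - meanAt k v (data f ε x t ω) p) ^ 2) ∂P =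
      ∫⁻ ω, W (data f ε x t ω) * ENNReal.ofReal (varAt k v (data f ε x t ω) p) ∂P := by
  have hmean : Measurable fun D : Fin t → X × ℝ => meanAt k v D p :=
    (hm.measurable_meanAt t).comp measurable_prodMk_right
  refine (lintegral_posterior hm hs hv t p
    (φ := fun z => W z.2 * ENNReal.ofReal ((z.1 - meanAt k v z.2 p) ^ 2)) ?_).trans ?_
  · exact (hW.comp measurable_snd).mul
      (((measurable_fst.sub (hmean.comp measurable_snd)).pow_const 2).ennreal_ofReal)
  · refine lintegral_congr fun ω => ?_
    have hsq : Measurable fun z : ℝ =>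
        ENNReal.ofReal ((z - meanAt k v (data f ε x t ω) p) ^ 2) := by fun_prop
    have hlaw := lintegral_sq_sub_gaussianReal (meanAt k v (data f ε x t ω) p)
      (varAt k v (data f ε x t ω) p).toNNReal
    exact (lintegral_const_mul (W (data f ε x t ω)) hsq).trans (congrArg _ hlaw)

lemma lintegral_excess_le (hm : IsGPModel k v f ε P) (hs : IsThompsonSampling f ε g x P)
    (hv : 0 < v) (t : ℕ) (p : X) {β : ℝ} (hβ : 1 ≤ β) :
    ∫⁻ ω, ENNReal.ofReal ((f ω p - meanAt k v (data f ε x t ω) p) ^ 2 -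
        β * varAt k v (data f ε x t ω) p) ∂P ≤ ENNReal.ofReal (2 * √β * stdPDF (√β)) := by
  have hmean : Measurable fun D : Fin t → X × ℝ => meanAt k v D p :=
    (hm.measurable_meanAt t).comp measurable_prodMk_right
  have hvar : Measurable fun D : Fin t → X × ℝ => varAt k v D p :=
    (hm.measurable_varAt t).comp measurable_prodMk_right
  rw [lintegral_posterior hm hs hv t p (φ := fun z => ENNReal.ofReal
    ((z.1 - meanAt k v z.2 p) ^ 2 - β * varAt k v z.2 p)) (by fun_prop)]
  refine (lintegral_mono (g := fun _ => ENNReal.ofReal (2 * √β * stdPDF (√β))) fun ω => ?_).trans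
    (by simp)
  have h0 := hm.varAt_nonneg hv (data f ε x t ω) p
  have h1 := lintegral_sq_sub_excess hβ (meanAt k v (data f ε x t ω) p)
    (s := (varAt k v (data f ε x t ω) p).toNNReal)
    (by simpa using hm.varAt_le_one hv (data f ε x t ω) p)
  rw [Real.coe_toNNReal _ h0] at h1
  exact h1

lemma sum_indicator_eq {α : Type*} [DecidableEq α] {S : Finset α} {q : α} (hq : q ∈ S)
    (F : α → ℝ≥0∞) : F q = ∑ p ∈ S, (if q = p then 1 else 0) * F p := by
  simp [Finset.sum_ite_eq, hq]

/-- Second moment of the posterior error at a point that depends on a posterior draw. -/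
lemma lintegral_sq_draw (hm : IsGPModel k v f ε P) (hs : IsThompsonSampling f ε g x P)
    (hv : 0 < v) (t : ℕ) {post : Kernel (Fin t → X × ℝ) C(X, ℝ)} [IsMarkovKernel post]
    (hg : HasCondDistrib (g t) (fun ω => (f ω, data f ε x t ω))
      (post.comap (Prod.snd : C(X, ℝ) × (Fin t → X × ℝ) → _) (by fun_prop)) P)
    {sel : (Fin t → X × ℝ) × C(X, ℝ) → X} (hsel : Measurable sel) {S : Finset X}
    (hS : ∀ z, sel z ∈ S) :
    ∫⁻ ω, ENNReal.ofReal ((f ω (sel (data f ε x t ω, g t ω)) -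
        meanAt k v (data f ε x t ω) (sel (data f ε x t ω, g t ω))) ^ 2) ∂P =
      ∫⁻ ω, ENNReal.ofReal (varAt k v (data f ε x t ω) (sel (data f ε x t ω, g t ω))) ∂P := by
  classical
  have hgm : AEMeasurable (g t) P := hg.aemeasurable_snd
  have hDm := hs.aemeasurable_data t
  have hfm := hs.aemeasurable_f
  have hselm : AEMeasurable (fun ω => sel (data f ε x t ω, g t ω)) P :=
    hsel.comp_aemeasurable (hDm.prodMk hgm)
  let ind : X → (Fin t → X × ℝ) × C(X, ℝ) → ℝ≥0∞ := fun p z => if sel z = p then 1 else 0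
  have hind : ∀ p, Measurable (ind p) := fun p =>
    Measurable.ite (hsel (measurableSet_singleton p)) measurable_const measurable_const
  have hmean : ∀ p, Measurable fun D : Fin t → X × ℝ => meanAt k v D p := fun p =>
    (hm.measurable_meanAt t).comp measurable_prodMk_right
  have hvar : ∀ p, Measurable fun D : Fin t → X × ℝ => varAt k v D p := fun p =>
    (hm.measurable_varAt t).comp measurable_prodMk_right
  have hindm : ∀ p, AEMeasurable (fun ω => ind p (data f ε x t ω, g t ω)) P := fun p =>
    (hind p).comp_aemeasurable (hDm.prodMk hgm)
  have hfp : ∀ p : X, AEMeasurable (fun ω => f ω p) P := fun p =>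
    (measurable_eval_path p).comp_aemeasurable hfm
  have hmD : ∀ p, AEMeasurable (fun ω => meanAt k v (data f ε x t ω) p) P := fun p =>
    (hmean p).comp_aemeasurable hDm
  have hvD : ∀ p, AEMeasurable (fun ω => varAt k v (data f ε x t ω) p) P := fun p =>
    (hvar p).comp_aemeasurable hDm
  have h1 : ∀ ω, ENNReal.ofReal ((f ω (sel (data f ε x t ω, g t ω)) -
        meanAt k v (data f ε x t ω) (sel (data f ε x t ω, g t ω))) ^ 2) =
      ∑ p ∈ S, ind p (data f ε x t ω, g t ω) *
        ENNReal.ofReal ((f ω p - meanAt k v (data f ε x t ω) p) ^ 2) := fun ω =>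
    sum_indicator_eq (hS _) fun p =>
      ENNReal.ofReal ((f ω p - meanAt k v (data f ε x t ω) p) ^ 2)
  have h2 : ∀ ω, ENNReal.ofReal (varAt k v (data f ε x t ω) (sel (data f ε x t ω, g t ω))) =
      ∑ p ∈ S, ind p (data f ε x t ω, g t ω) *
        ENNReal.ofReal (varAt k v (data f ε x t ω) p) := fun ω =>
    sum_indicator_eq (hS _) fun p => ENNReal.ofReal (varAt k v (data f ε x t ω) p)
  simp_rw [h1, h2]
  have h5 : ∀ p ∈ S, AEMeasurable (fun ω => ind p (data f ε x t ω, g t ω) *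
      ENNReal.ofReal ((f ω p - meanAt k v (data f ε x t ω) p) ^ 2)) P := fun p _ => by fun_prop
  have h6 : ∀ p ∈ S, AEMeasurable (fun ω => ind p (data f ε x t ω, g t ω) *
      ENNReal.ofReal (varAt k v (data f ε x t ω) p)) P := fun p _ => by fun_prop
  rw [lintegral_finsetSum' _ h5, lintegral_finsetSum' _ h6]
  refine Finset.sum_congr rfl fun p _ => ?_
  -- Given the data, the event that the draw selects `p` is independent of the objective, so its
  -- indicator may be replaced by its conditional probability. Hence neither a factor `β` nor the
  -- size of `S` appears.
  let W : (Fin t → X × ℝ) → ℝ≥0∞ := fun D => ∫⁻ h, ind p (D, h) ∂(post D)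
  have hW : Measurable W := Measurable.lintegral_kernel_prod_right' (hind p)
  have key : ∀ {F : C(X, ℝ) × (Fin t → X × ℝ) → ℝ≥0∞}, Measurable F →
      ∫⁻ ω, ind p (data f ε x t ω, g t ω) * F (f ω, data f ε x t ω) ∂P =
        ∫⁻ ω, W (data f ε x t ω) * F (f ω, data f ε x t ω) ∂P := fun {F} hF => by
    have hi : Measurable fun z : (C(X, ℝ) × (Fin t → X × ℝ)) × C(X, ℝ) => ind p (z.1.2, z.2) :=
      (hind p).comp (by fun_prop)
    rw [lintegral_draw hg (φ := fun z => ind p (z.1.2, z.2) * F z.1)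
      (hi.mul (hF.comp measurable_fst))]
    refine lintegral_congr fun ω => ?_
    have hi' : Measurable fun h : C(X, ℝ) => ind p (data f ε x t ω, h) :=
      (hind p).comp (by fun_prop)
    exact lintegral_mul_const (F (f ω, data f ε x t ω)) hi'
  have h3 := key (F := fun z => ENNReal.ofReal ((z.1 p - meanAt k v z.2 p) ^ 2)) (by
    exact ((((measurable_eval_path p).comp measurable_fst).sub
      ((hmean p).comp measurable_snd)).pow_const 2).ennreal_ofReal)
  have h4 := key (F := fun z => ENNReal.ofReal (varAt k v z.2 p)) (by
    exact ((hvar p).comp measurable_snd).ennreal_ofReal)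
  exact h3.trans ((lintegral_sq_sub_mul hm hs hv t p hW).trans h4.symm)

/-- Second moment of the posterior error at a point that depends on the objective. -/
lemma lintegral_sq_objective_le (hm : IsGPModel k v f ε P) (hs : IsThompsonSampling f ε g x P)
    (hv : 0 < v) (t : ℕ) {sel : (Fin t → X × ℝ) × C(X, ℝ) → X} (hsel : Measurable sel)
    {S : Finset X} (hS : ∀ z, sel z ∈ S) {β : ℝ} (hβ : 1 ≤ β) :
    ∫⁻ ω, ENNReal.ofReal ((f ω (sel (data f ε x t ω, f ω)) -
        meanAt k v (data f ε x t ω) (sel (data f ε x t ω, f ω))) ^ 2) ∂P ≤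
      ENNReal.ofReal β *
        ∫⁻ ω, ENNReal.ofReal (varAt k v (data f ε x t ω) (sel (data f ε x t ω, f ω))) ∂P +
      S.card * ENNReal.ofReal (2 * √β * stdPDF (√β)) := by
  have hβ0 : 0 ≤ β := by linarith
  have hDm := hs.aemeasurable_data t
  have hfm := hs.aemeasurable_f
  have hmean : ∀ p, Measurable fun D : Fin t → X × ℝ => meanAt k v D p := fun p =>
    (hm.measurable_meanAt t).comp measurable_prodMk_right
  have hvar : ∀ p, Measurable fun D : Fin t → X × ℝ => varAt k v D p := fun p =>
    (hm.measurable_varAt t).comp measurable_prodMk_right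
  have hselm : AEMeasurable (fun ω => sel (data f ε x t ω, f ω)) P :=
    hsel.comp_aemeasurable (hDm.prodMk hfm)
  have hfp : ∀ p : X, AEMeasurable (fun ω => f ω p) P := fun p =>
    (measurable_eval_path p).comp_aemeasurable hfm
  have hmD : ∀ p, AEMeasurable (fun ω => meanAt k v (data f ε x t ω) p) P := fun p =>
    (hmean p).comp_aemeasurable hDm
  have hvD : ∀ p, AEMeasurable (fun ω => varAt k v (data f ε x t ω) p) P := fun p =>
    (hvar p).comp_aemeasurable hDm
  have hvs : AEMeasurable (fun ω => varAt k v (data f ε x t ω) (sel (data f ε x t ω, f ω))) P :=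
    (hm.measurable_varAt t).comp_aemeasurable (hDm.prodMk hselm)
  -- The selected point is correlated with the objective. Its square is split into `β` times the
  -- variance and a positive excess, and the latter is dominated by the sum over all points of `S`.
  calc _ ≤ ∫⁻ ω, (ENNReal.ofReal β *
          ENNReal.ofReal (varAt k v (data f ε x t ω) (sel (data f ε x t ω, f ω))) +
        ∑ p ∈ S, ENNReal.ofReal ((f ω p - meanAt k v (data f ε x t ω) p) ^ 2 -
          β * varAt k v (data f ε x t ω) p)) ∂P := by
        refine lintegral_mono fun ω => ?_
        set q := sel (data f ε x t ω, f ω) with hq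
        have h1 : ENNReal.ofReal ((f ω q - meanAt k v (data f ε x t ω) q) ^ 2 -
            β * varAt k v (data f ε x t ω) q) ≤ _ := Finset.single_le_sum
          (f := fun p => ENNReal.ofReal ((f ω p - meanAt k v (data f ε x t ω) p) ^ 2 -
            β * varAt k v (data f ε x t ω) p)) (fun _ _ => zero_le) (hS (data f ε x t ω, f ω))
        refine le_trans ?_ (add_le_add_right h1 _)
        rw [← ENNReal.ofReal_mul hβ0]
        refine le_trans (ENNReal.ofReal_le_ofReal ?_) ENNReal.ofReal_add_le
        linarith
    _ = ENNReal.ofReal β *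
          ∫⁻ ω, ENNReal.ofReal (varAt k v (data f ε x t ω) (sel (data f ε x t ω, f ω))) ∂P +
        ∑ p ∈ S, ∫⁻ ω, ENNReal.ofReal ((f ω p - meanAt k v (data f ε x t ω) p) ^ 2 -
          β * varAt k v (data f ε x t ω) p) ∂P := by
        rw [lintegral_add_left' (by fun_prop), lintegral_const_mul'' _ (by fun_prop),
          lintegral_finsetSum' _ fun p _ => by fun_prop]
    _ ≤ _ := by
        gcongr
        refine (Finset.sum_le_sum fun p _ => lintegral_excess_le hm hs hv t p hβ).trans ?_
        simp

end IsThompsonSampling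

end Posterior

end GPTS

/-! ### Second moment of the regret of one round. -/

namespace GPTS

section Regret

variable {d : ℕ} {X : Set (E d)} {Ω : Type*} [MeasurableSpace Ω] {k : E d → E d → ℝ} {v : ℝ≥0}
  {f : Ω → C(X, ℝ)} {ε : ℕ → Ω → ℝ} {g : ℕ → Ω → C(X, ℝ)} {x : ℕ → Ω → X} {P : Measure Ω}

lemma add_four_sq_le (p q r s : ℝ) :
    (p + q + r + s) ^ 2 ≤ 4 * (p ^ 2 + q ^ 2 + r ^ 2 + s ^ 2) := by
  have h1 := add_sq_le (a := p + q) (b := r + s)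
  have h2 := add_sq_le (a := p) (b := q)
  have h3 := add_sq_le (a := r) (b := s)
  rw [← add_assoc] at h1
  linarith

/-- Regret in terms of four posterior deviations at grid points and four discretization errors:
`a, b` are points, `A, B` their grid points, `f, g` the objective and a draw, `m` the mean. -/
lemma ofReal_gap_sq_le {fa fb fA fB ga gb gA gB mA mB : ℝ} (hf : fb ≤ fa) (hg : ga ≤ gb) :
    ENNReal.ofReal ((fa - fb) ^ 2) ≤
      5 * (ENNReal.ofReal ((fA - mA) ^ 2) + ENNReal.ofReal ((fB - mB) ^ 2) +
        ENNReal.ofReal ((gA - mA) ^ 2) + ENNReal.ofReal ((gB - mB) ^ 2)) +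
      20 * (ENNReal.ofReal ((fa - fA) ^ 2) + ENNReal.ofReal ((fb - fB) ^ 2) +
        ENNReal.ofReal ((ga - gA) ^ 2) + ENNReal.ofReal ((gb - gB) ^ 2)) := by
  have h1 : (fa - fb) ^ 2 ≤ 5 * ((fA - mA) ^ 2 + (fB - mB) ^ 2 + (gA - mA) ^ 2 + (gB - mB) ^ 2) +
      20 * ((fa - fA) ^ 2 + (fb - fB) ^ 2 + (ga - gA) ^ 2 + (gb - gB) ^ 2) := by
    set D := (fA - mA) + (mB - fB) + (mA - gA) + (gB - mB) with hD
    set e := (fa - fA) + (fB - fb) + (gA - ga) + (gb - gB) with he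
    have h2 := add_four_sq_le (fA - mA) (mB - fB) (mA - gA) (gB - mB)
    have h3 := add_four_sq_le (fa - fA) (fB - fb) (gA - ga) (gb - gB)
    -- The means cancel and `D + e = (fa - fb) + (gb - ga)`, where the last bracket is nonnegative
    -- because the draw is maximal at `b`.
    have h4 : (fa - fb) ^ 2 ≤ (D + e) ^ 2 := by
      refine pow_le_pow_left₀ (by linarith) ?_ 2
      linarith
    -- An unbalanced Young inequality that favours the deviations over the discretization errors;
    -- multiplied by the `4` from each sum of four terms, it gives the constants `5` and `20`.
    have h5 : (D + e) ^ 2 ≤ 5 / 4 * D ^ 2 + 5 * e ^ 2 := by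
      have := sq_nonneg (D - 4 * e)
      linarith
    rw [← hD] at h2
    rw [← he] at h3
    rw [sub_sq_comm mB, sub_sq_comm mA] at h2
    rw [sub_sq_comm fB, sub_sq_comm gA] at h3
    linarith
  have h5 : (5 : ℝ≥0∞) = ENNReal.ofReal 5 := by simp
  have h20 : (20 : ℝ≥0∞) = ENNReal.ofReal 20 := by simp
  have hadd : ∀ p q r s : ℝ, ENNReal.ofReal (p ^ 2 + q ^ 2 + r ^ 2 + s ^ 2) =
      ENNReal.ofReal (p ^ 2) + ENNReal.ofReal (q ^ 2) + ENNReal.ofReal (r ^ 2) +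
        ENNReal.ofReal (s ^ 2) := fun p q r s => by
    rw [ENNReal.ofReal_add (by positivity) (by positivity),
      ENNReal.ofReal_add (by positivity) (by positivity),
      ENNReal.ofReal_add (by positivity) (by positivity)]
  refine (ENNReal.ofReal_le_ofReal h1).trans_eq ?_
  rw [ENNReal.ofReal_add (by positivity) (by positivity), ENNReal.ofReal_mul (by norm_num),
    ENNReal.ofReal_mul (by norm_num), hadd, hadd, h5, h20]

lemma lintegral_four_four {α : Type*} {mα : MeasurableSpace α} {μ : Measure α} (a b : ℝ≥0∞)
    {F₁ F₂ F₃ F₄ G₁ G₂ G₃ G₄ : α → ℝ≥0∞} (hF₁ : AEMeasurable F₁ μ) (hF₂ : AEMeasurable F₂ μ)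
    (hF₃ : AEMeasurable F₃ μ) (hF₄ : AEMeasurable F₄ μ) (hG₁ : AEMeasurable G₁ μ)
    (hG₂ : AEMeasurable G₂ μ) (hG₃ : AEMeasurable G₃ μ) (hG₄ : AEMeasurable G₄ μ) :
    ∫⁻ z, (a * (F₁ z + F₂ z + F₃ z + F₄ z) + b * (G₁ z + G₂ z + G₃ z + G₄ z)) ∂μ =
      a * (∫⁻ z, F₁ z ∂μ + ∫⁻ z, F₂ z ∂μ + ∫⁻ z, F₃ z ∂μ + ∫⁻ z, F₄ z ∂μ) +
        b * (∫⁻ z, G₁ z ∂μ + ∫⁻ z, G₂ z ∂μ + ∫⁻ z, G₃ z ∂μ + ∫⁻ z, G₄ z ∂μ) := by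
  rw [lintegral_add_left' (by fun_prop), lintegral_const_mul'' _ (by fun_prop),
    lintegral_const_mul'' _ (by fun_prop), lintegral_add_left' (by fun_prop),
    lintegral_add_left' (by fun_prop), lintegral_add_left' (by fun_prop),
    lintegral_add_left' (by fun_prop), lintegral_add_left' (by fun_prop),
    lintegral_add_left' (by fun_prop)]

lemma lintegral_gap_sq_le_of {α : Type*} {mα : MeasurableSpace α} {μ : Measure α}
    {fa fb fA fB ga gb gA gB mA mB : α → ℝ} (hf : ∀ z, fb z ≤ fa z) (hg : ∀ z, ga z ≤ gb z)
    (hfa : AEMeasurable fa μ) (hfb : AEMeasurable fb μ) (hfA : AEMeasurable fA μ)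
    (hfB : AEMeasurable fB μ) (hga : AEMeasurable ga μ) (hgb : AEMeasurable gb μ)
    (hgA : AEMeasurable gA μ) (hgB : AEMeasurable gB μ) (hmA : AEMeasurable mA μ)
    (hmB : AEMeasurable mB μ) {U W H : ℝ≥0∞}
    (h1 : ∫⁻ z, ENNReal.ofReal ((fA z - mA z) ^ 2) ∂μ ≤ U)
    (h2 : ∫⁻ z, ENNReal.ofReal ((fB z - mB z) ^ 2) ∂μ ≤ W)
    (h3 : ∫⁻ z, ENNReal.ofReal ((gA z - mA z) ^ 2) ∂μ ≤ W)
    (h4 : ∫⁻ z, ENNReal.ofReal ((gB z - mB z) ^ 2) ∂μ ≤ U)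
    (h5 : ∫⁻ z, ENNReal.ofReal ((fa z - fA z) ^ 2) ∂μ ≤ H)
    (h6 : ∫⁻ z, ENNReal.ofReal ((fb z - fB z) ^ 2) ∂μ ≤ H)
    (h7 : ∫⁻ z, ENNReal.ofReal ((ga z - gA z) ^ 2) ∂μ ≤ H)
    (h8 : ∫⁻ z, ENNReal.ofReal ((gb z - gB z) ^ 2) ∂μ ≤ H) :
    ∫⁻ z, ENNReal.ofReal ((fa z - fb z) ^ 2) ∂μ ≤ 5 * (2 * U + 2 * W) + 80 * H := by
  refine (lintegral_mono fun z => ofReal_gap_sq_le (fA := fA z) (fB := fB z) (gA := gA z)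
    (gB := gB z) (mA := mA z) (mB := mB z) (hf z) (hg z)).trans ?_
  rw [lintegral_four_four 5 20 (by fun_prop) (by fun_prop) (by fun_prop) (by fun_prop)
    (by fun_prop) (by fun_prop) (by fun_prop) (by fun_prop)]
  calc _ ≤ 5 * (U + W + W + U) + 20 * (H + H + H + H) := by gcongr
    _ = _ := by ring

lemma iSup_path_eq {h : C(X, ℝ)} {q : X} (hq : ∀ p, h p ≤ h q) : ⨆ p : X, h p = h q := by
  have : Nonempty X := ⟨q⟩
  exact le_antisymm (ciSup_le hq) (le_ciSup (f := fun p => h p) ⟨h q, by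
    rintro _ ⟨p, rfl⟩; exact hq p⟩ q)

namespace IsThompsonSampling

variable [IsProbabilityMeasure P]

lemma measurable_sq_dev (hm : IsGPModel k v f ε P) {t : ℕ}
    {q : (C(X, ℝ) × (Fin t → X × ℝ)) × C(X, ℝ) → X} (hq : Measurable q) :
    Measurable fun z : (C(X, ℝ) × (Fin t → X × ℝ)) × C(X, ℝ) =>
      ENNReal.ofReal ((z.1.1 (q z) - meanAt k v z.1.2 (q z)) ^ 2) := by
  have h1 : Measurable fun z : (C(X, ℝ) × (Fin t → X × ℝ)) × C(X, ℝ) => (z.1.2, q z) :=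
    Measurable.prodMk (by fun_prop) hq
  have h2 : Measurable fun z : (C(X, ℝ) × (Fin t → X × ℝ)) × C(X, ℝ) => z.1.1 (q z) :=
    Measurable.path_apply (by fun_prop) hq
  exact ((h2.sub ((hm.measurable_meanAt t).comp h1)).pow_const 2).ennreal_ofReal

lemma measurable_sq_err {t : ℕ} {q q' : (C(X, ℝ) × (Fin t → X × ℝ)) × C(X, ℝ) → X}
    (hq : Measurable q) (hq' : Measurable q') :
    Measurable fun z : (C(X, ℝ) × (Fin t → X × ℝ)) × C(X, ℝ) =>
      ENNReal.ofReal ((z.1.1 (q z) - z.1.1 (q' z)) ^ 2) :=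
  (((Measurable.path_apply (by fun_prop) hq).sub
    (Measurable.path_apply (by fun_prop) hq')).pow_const 2).ennreal_ofReal

lemma measurable_var_comp (hm : IsGPModel k v f ε P) {t : ℕ}
    {q : (C(X, ℝ) × (Fin t → X × ℝ)) × C(X, ℝ) → X} (hq : Measurable q) :
    Measurable fun z : (C(X, ℝ) × (Fin t → X × ℝ)) × C(X, ℝ) =>
      ENNReal.ofReal (varAt k v z.1.2 (q z)) := by
  have h1 : Measurable fun z : (C(X, ℝ) × (Fin t → X × ℝ)) × C(X, ℝ) => (z.1.2, q z) :=
    Measurable.prodMk (by fun_prop) hq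
  exact ((hm.measurable_varAt t).comp h1).ennreal_ofReal

/-- The second moment of the instantaneous regret, with the domain discretized by the map `π`. -/
theorem lintegral_gap_sq_le (hm : IsGPModel k v f ε P) (hs : IsThompsonSampling f ε g x P)
    (hv : 0 < v) (t : ℕ) {π : X → X} (hπ : Measurable π) {S : Finset X} (hS : ∀ p, π p ∈ S)
    {β : ℝ} (hβ : 1 ≤ β) {H : ℝ≥0∞}
    (herr : ∀ q : Ω → X, AEMeasurable q P →
      ∫⁻ ω, ENNReal.ofReal ((f ω (q ω) - f ω (π (q ω))) ^ 2) ∂P ≤ H) :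
    AEMeasurable (fun ω => (⨆ p : X, f ω p) - f ω (x t ω)) P ∧
    ∫⁻ ω, ENNReal.ofReal (((⨆ p : X, f ω p) - f ω (x t ω)) ^ 2) ∂P ≤
      5 * (2 * (ENNReal.ofReal β *
          ∫⁻ ω, ENNReal.ofReal (varAt k v (data f ε x t ω) (π (x t ω))) ∂P +
        S.card * ENNReal.ofReal (2 * √β * stdPDF (√β))) +
        2 * ∫⁻ ω, ENNReal.ofReal (varAt k v (data f ε x t ω) (π (x t ω))) ∂P) + 80 * H := by
  obtain ⟨post, _, hf, hg'⟩ := hs.posterior_sample t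
  have hg := hasCondDistrib_pair t hg'
  obtain ⟨select, hsel, hmax, hx⟩ := hs.argmax t
  have hDm := hs.aemeasurable_data t
  have hfm := hs.aemeasurable_f
  have hgm : AEMeasurable (g t) P := hg.aemeasurable_snd
  have hselπ : Measurable fun z => π (select z) := hπ.comp hsel
  have hmm := hm.measurable_meanAt t
  have hvm := hm.measurable_varAt t
  have hsm : AEMeasurable (fun ω => select (data f ε x t ω, f ω)) P :=
    hsel.comp_aemeasurable (hDm.prodMk hfm)
  have htm : AEMeasurable (fun ω => select (data f ε x t ω, g t ω)) P :=
    hsel.comp_aemeasurable (hDm.prodMk hgm)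
  -- evaluation and exchange of functionals of `(D, f, g)`
  have ex : ∀ {F : (C(X, ℝ) × (Fin t → X × ℝ)) × C(X, ℝ) → ℝ≥0∞}, Measurable F →
      ∫⁻ ω, F ((f ω, data f ε x t ω), g t ω) ∂P = ∫⁻ ω, F ((g t ω, data f ε x t ω), f ω) ∂P :=
    fun hF => lintegral_exchange hf hg hF
  have m1 : Measurable fun z : (C(X, ℝ) × (Fin t → X × ℝ)) × C(X, ℝ) => select (z.1.2, z.1.1) :=
    hsel.comp (by fun_prop)
  have m2 : Measurable fun z : (C(X, ℝ) × (Fin t → X × ℝ)) × C(X, ℝ) => select (z.1.2, z.2) :=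
    hsel.comp (by fun_prop)
  have dm1 := measurable_sq_dev hm (hπ.comp m1)
  have dm2 := measurable_sq_dev hm (hπ.comp m2)
  have em1 := measurable_sq_err m1 (hπ.comp m1)
  have em2 := measurable_sq_err m2 (hπ.comp m2)
  have hz1 : AEMeasurable (fun ω => ((f ω, data f ε x t ω), g t ω)) P :=
    (hfm.prodMk hDm).prodMk hgm
  have hz2 : AEMeasurable (fun ω => ((g t ω, data f ε x t ω), f ω)) P :=
    (hgm.prodMk hDm).prodMk hfm
  -- The maximizer of `f` is taken by the same rule as the query, so that exchanging `f` and `g t`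
  -- exchanges the two points.
  have hgap : ∀ ω, (⨆ p : X, f ω p) = f ω (select (data f ε x t ω, f ω)) := fun ω =>
    iSup_path_eq fun p => hmax _ _ p
  simp only [hgap, hx]
  have m0 : Measurable fun z : (C(X, ℝ) × (Fin t → X × ℝ)) × C(X, ℝ) => z.1.1 := by fun_prop
  have mgap : Measurable fun z : (C(X, ℝ) × (Fin t → X × ℝ)) × C(X, ℝ) =>
      z.1.1 (select (z.1.2, z.1.1)) - z.1.1 (select (z.1.2, z.2)) :=
    (Measurable.path_apply m0 m1).sub (Measurable.path_apply m0 m2)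
  refine ⟨mgap.comp_aemeasurable hz1, ?_⟩
  -- the four deviations and the four discretization errors
  have dB := lintegral_sq_draw hm hs hv t hg hselπ (S := S) fun z => hS _
  have dA := lintegral_sq_objective_le hm hs hv t hselπ (S := S) (fun z => hS _) hβ
  have xv := ex (measurable_var_comp hm (hπ.comp m1))
  have xA := ex dm1
  have xB := ex dm2
  have e1 := herr _ hsm
  have e2 := herr _ htm
  have xe1 := ex em1
  have xe2 := ex em2
  simp only [Function.comp_apply] at xv xA xB xe1 xe2
  -- The variance at the maximizer of `f` becomes, in mean, the variance at the query, which is the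
  -- one that the information gain controls.
  rw [xv] at dA
  have mp : ∀ {q : (C(X, ℝ) × (Fin t → X × ℝ)) × C(X, ℝ) → X}, Measurable q →
      Measurable fun z : (C(X, ℝ) × (Fin t → X × ℝ)) × C(X, ℝ) => z.1.1 (q z) :=
    fun hq => Measurable.path_apply m0 hq
  have mm : ∀ {q : (C(X, ℝ) × (Fin t → X × ℝ)) × C(X, ℝ) → X}, Measurable q →
      Measurable fun z : (C(X, ℝ) × (Fin t → X × ℝ)) × C(X, ℝ) => meanAt k v z.1.2 (q z) :=
    fun hq => hmm.comp (Measurable.prodMk (by fun_prop) hq)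
  -- `f` at its own maximizer and `f` at the query are bounded directly; the two deviations and two
  -- errors of the draw are reduced to these by exchange.
  exact lintegral_gap_sq_le_of (fun ω => hmax (data f ε x t ω) (f ω) _)
    (fun ω => hmax (data f ε x t ω) (g t ω) _)
    ((mp m1).comp_aemeasurable hz1) ((mp m2).comp_aemeasurable hz1)
    ((mp (hπ.comp m1)).comp_aemeasurable hz1) ((mp (hπ.comp m2)).comp_aemeasurable hz1)
    ((mp m2).comp_aemeasurable hz2) ((mp m1).comp_aemeasurable hz2)
    ((mp (hπ.comp m2)).comp_aemeasurable hz2) ((mp (hπ.comp m1)).comp_aemeasurable hz2)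
    ((mm (hπ.comp m1)).comp_aemeasurable hz1) ((mm (hπ.comp m2)).comp_aemeasurable hz1)
    dA dB.le (xB.symm.trans dB).le (xA.symm.trans_le dA) e1 e2 (xe2.symm.trans_le e2)
    (xe1.symm.trans_le e1)

end IsThompsonSampling

end Regret

end GPTS

namespace GPTS

/-! ### Mutual information of product laws -/

section KL

variable {α β α' β' : Type*} [MeasurableSpace α] [MeasurableSpace β] [MeasurableSpace α']
  [MeasurableSpace β']

/-- Data processing for the map and for its inverse. -/
lemma klDiv_map_equiv (e : α ≃ᵐ β) (μ ν : Measure α) [IsFiniteMeasure μ] [IsFiniteMeasure ν] :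
    klDiv (μ.map e) (ν.map e) = klDiv μ ν := by
  refine le_antisymm (klDiv_map_le _ _ e.measurable) ?_
  have := klDiv_map_le (μ.map e) (ν.map e) e.symm.measurable
  simpa [MeasurableEquiv.map_symm_map] using this

/-- The chain rule for divergences with constant kernels. -/
lemma klDiv_prod (μ ν : Measure α) (κ η : Measure β) [IsProbabilityMeasure μ]
    [IsProbabilityMeasure ν] [IsProbabilityMeasure κ] [IsProbabilityMeasure η] :
    klDiv (μ.prod κ) (ν.prod η) = klDiv μ ν + klDiv κ η := by
  have h1 := klDiv_compProd_eq_add μ ν (Kernel.const α κ) (Kernel.const α η)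
  have h2 := klDiv_compProd_left κ η (Kernel.const β μ)
  have h3 := klDiv_map_equiv MeasurableEquiv.prodComm (κ.prod μ) (η.prod μ)
  simp only [Measure.compProd_const] at h1 h2
  rw [h1, ← h2, ← h3]
  change _ = klDiv μ ν + klDiv ((κ.prod μ).map Prod.swap) ((η.prod μ).map Prod.swap)
  rw [Measure.prod_swap, Measure.prod_swap]

lemma klDiv_pi {n : ℕ} (μ ν : Fin n → Measure α) [∀ i, IsProbabilityMeasure (μ i)]
    [∀ i, IsProbabilityMeasure (ν i)] :
    klDiv (Measure.pi μ) (Measure.pi ν) = ∑ i, klDiv (μ i) (ν i) := by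
  induction n with
  | zero =>
    have : Measure.pi μ = Measure.pi ν := by
      rw [Measure.pi_of_empty, Measure.pi_of_empty]
    rw [this, klDiv_self]
    simp
  | succ n ih =>
    have h1 := (measurePreserving_piFinSuccAbove μ 0).map_eq
    have h2 := (measurePreserving_piFinSuccAbove ν 0).map_eq
    rw [← klDiv_map_equiv (MeasurableEquiv.piFinSuccAbove (fun _ => α) 0), h1, h2, klDiv_prod, ih,
      Fin.sum_univ_succ]
    rfl

lemma mutualInfo_map_equiv (e : α ≃ᵐ α') (e' : β ≃ᵐ β') (μ : Measure (α × β))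
    [IsProbabilityMeasure μ] :
    mutualInfo (μ.map (Prod.map e e')) = mutualInfo μ := by
  unfold mutualInfo
  have h1 : (μ.map (Prod.map e e')).fst = μ.fst.map e := by
    rw [Measure.fst, Measure.fst, Measure.map_map (by fun_prop) (by fun_prop),
      Measure.map_map (by fun_prop) (by fun_prop)]
    rfl
  have h2 : (μ.map (Prod.map e e')).snd = μ.snd.map e' := by
    rw [Measure.snd, Measure.snd, Measure.map_map (by fun_prop) (by fun_prop),
      Measure.map_map (by fun_prop) (by fun_prop)]
    rfl
  rw [h1, h2, Measure.map_prod_map _ _ e.measurable e'.measurable]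
  exact klDiv_map_equiv (MeasurableEquiv.prodCongr e e') _ _

/-- For independent pairs both the joint law and the product of its marginals are products over the
index, so divergences add up. -/
lemma mutualInfo_pi {n : ℕ} (J : Fin n → Measure (α × β)) [∀ i, IsProbabilityMeasure (J i)] :
    mutualInfo ((Measure.pi J).map fun w => (fun i => (w i).1, fun i => (w i).2)) =
      ∑ i, mutualInfo (J i) := by
  unfold mutualInfo
  have hm : Measurable fun w : Fin n → α × β => (fun i => (w i).1, fun i => (w i).2) :=
    (MeasurableEquiv.arrowProdEquivProdArrow α β (Fin n)).measurable
  have hp1 : ∀ i, IsProbabilityMeasure ((J i).map Prod.fst) := fun i =>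
    Measure.isProbabilityMeasure_map (by fun_prop)
  have hp2 : ∀ i, IsProbabilityMeasure ((J i).map Prod.snd) := fun i =>
    Measure.isProbabilityMeasure_map (by fun_prop)
  have h1 : ((Measure.pi J).map fun w => (fun i => (w i).1, fun i => (w i).2)).fst =
      Measure.pi fun i => (J i).fst := by
    rw [Measure.fst, Measure.map_map measurable_fst hm]
    exact Measure.pi_map_pi (f := fun _ => Prod.fst) fun i => by fun_prop
  have h2 : ((Measure.pi J).map fun w => (fun i => (w i).1, fun i => (w i).2)).snd =
      Measure.pi fun i => (J i).snd := by
    rw [Measure.snd, Measure.map_map measurable_snd hm]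
    exact Measure.pi_map_pi (f := fun _ => Prod.snd) fun i => by fun_prop
  rw [h1, h2, ← (measurePreserving_arrowProdEquivProdArrow α β (Fin n) (fun i => (J i).fst)
    fun i => (J i).snd).map_eq, ← klDiv_pi]
  exact klDiv_map_equiv (MeasurableEquiv.arrowProdEquivProdArrow α β (Fin n)) _ _

/-- Divergence of a law that is given by a log-density. -/
lemma klDiv_withDensity_exp {μ : Measure α} [IsProbabilityMeasure μ] {h : α → ℝ}
    (hh : Measurable h) {J : Measure α} [IsProbabilityMeasure J]
    (hJ : J = μ.withDensity fun a => ENNReal.ofReal (Real.exp (h a))) (hint : Integrable h J) :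
    klDiv J μ = ENNReal.ofReal (∫ a, h a ∂J) := by
  have hac : J ≪ μ := by
    rw [hJ]
    exact withDensity_absolutelyContinuous _ _
  have hllr : llr J μ =ᵐ[J] h := by
    have h1 := Measure.rnDeriv_withDensity μ (f := fun a => ENNReal.ofReal (Real.exp (h a)))
      hh.exp.ennreal_ofReal
    rw [← hJ] at h1
    filter_upwards [hac.ae_le h1] with a ha
    rw [llr, ha, ENNReal.toReal_ofReal (Real.exp_pos _).le, Real.log_exp]
  rw [klDiv_of_ac_of_integrable hac ((integrable_congr hllr).2 hint), integral_congr_ae hllr]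
  simp

end KL

/-! ### The information gained from one Gaussian observation -/

section Channel

/-- The joint law of a noisy observation and a Gaussian signal of variance `l`. -/
noncomputable def channel (l v : ℝ≥0) : Measure (ℝ × ℝ) :=
  ((gaussianReal 0 l).prod (gaussianReal 0 v)).map fun p => (p.1 + p.2, p.1)

instance (l v : ℝ≥0) : IsProbabilityMeasure (channel l v) :=
  Measure.isProbabilityMeasure_map (by fun_prop)

/-- The log-density of `channel l v` with respect to the product of its marginals. -/
noncomputable def channelLog (l v : ℝ≥0) (p : ℝ × ℝ) : ℝ :=
  -(p.1 - p.2) ^ 2 / (2 * v) + p.1 ^ 2 / (2 * (l + v)) + Real.log (1 + l / v) / 2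

lemma gaussianPDFReal_eq_exp_channelLog {l v : ℝ≥0} (hv : 0 < v) (a y : ℝ) :
    gaussianPDFReal a v y = Real.exp (channelLog l v (y, a)) * gaussianPDFReal 0 (l + v) y := by
  have hv' : (0 : ℝ) < v := hv
  have hl : (0 : ℝ) ≤ l := l.2
  have hlog : Real.exp (Real.log (1 + l / v) / 2) = √((l + v) / v) := by
    rw [Real.sqrt_eq_rpow, Real.rpow_def_of_pos (by positivity)]
    congr 1
    rw [show (1 + (l : ℝ) / v) = (l + v) / v by field_simp; ring]
    ring
  unfold gaussianPDFReal channelLog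
  rw [Real.exp_add, Real.exp_add, hlog, Real.sqrt_div (by positivity)]
  push_cast
  have hs : ∀ s : ℝ, √(2 * Real.pi * s) = √(2 * Real.pi) * √s :=
    fun s => Real.sqrt_mul (by positivity) s
  rw [hs, hs]
  have h1 : Real.exp (y ^ 2 / (2 * (l + v))) * Real.exp (-(y - 0) ^ 2 / (2 * (l + v))) = 1 := by
    rw [← Real.exp_add, ← Real.exp_zero]
    congr 1
    ring
  have h2 : √((l : ℝ) + v) ≠ 0 := by positivity
  have h3 : √(v : ℝ) ≠ 0 := by positivity
  have h4 : √(2 * Real.pi) ≠ 0 := by positivity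
  calc _ = (√(2 * Real.pi) * √v)⁻¹ * Real.exp (-(y - a) ^ 2 / (2 * v)) * 1 := by ring
    _ = _ := by
      rw [← h1]
      field_simp

lemma channel_eq_withDensity {l v : ℝ≥0} (hv : 0 < v) :
    channel l v = ((gaussianReal 0 (l + v)).prod (gaussianReal 0 l)).withDensity
      fun p => ENNReal.ofReal (Real.exp (channelLog l v p)) := by
  have hcm : Measurable (channelLog l v) := by unfold channelLog; fun_prop
  refine Measure.ext_of_lintegral _ fun φ hφ => ?_
  have hlv : l + v ≠ 0 := (add_pos_of_nonneg_of_pos zero_le hv).ne'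
  unfold channel
  rw [lintegral_map hφ (by fun_prop), lintegral_prod _ (by fun_prop),
    lintegral_withDensity_eq_lintegral_mul _ hcm.exp.ennreal_ofReal hφ,
    lintegral_prod_symm _ (by fun_prop)]
  refine lintegral_congr fun a => ?_
  simp only [Pi.mul_apply]
  have h1 := gaussianReal_map_const_add (μ := 0) (v := v) a
  have h2 : Measurable fun y => φ (y, a) := by fun_prop
  rw [← lintegral_map (f := fun y => φ (y, a)) (g := fun e => a + e) h2 (by fun_prop), h1, zero_add,
    gaussianReal_of_var_ne_zero _ hv.ne', gaussianReal_of_var_ne_zero _ hlv,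
    lintegral_withDensity_eq_lintegral_mul _ (measurable_gaussianPDF a v) h2,
    lintegral_withDensity_eq_lintegral_mul _ (measurable_gaussianPDF 0 (l + v)) (by fun_prop)]
  refine lintegral_congr fun y => ?_
  simp only [Pi.mul_apply, gaussianPDF]
  rw [gaussianPDFReal_eq_exp_channelLog (l := l) hv a y, ENNReal.ofReal_mul (Real.exp_pos _).le]
  ring

lemma channel_fst (l v : ℝ≥0) : (channel l v).fst = gaussianReal 0 (l + v) := by
  have h := gaussianReal_conv_gaussianReal (m₁ := 0) (m₂ := 0) (v₁ := l) (v₂ := v)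
  rw [add_zero] at h
  rw [← h, Measure.fst, channel, Measure.map_map (by fun_prop) (by fun_prop)]
  rfl

lemma channel_snd (l v : ℝ≥0) : (channel l v).snd = gaussianReal 0 l := by
  rw [Measure.snd, channel, Measure.map_map (by fun_prop) (by fun_prop)]
  exact Measure.fst_prod

lemma integrable_sq_gaussianReal (s : ℝ≥0) : Integrable (fun z => z ^ 2) (gaussianReal 0 s) :=
  (memLp_id_gaussianReal 2).integrable_sq

lemma integral_sq_gaussianReal (s : ℝ≥0) : ∫ z, z ^ 2 ∂(gaussianReal 0 s) = s := by
  have h1 := variance_id_gaussianReal (μ := 0) (v := s)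
  rw [variance_eq_integral aemeasurable_id] at h1
  simpa using h1

/-- The two quadratic terms of `channelLog` have means `-1 / 2` and `1 / 2`, so only the logarithm
survives in the divergence. -/
theorem mutualInfo_channel (l : ℝ≥0) {v : ℝ≥0} (hv : 0 < v) :
    mutualInfo (channel l v) = ENNReal.ofReal (Real.log (1 + l / v) / 2) := by
  have hv' : (0 : ℝ) < v := hv
  have hl : (0 : ℝ) ≤ l := l.2
  have hcm : Measurable (channelLog l v) := by unfold channelLog; fun_prop
  have i1 : Integrable (fun p : ℝ × ℝ => (p.1 - p.2) ^ 2) (channel l v) := by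
    rw [channel, integrable_map_measure (by fun_prop) (by fun_prop)]
    have := (integrable_sq_gaussianReal v).comp_snd (gaussianReal 0 l)
    refine this.congr (ae_of_all _ fun p => ?_)
    simp
  have i2 : Integrable (fun p : ℝ × ℝ => p.1 ^ 2) (channel l v) := by
    have := integrable_sq_gaussianReal (l + v)
    rw [← channel_fst, Measure.fst, integrable_map_measure (by fun_prop) (by fun_prop)] at this
    exact this
  have e1 : ∫ p, (p.1 - p.2) ^ 2 ∂(channel l v) = v := by
    rw [channel, integral_map (by fun_prop) (by fun_prop)]
    have := integral_fun_snd (μ := gaussianReal 0 l) (ν := gaussianReal 0 v) (fun z : ℝ => z ^ 2)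
    simp only [add_sub_cancel_left]
    rw [this, integral_sq_gaussianReal]
    simp
  have e2 : ∫ p, p.1 ^ 2 ∂(channel l v) = l + v := by
    have := integral_sq_gaussianReal (l + v)
    rw [← channel_fst, Measure.fst, integral_map (by fun_prop) (by fun_prop)] at this
    exact_mod_cast this
  have i3 : Integrable (fun p : ℝ × ℝ => -(p.1 - p.2) ^ 2 / (2 * v) + p.1 ^ 2 / (2 * (l + v)))
      (channel l v) := (i1.neg.div_const _).add (i2.div_const _)
  unfold mutualInfo
  rw [channel_fst, channel_snd, klDiv_withDensity_exp hcm (channel_eq_withDensity hv)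
    (i3.add (integrable_const _))]
  congr 1
  unfold channelLog
  have i1' : Integrable (fun p : ℝ × ℝ => -(p.1 - p.2) ^ 2 / (2 * v)) (channel l v) :=
    i1.neg.div_const _
  rw [integral_add i3 (integrable_const _), integral_add i1' (i2.div_const _),
    integral_div, integral_div, integral_neg, e1, e2]
  simp
  field_simp
  ring

end Channel

end GPTS

/-! ### The information gain as a log-determinant. -/

namespace GPTS

section InfoGain

open Matrix

/-- In an orthonormal eigenbasis of `S` the coordinates are independent. The basis is a parameter
because one basis must serve both the signal and the noise. -/
lemma multivariateGaussian_eq_map_pi {n : ℕ} {S : Matrix (Fin n) (Fin n) ℝ} (hS : S.PosSemidef)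
    (b : OrthonormalBasis (Fin n) ℝ (EuclideanSpace ℝ (Fin n))) {l : Fin n → ℝ≥0}
    (hb : ∀ i, S *ᵥ ⇑(b i) = (l i : ℝ) • ⇑(b i)) :
    multivariateGaussian (0 : EuclideanSpace ℝ (Fin n)) S =
      (Measure.pi fun i => gaussianReal 0 (l i)).map
        fun z => b.repr.symm (WithLp.toLp 2 z) := by
  apply Measure.ext_of_charFun (E := EuclideanSpace ℝ (Fin n))
  ext s
  have h1 : charFun ((Measure.pi fun i => gaussianReal 0 (l i)).map
      fun z => b.repr.symm (WithLp.toLp 2 z)) s =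
      charFun ((Measure.pi fun i => gaussianReal 0 (l i)).map (WithLp.toLp 2)) (b.repr s) := by
    simp only [charFun]
    rw [integral_map (by fun_prop) (by fun_prop), integral_map (by fun_prop) (by fun_prop)]
    refine integral_congr_ae (ae_of_all _ fun z => ?_)
    simp only
    rw [← b.repr.inner_map_map, LinearIsometryEquiv.apply_symm_apply]
  have h2 : s.ofLp ⬝ᵥ S *ᵥ s.ofLp = ∑ i, (l i : ℝ) * b.repr s i ^ 2 := by
    have h3 : s = ∑ i, b.repr s i • b i := (b.sum_repr s).symm
    have h4 : S *ᵥ s.ofLp = ∑ i, (b.repr s i * l i) • (b i).ofLp := by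
      conv_lhs => rw [h3]
      rw [WithLp.ofLp_sum, Matrix.mulVec_sum]
      refine Finset.sum_congr rfl fun i _ => ?_
      rw [WithLp.ofLp_smul, Matrix.mulVec_smul, hb, smul_smul]
    rw [h4, dotProduct_sum]
    refine Finset.sum_congr rfl fun i _ => ?_
    have h5 : s.ofLp ⬝ᵥ (b i).ofLp = b.repr s i := by
      rw [b.repr_apply_apply, EuclideanSpace.inner_eq_star_dotProduct]
      simp
    rw [dotProduct_smul, h5, smul_eq_mul]
    ring
  rw [h1, charFun_multivariateGaussian hS, charFun_pi, h2]
  simp_rw [charFun_gaussianReal, ← Complex.exp_sum]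
  congr 1
  push_cast
  simp [Finset.sum_div]

/-- The characteristic polynomial of `K` evaluated at `-v`, up to a common sign. -/
lemma det_smul_one_add {n : ℕ} {K : Matrix (Fin n) (Fin n) ℝ} (hK : K.IsHermitian) (v : ℝ) :
    (v • (1 : Matrix (Fin n) (Fin n) ℝ) + K).det = ∏ i, (v + hK.eigenvalues i) := by
  have h1 := congrArg (Polynomial.eval (-v)) hK.charpoly_eq
  rw [Matrix.eval_charpoly, Polynomial.eval_prod] at h1
  have h2 : Matrix.scalar (Fin n) (-v) - K = -(v • (1 : Matrix (Fin n) (Fin n) ℝ) + K) := by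
    ext i j
    simp [Matrix.scalar_apply, Matrix.diagonal_apply, Matrix.one_apply]
    split_ifs <;> ring
  rw [h2, Matrix.det_neg] at h1
  have h3 : ∏ i, (-v - hK.eigenvalues i) =
      (-1) ^ (Fintype.card (Fin n)) * ∏ i, (v + hK.eigenvalues i) := by
    rw [← Finset.card_univ, ← Finset.prod_const, ← Finset.prod_mul_distrib]
    refine Finset.prod_congr rfl fun i _ => by ring
  simp only [Polynomial.eval_sub, Polynomial.eval_X, Polynomial.eval_C, RCLike.ofReal_real_eq_id,
    id_eq, h3] at h1
  exact mul_left_cancel₀ (pow_ne_zero _ (by norm_num)) h1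

variable {d : ℕ} {k : E d → E d → ℝ} {v : ℝ≥0}

/-- An eigenbasis of the kernel matrix diagonalizes the isotropic noise as well, so the observation
splits into independent scalar channels. Mutual information is invariant under the change of
coordinates. -/
lemma infoGain_eq_sum_eigenvalues (hv : 0 < v) {T : ℕ} (A : Fin T → E d)
    (hK : (Matrix.of fun i j => k (A i) (A j)).PosSemidef) :
    infoGain k v A = ENNReal.ofReal (∑ i, Real.log (1 + hK.1.eigenvalues i / v) / 2) := by
  set K : Matrix (Fin T) (Fin T) ℝ := Matrix.of fun i j => k (A i) (A j)
  let b := hK.1.eigenvectorBasis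
  let l : Fin T → ℝ≥0 := fun i => ⟨hK.1.eigenvalues i, hK.eigenvalues_nonneg i⟩
  have h1 := multivariateGaussian_eq_map_pi hK b (l := l) fun i => hK.1.mulVec_eigenvectorBasis i
  have hvI : ((v : ℝ) • (1 : Matrix (Fin T) (Fin T) ℝ)).PosSemidef :=
    Matrix.PosSemidef.one.smul v.2
  have h2 := multivariateGaussian_eq_map_pi hvI b (l := fun _ => v) fun i => by
    rw [Matrix.smul_mulVec, Matrix.one_mulVec]
  let Ψ : (Fin T → ℝ) ≃ᵐ EuclideanSpace ℝ (Fin T) :=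
    (MeasurableEquiv.toLp 2 (Fin T → ℝ)).trans b.repr.symm.toHomeomorph.toMeasurableEquiv
  have hΨ : ∀ z, Ψ z = b.repr.symm (WithLp.toLp 2 z) := fun _ => rfl
  have hΨadd : ∀ z w, Ψ (z + w) = Ψ z + Ψ w := fun z w => by simp [hΨ]
  have h3 : ((multivariateGaussian (0 : EuclideanSpace ℝ (Fin T)) K).prod
      (multivariateGaussian 0 ((v : ℝ) • (1 : Matrix (Fin T) (Fin T) ℝ)))).map
        (fun p => (p.1 + p.2, p.1)) =
      ((Measure.pi fun i => channel (l i) v).map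
        fun w => (fun i => (w i).1, fun i => (w i).2)).map (Prod.map Ψ Ψ) := by
    have hm : Measurable fun w : Fin T → ℝ × ℝ => (fun i => (w i).1, fun i => (w i).2) :=
      (MeasurableEquiv.arrowProdEquivProdArrow ℝ ℝ (Fin T)).measurable
    have hpi : (Measure.pi fun i => channel (l i) v) =
        (Measure.pi fun i => (gaussianReal 0 (l i)).prod (gaussianReal 0 v)).map
          fun w i => ((w i).1 + (w i).2, (w i).1) := by
      rw [Measure.pi_map_pi (f := fun _ (p : ℝ × ℝ) => (p.1 + p.2, p.1)) fun i => by fun_prop]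
      rfl
    rw [h1, h2, hpi]
    change ((Measure.map Ψ _).prod (Measure.map Ψ _)).map _ = _
    rw [Measure.map_prod_map _ _ Ψ.measurable Ψ.measurable,
      ← (measurePreserving_arrowProdEquivProdArrow ℝ ℝ (Fin T) (fun i => gaussianReal 0 (l i))
        fun i => gaussianReal 0 v).map_eq, Measure.map_map (by fun_prop) (by fun_prop),
      Measure.map_map (by fun_prop) (by fun_prop), Measure.map_map hm (by fun_prop),
      Measure.map_map (by fun_prop) (by fun_prop)]
    congr 1
    funext w
    refine Prod.ext ?_ rfl
    exact (hΨadd _ _).symm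
  have hch : IsProbabilityMeasure ((Measure.pi fun i => channel (l i) v).map
      fun w => (fun i => (w i).1, fun i => (w i).2)) :=
    Measure.isProbabilityMeasure_map
      (MeasurableEquiv.arrowProdEquivProdArrow ℝ ℝ (Fin T)).measurable.aemeasurable
  unfold infoGain
  rw [h3, mutualInfo_map_equiv, mutualInfo_pi, ENNReal.ofReal_sum_of_nonneg]
  · exact Finset.sum_congr rfl fun i _ => mutualInfo_channel (l i) hv
  · intro i _
    have : 0 ≤ hK.1.eigenvalues i / v := div_nonneg (hK.eigenvalues_nonneg i) v.2
    have := Real.log_nonneg (x := 1 + hK.1.eigenvalues i / v) (by linarith)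
    positivity

/-- The information gain as a log-determinant. -/
theorem infoGain_eq_log_det (hv : 0 < v) {T : ℕ} (A : Fin T → E d)
    (hK : (Matrix.of fun i j => k (A i) (A j)).PosSemidef) :
    infoGain k v A = ENNReal.ofReal (Real.log (((v : ℝ) • (1 : Matrix (Fin T) (Fin T) ℝ) +
      Matrix.of fun i j => k (A i) (A j)).det / v ^ T) / 2) := by
  have hv' : (0 : ℝ) < v := hv
  rw [infoGain_eq_sum_eigenvalues hv A hK, det_smul_one_add hK.1]
  congr 1
  have h1 : (v : ℝ) ^ T = ∏ _i : Fin T, (v : ℝ) := by simp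
  rw [h1, ← Finset.prod_div_distrib, Real.log_prod, Finset.sum_div]
  · refine Finset.sum_congr rfl fun i _ => ?_
    rw [add_div, div_self hv'.ne']
  · intro i _
    have := hK.eigenvalues_nonneg i
    positivity

end InfoGain

end GPTS

/-! ### From the information gain to the second moment of the cumulative regret. -/

namespace GPTS

section Gain

variable {d : ℕ} {X : Set (E d)} {Ω : Type*} [MeasurableSpace Ω] {k : E d → E d → ℝ} {v : ℝ≥0}
  {f : Ω → C(X, ℝ)} {ε : ℕ → Ω → ℝ} {g : ℕ → Ω → C(X, ℝ)} {x : ℕ → Ω → X} {P : Measure Ω}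

lemma IsGP.posSemidef {α Ω' : Type*} {mΩ : MeasurableSpace Ω'} {Y : α → Ω' → ℝ} {m : α → ℝ}
    {c : α → α → ℝ} {ν : Measure Ω'} (h : IsGP Y m c ν) {n : ℕ} (A : Fin n → α) :
    (Matrix.of fun i j => c (A i) (A j)).PosSemidef := by
  refine Matrix.PosSemidef.of_dotProduct_mulVec_nonneg ?_ fun z => ?_
  · ext i j
    simpa using h.symm (A j) (A i)
  · have h1 := h.sum_sum_nonneg Finset.univ z A
    refine h1.trans_eq ?_
    simp only [dotProduct, Matrix.mulVec, Matrix.of_apply, Pi.star_apply, star_trivial,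
      Finset.mul_sum]
    exact Finset.sum_congr rfl fun i _ => Finset.sum_congr rfl fun j _ => by ring

namespace IsGPModel

/-- The chain rule of information: round `t` contributes a scalar channel whose signal has the
current posterior variance. -/
lemma infoGain_eq (hm : IsGPModel k v f ε P) (hv : 0 < v) (T : ℕ) (y : ℕ → X) :
    infoGain k v (fun i : Fin T => (y i : E d)) = ENNReal.ofReal (∑ t ∈ Finset.range T,
      Real.log (1 + postCov v (fun p q : X => k p q) t (fun i => y i) (y t) (y t) / v) / 2) := by
  have hv' : (0 : ℝ) < v := hv
  have hK := hm.isGP.posSemidef fun i : Fin T => y i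
  rw [infoGain_eq_log_det hv (fun i : Fin T => (y i : E d)) hK]
  have h1 := hm.isGP.det_eq_prod_postCov measurable_eval_path hv T y
  rw [h1]
  congr 1
  rw [← Finset.sum_div]
  congr 1
  have h2 : (v : ℝ) ^ T = ∏ _i ∈ Finset.range T, (v : ℝ) := by simp
  rw [h2, ← Finset.prod_div_distrib, Real.log_prod]
  · refine Finset.sum_congr rfl fun i _ => ?_
    rw [add_div, div_self hv'.ne']
  · intro t _
    have := hm.isGP.postCov_nonneg measurable_eval_path hv t (fun i => y i) (y t)
    positivity

/-- Needed because `toReal` sends `⊤` to `0`: without finiteness the supremum would not bound the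
individual gains after conversion. -/
lemma iSup_infoGain_ne_top [Nonempty X] (hm : IsGPModel k v f ε P) (hv : 0 < v) (T : ℕ) :
    (⨆ A : Fin T → X, infoGain k v (fun i => (A i : E d))) ≠ ⊤ := by
  have hv' : (0 : ℝ) < v := hv
  refine ne_top_of_le_ne_top (b := ENNReal.ofReal (T * (Real.log (1 + 1 / v) / 2)))
    ENNReal.ofReal_ne_top (iSup_le fun A => ?_)
  let y : ℕ → X := fun n => if h : n < T then A ⟨n, h⟩ else Classical.arbitrary X
  have hy : (fun i : Fin T => (A i : E d)) = fun i : Fin T => (y i : E d) := by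
    funext i
    simp [y]
  rw [hy, hm.infoGain_eq hv]
  refine ENNReal.ofReal_le_ofReal ((Finset.sum_le_card_nsmul _ _ _ fun t _ => ?_).trans_eq
    (by rw [nsmul_eq_mul, Finset.card_range]))
  have h1 := hm.isGP.postCov_nonneg measurable_eval_path hv t (fun i => y i) (y t)
  have h2 := (hm.isGP.postCov_le measurable_eval_path hv t (fun i => y i) (y t)).trans
    (hm.kernel_le_one _ _)
  gcongr

/-- The information about the objective that is collected along a path of queries. -/
lemma sum_log_le_maxInfoGain (hm : IsGPModel k v f ε P) (hv : 0 < v) (T : ℕ) (y : ℕ → X) :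
    ∑ t ∈ Finset.range T,
      Real.log (1 + postCov v (fun p q : X => k p q) t (fun i => y i) (y t) (y t) / v) / 2 ≤
        maxInfoGain X k v T := by
  have : Nonempty X := ⟨y 0⟩
  have h1 := le_iSup (fun A : Fin T → X => infoGain k v (fun i => (A i : E d))) fun i => y i
  simp only [hm.infoGain_eq hv] at h1
  unfold maxInfoGain
  exact (ENNReal.ofReal_le_iff_le_toReal (hm.iSup_infoGain_ne_top hv T)).1 h1

/-- Bernoulli's inequality `(1 + s) ^ c ≤ 1 + c * s` for exponents in `[0, 1]`. It turns a
logarithmic gain into a variance and produces `C₁`. -/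
lemma mul_log_le_log {c v : ℝ} (hv : 0 < v) (h0 : 0 ≤ c) (h1 : c ≤ 1) :
    c * Real.log (1 + v⁻¹) ≤ Real.log (1 + c / v) := by
  have hv' : 0 < v⁻¹ := inv_pos.2 hv
  have h2 := rpow_one_add_le_one_add_mul_self (s := v⁻¹) (by linarith) h0 h1
  rw [← Real.log_rpow (by linarith), div_eq_mul_inv]
  exact Real.log_le_log (by positivity) h2

lemma C₁_pos (hv : 0 < v) : 0 < C₁ v := by
  have : (0 : ℝ) < (v : ℝ)⁻¹ := inv_pos.2 hv
  exact div_pos two_pos (Real.log_pos (by linarith))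

lemma maxInfoGain_nonneg (X : Set (E d)) (k : E d → E d → ℝ) (v : ℝ≥0) (T : ℕ) :
    0 ≤ maxInfoGain X k v T := ENNReal.toReal_nonneg

lemma sum_postCov_le (hm : IsGPModel k v f ε P) (hv : 0 < v) (T : ℕ) (y : ℕ → X) :
    ∑ t ∈ Finset.range T, postCov v (fun p q : X => k p q) t (fun i => y i) (y t) (y t) ≤
      C₁ v * maxInfoGain X k v T := by
  have hv' : (0 : ℝ) < v := hv
  have hi : (0 : ℝ) < (v : ℝ)⁻¹ := inv_pos.2 hv
  have hlog : 0 < Real.log (1 + (v : ℝ)⁻¹) := Real.log_pos (by linarith)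
  refine le_trans ?_ (mul_le_mul_of_nonneg_left (hm.sum_log_le_maxInfoGain hv T y)
    (C₁_pos hv).le)
  rw [Finset.mul_sum]
  refine Finset.sum_le_sum fun t _ => ?_
  have h1 := hm.isGP.postCov_nonneg measurable_eval_path hv t (fun i => y i) (y t)
  have h2 := (hm.isGP.postCov_le measurable_eval_path hv t (fun i => y i) (y t)).trans
    (hm.kernel_le_one _ _)
  have h3 := mul_log_le_log hv' h1 h2
  have h4 : ∀ z : ℝ, C₁ v * (z / 2) = z / Real.log (1 + (v : ℝ)⁻¹) := fun z => by
    unfold C₁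
    ring
  rw [h4, le_div_iff₀ hlog]
  exact h3

end IsGPModel

namespace IsThompsonSampling

lemma aemeasurable_query (hs : IsThompsonSampling f ε g x P) (t : ℕ) : AEMeasurable (x t) P := by
  obtain ⟨post, _, _, hg⟩ := hs.posterior_sample t
  obtain ⟨select, hsel, -, hx⟩ := hs.argmax t
  rw [show x t = _ from funext hx]
  exact hsel.comp_aemeasurable ((hs.aemeasurable_data t).prodMk hg.aemeasurable_snd)

end IsThompsonSampling

/-- Posterior variances depend on the queries but not on the observed values, and `sum_postCov_le`
holds for every sequence of queries. Hence the bound is pathwise, and the adaptivity of the queries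
costs nothing. -/
lemma IsThompsonSampling.sum_lintegral_var_le [IsProbabilityMeasure P]
    (hm : IsGPModel k v f ε P) (hs : IsThompsonSampling f ε g x P)
    (hv : 0 < v) (T : ℕ) {π : X → X} (hπ : Measurable π) {c₁ c₂ : ℝ} (hc₁ : 0 ≤ c₁)
    (hvar : ∀ (t : ℕ) (D : Fin t → X × ℝ) (p : X),
      varAt k v D (π p) ≤ c₁ * varAt k v D p + c₂) :
    ∑ t ∈ Finset.range T,
      ∫⁻ ω, ENNReal.ofReal (varAt k v (data f ε x t ω) (π (x t ω))) ∂P ≤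
        ENNReal.ofReal (c₁ * (C₁ v * maxInfoGain X k v T) + T * c₂) := by
  have hmeas : ∀ t ∈ Finset.range T, AEMeasurable
      (fun ω => ENNReal.ofReal (varAt k v (data f ε x t ω) (π (x t ω)))) P := fun t _ =>
    ((hm.measurable_varAt t).comp_aemeasurable ((hs.aemeasurable_data t).prodMk
      (hπ.comp_aemeasurable (hs.aemeasurable_query t)))).ennreal_ofReal
  rw [← lintegral_finsetSum' _ hmeas]
  refine (lintegral_mono (g := fun _ => ENNReal.ofReal
    (c₁ * (C₁ v * maxInfoGain X k v T) + T * c₂)) fun ω => ?_).trans (by simp)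
  rw [← ENNReal.ofReal_sum_of_nonneg fun t _ => hm.varAt_nonneg hv _ _]
  refine ENNReal.ofReal_le_ofReal ((Finset.sum_le_sum fun t _ => hvar t _ _).trans ?_)
  rw [Finset.sum_add_distrib, ← Finset.mul_sum, Finset.sum_const, nsmul_eq_mul, Finset.card_range]
  gcongr
  exact hm.sum_postCov_le hv T fun t => x t ω

/-- The second moment of the cumulative regret, with the domain discretized by the map `π`. -/
theorem Run.integral_regret_sq_le (A : Run X k v) (hv : 0 < v) (T : ℕ) {π : X → X}
    (hπ : Measurable π) {S : Finset X} (hS : ∀ p, π p ∈ S) {β H : ℝ} (hβ : 1 ≤ β) (hH : 0 ≤ H)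
    (herr : ∀ q : A.Ω → X, AEMeasurable q A.P →
      ∫⁻ ω, ENNReal.ofReal ((A.f ω (q ω) - A.f ω (π (q ω))) ^ 2) ∂A.P ≤ ENNReal.ofReal H)
    {c₁ c₂ : ℝ} (hc₁ : 0 ≤ c₁) (hc₂ : 0 ≤ c₂)
    (hvar : ∀ (t : ℕ) (D : Fin t → X × ℝ) (p : X),
      varAt k v D (π p) ≤ c₁ * varAt k v D p + c₂) :
    Integrable (fun ω => A.regret T ω ^ 2) A.P ∧
    ∫ ω, A.regret T ω ^ 2 ∂A.P ≤
      10 * T * (β + 1) * (c₁ * (C₁ v * maxInfoGain X k v T) + T * c₂) +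
        T ^ 2 * (20 * (S.card * (√β * stdPDF (√β))) + 80 * H) := by
  have hm := A.model
  have hs := A.sampling
  have hgap := fun t => hs.lintegral_gap_sq_le hm hv t hπ hS hβ herr
  have hC := (IsGPModel.C₁_pos hv).le
  have hγ := IsGPModel.maxInfoGain_nonneg X k v T
  have hφ := (stdPDF_pos (√β)).le
  have hβ0 : 0 ≤ β := by linarith
  set B := 10 * T * (β + 1) * (c₁ * (C₁ v * maxInfoGain X k v T) + T * c₂) +
        T ^ 2 * (20 * (S.card * (√β * stdPDF (√β))) + 80 * H) with hB
  have hB0 : 0 ≤ B := by positivity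
  have hRm : AEMeasurable (A.regret T) A.P := by
    unfold Run.regret
    exact Finset.aemeasurable_fun_sum _ fun t _ => (hgap t).1
  -- Cauchy–Schwarz over the `T` rounds reduces the square of the sum to one-round second moments.
  -- All is done with `lintegral`, so that integrability comes out along with the bound.
  have key : ∫⁻ ω, ENNReal.ofReal (A.regret T ω ^ 2) ∂A.P ≤ ENNReal.ofReal B := by
    calc ∫⁻ ω, ENNReal.ofReal (A.regret T ω ^ 2) ∂A.P
        ≤ ∫⁻ ω, (T : ℝ≥0∞) * ∑ t ∈ Finset.range T,
          ENNReal.ofReal (((⨆ p : X, A.f ω p) - A.f ω (A.x t ω)) ^ 2) ∂A.P := by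
          refine lintegral_mono fun ω => ?_
          rw [← ENNReal.ofReal_sum_of_nonneg fun t _ => sq_nonneg _, ← ENNReal.ofReal_natCast,
            ← ENNReal.ofReal_mul (by positivity)]
          refine ENNReal.ofReal_le_ofReal ?_
          have := sq_sum_le_card_mul_sum_sq (s := Finset.range T)
            (f := fun t => (⨆ p : X, A.f ω p) - A.f ω (A.x t ω))
          rwa [Finset.card_range] at this
      _ = (T : ℝ≥0∞) * ∑ t ∈ Finset.range T, ∫⁻ ω,
          ENNReal.ofReal (((⨆ p : X, A.f ω p) - A.f ω (A.x t ω)) ^ 2) ∂A.P := by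
          have hmt : ∀ t ∈ Finset.range T, AEMeasurable (fun ω =>
              ENNReal.ofReal (((⨆ p : X, A.f ω p) - A.f ω (A.x t ω)) ^ 2)) A.P := fun t _ =>
            ((hgap t).1.pow_const 2).ennreal_ofReal
          rw [lintegral_const_mul'' _ (Finset.aemeasurable_fun_sum _ hmt),
            lintegral_finsetSum' _ hmt]
      _ ≤ (T : ℝ≥0∞) * ∑ t ∈ Finset.range T, (10 * ENNReal.ofReal (β + 1) *
          ∫⁻ ω, ENNReal.ofReal (varAt k v (data A.f A.ε A.x t ω) (π (A.x t ω))) ∂A.P +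
            ENNReal.ofReal (20 * (S.card * (√β * stdPDF (√β))) + 80 * H)) := by
          gcongr with t _
          refine (hgap t).2.trans_eq ?_
          rw [ENNReal.ofReal_add hβ0 zero_le_one, ENNReal.ofReal_one,
            ENNReal.ofReal_add (by positivity) (by positivity),
            ENNReal.ofReal_mul (by norm_num : (0 : ℝ) ≤ 80),
            show 20 * (S.card * (√β * stdPDF (√β))) =
              10 * (S.card * (2 * √β * stdPDF (√β))) by ring,
            ENNReal.ofReal_mul (by norm_num : (0 : ℝ) ≤ 10), ENNReal.ofReal_mul (Nat.cast_nonneg _),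
            ENNReal.ofReal_natCast, ENNReal.ofReal_ofNat, ENNReal.ofReal_ofNat]
          ring
      _ ≤ (T : ℝ≥0∞) * (10 * ENNReal.ofReal (β + 1) *
          ENNReal.ofReal (c₁ * (C₁ v * maxInfoGain X k v T) + T * c₂) +
            T * ENNReal.ofReal (20 * (S.card * (√β * stdPDF (√β))) + 80 * H)) := by
          rw [Finset.sum_add_distrib, ← Finset.mul_sum, Finset.sum_const, nsmul_eq_mul,
            Finset.card_range]
          gcongr
          exact hs.sum_lintegral_var_le hm hv T hπ hc₁ hvar
      _ = ENNReal.ofReal B := by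
          rw [← ENNReal.ofReal_natCast, ← ENNReal.ofReal_ofNat 10,
            ← ENNReal.ofReal_mul (by positivity), ← ENNReal.ofReal_mul (by positivity),
            ← ENNReal.ofReal_mul (by positivity), ← ENNReal.ofReal_add (by positivity)
              (by positivity), ← ENNReal.ofReal_mul (by positivity), hB]
          congr 1
          ring
  have hsm : AEStronglyMeasurable (fun ω => A.regret T ω ^ 2) A.P :=
    (hRm.pow_const 2).aestronglyMeasurable
  refine ⟨⟨hsm, ?_⟩, ?_⟩
  · rw [hasFiniteIntegral_iff_ofReal (ae_of_all _ fun ω => sq_nonneg _)]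
    exact key.trans_lt ENNReal.ofReal_lt_top
  · rw [integral_eq_lintegral_of_nonneg_ae (ae_of_all _ fun ω => sq_nonneg _) hsm]
    exact ENNReal.toReal_le_of_le_ofReal hB0 key

end Gain

end GPTS

namespace GPTS

/-! ### Discretization of the domain -/

section Grid

variable {d : ℕ} {X : Set (E d)}

/-- The index of the cell of the regular grid with `n` cells per axis on `[0, r]ᵈ`. -/
noncomputable def gridCell (r : ℝ) (n : ℕ) (p : E d) (j : Fin d) : ℕ := min ⌊p j * n / r⌋₊ (n - 1)

lemma measurable_gridCell (r : ℝ) (n : ℕ) : Measurable (gridCell (d := d) r n) := by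
  refine measurable_pi_lambda _ fun j => ?_
  unfold gridCell
  have h1 : Measurable fun p : E d => p j * n / r := by fun_prop
  exact (Nat.measurable_floor.comp h1).min measurable_const

lemma gridCell_dist {r : ℝ} (hr : 0 < r) {n : ℕ} {j : Fin d} (hn : 0 < n) {p q : E d}
    (hp : p j ∈ Icc 0 r) (hq : q j ∈ Icc 0 r) (h : gridCell r n p j = gridCell r n q j) :
    |p j - q j| ≤ r / n := by
  have hn' : (0 : ℝ) < n := by exact_mod_cast hn
  have key : ∀ z ∈ Icc 0 r, ((min ⌊z * n / r⌋₊ (n - 1) : ℕ) : ℝ) ≤ z * n / r ∧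
      z * n / r ≤ ((min ⌊z * n / r⌋₊ (n - 1) : ℕ) : ℝ) + 1 := by
    intro z hz
    have h0 : 0 ≤ z * n / r := div_nonneg (mul_nonneg hz.1 hn'.le) hr.le
    have h1 : z * n / r ≤ n := by
      rw [div_le_iff₀ hr, mul_comm (n : ℝ)]
      exact mul_le_mul_of_nonneg_right hz.2 hn'.le
    constructor
    · exact (Nat.cast_le.2 (min_le_left _ _)).trans (Nat.floor_le h0)
    -- The cap at `n - 1` puts the upper face `z = r` into the last cell.
    · rcases le_total ⌊z * n / r⌋₊ (n - 1) with h2 | h2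
      · rw [min_eq_left h2]
        exact (Nat.lt_floor_add_one _).le
      · rw [min_eq_right h2, Nat.cast_sub (Nat.succ_le_of_lt hn)]
        simpa using h1
  have hp' := key _ hp
  have hq' := key _ hq
  unfold gridCell at h
  rw [← h] at hq'
  have h3 : |p j * n / r - q j * n / r| ≤ 1 := by
    rw [abs_le]
    constructor <;> linarith [hp'.1, hp'.2, hq'.1, hq'.2]
  have h4 : p j * n / r - q j * n / r = (p j - q j) * (n / r) := by ring
  rw [h4, abs_mul, abs_of_pos (div_pos hn' hr)] at h3
  rw [le_div_iff₀ hn']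
  have h5 : |p j - q j| * (n / r) * r ≤ 1 * r := mul_le_mul_of_nonneg_right h3 hr.le
  have h6 : |p j - q j| * (n / r) * r = |p j - q j| * n := by
    field_simp
  linarith

/-- A measurable map onto at most `nᵈ` points of `X` that stays within the grid cells. -/
lemma exists_grid [Nonempty X] {r : ℝ} (hr : 0 < r) (hX : ∀ p ∈ X, ∀ j, p j ∈ Icc 0 r) {n : ℕ}
    (hn : d ≠ 0 → 0 < n) : ∃ (π : X → X) (S : Finset X), Measurable π ∧ (∀ p, π p ∈ S) ∧
      S.card ≤ n ^ d ∧ ∀ (p : X) j, |(p : E d) j - (π p : E d) j| ≤ r / n := by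
  classical
  have hn' : ∀ _ : Fin d, 0 < n := fun j => hn fun h => by subst h; exact j.elim0
  -- A representative inside `X` for each occupied cell, since grid points themselves need not
  -- belong to `X`.
  let ρ : (Fin d → ℕ) → X := fun i =>
    if h : ∃ p : X, gridCell r n (p : E d) = i then h.choose else Classical.arbitrary X
  have hρ : ∀ p : X, gridCell r n (ρ (gridCell r n (p : E d)) : E d) = gridCell r n (p : E d) := by
    intro p
    have h : ∃ q : X, gridCell r n (q : E d) = gridCell r n (p : E d) := ⟨p, rfl⟩
    have h2 : ρ (gridCell r n (p : E d)) = h.choose := dif_pos h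
    rw [h2]
    exact h.choose_spec
  refine ⟨fun p => ρ (gridCell r n (p : E d)),
    (Fintype.piFinset fun _ : Fin d => Finset.range n).image ρ, ?_, fun p => ?_, ?_, fun p j => ?_⟩
  · exact (measurable_of_countable ρ).comp ((measurable_gridCell r n).comp measurable_subtype_coe)
  · refine Finset.mem_image_of_mem _ (Fintype.mem_piFinset.2 fun j => Finset.mem_range.2 ?_)
    exact (min_le_right _ _).trans_lt (Nat.sub_lt (hn' j) one_pos)
  · exact Finset.card_image_le.trans (by simp)
  · exact gridCell_dist hr (hn' j) (hX _ p.2 j) (hX _ (Subtype.coe_prop _) j)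
      (congrFun (hρ p).symm j)

lemma norm_le_sum_abs (p : E d) : ‖p‖ ≤ ∑ j, |p j| := by
  rw [EuclideanSpace.norm_eq]
  refine Real.sqrt_le_iff.2 ⟨Finset.sum_nonneg fun _ _ => abs_nonneg _, ?_⟩
  exact Finset.sum_sq_le_sq_sum_of_nonneg fun _ _ => norm_nonneg _

end Grid

/-! ### Moments from a sub-Gaussian tail -/

section Tail

/-- Second moment of a variable with tail `A exp (-(u / b)²)`, where `A ≥ 1`. -/
lemma lintegral_sq_le_of_tail {Ω : Type*} [MeasurableSpace Ω] {P : Measure Ω}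
    [IsProbabilityMeasure P] {W : Ω → ℝ} (hW : AEMeasurable W P) (hW0 : ∀ ω, 0 ≤ W ω) {A b : ℝ}
    (hA : 1 ≤ A) (hb : 0 < b)
    (htail : ∀ u, 0 < u → P {ω | u < W ω} ≤ ENNReal.ofReal (A * Real.exp (-(u / b) ^ 2))) :
    ∫⁻ ω, ENNReal.ofReal (W ω ^ 2) ∂P ≤ ENNReal.ofReal (b ^ 2 * (Real.log A + 1)) := by
  have hA0 : 0 < A := by linarith
  have hlog : 0 ≤ Real.log A := Real.log_nonneg hA
  have hs0 : 0 ≤ b ^ 2 * Real.log A := by positivity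
  have htail2 : ∀ s, 0 < s → P {ω | s < W ω ^ 2} ≤
      ENNReal.ofReal (A * Real.exp (-(1 / b ^ 2) * s)) := fun s hs => by
    have h1 : {ω | s < W ω ^ 2} = {ω | √s < W ω} := by
      ext ω
      simp only [mem_ofPred]
      exact ⟨fun h => by simpa [Real.sqrt_sq (hW0 ω)] using Real.sqrt_lt_sqrt hs.le h,
        fun h => by simpa [Real.sq_sqrt hs.le] using pow_lt_pow_left₀ h (Real.sqrt_nonneg s) two_ne_zero⟩
    rw [h1]
    refine (htail _ (Real.sqrt_pos.2 hs)).trans_eq ?_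
    rw [div_pow, Real.sq_sqrt hs.le]
    congr 3
    ring
  rw [lintegral_eq_lintegral_meas_lt P (ae_of_all _ fun ω => sq_nonneg _) (hW.pow_const 2)]
  have hneg : -(1 / b ^ 2) < 0 := by
    have : 0 < 1 / b ^ 2 := by positivity
    linarith
  -- The layer-cake integral is cut at `b ^ 2 * Real.log A`, where the tail bound equals one: below,
  -- the probability is bounded by one; above, the exponential integrates to `b ^ 2`.
  calc ∫⁻ s in Ioi (0 : ℝ), P {ω | s < W ω ^ 2}
      = ∫⁻ s in Ioc 0 (b ^ 2 * Real.log A) ∪ Ioi (b ^ 2 * Real.log A), P {ω | s < W ω ^ 2} := by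
        rw [Ioc_union_Ioi_eq_Ioi hs0]
    _ ≤ _ := lintegral_union_le _ _ _
    _ ≤ (∫⁻ _s in Ioc 0 (b ^ 2 * Real.log A), 1) +
        ∫⁻ s in Ioi (b ^ 2 * Real.log A), ENNReal.ofReal (A * Real.exp (-(1 / b ^ 2) * s)) := by
        refine add_le_add (lintegral_mono fun s => prob_le_one) ?_
        exact setLIntegral_mono' measurableSet_Ioi fun s hs => htail2 s (hs0.trans_lt hs)
    _ = ENNReal.ofReal (b ^ 2 * Real.log A) + ENNReal.ofReal (b ^ 2) := by
        congr 1
        · simp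
        · rw [← ofReal_integral_eq_lintegral_ofReal
            ((integrableOn_exp_mul_Ioi hneg _).const_mul A)
            (ae_of_all _ fun s => by positivity), integral_const_mul, integral_exp_mul_Ioi hneg]
          congr 1
          have h1 : Real.exp (-(1 / b ^ 2) * (b ^ 2 * Real.log A)) = A⁻¹ := by
            rw [show -(1 / b ^ 2) * (b ^ 2 * Real.log A) = -Real.log A by field_simp,
              Real.exp_neg, Real.exp_log hA0]
          rw [h1]
          field_simp
    _ = _ := by
        rw [← ENNReal.ofReal_add hs0 (by positivity)]
        congr 1
        ring

end Tail

end GPTS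

/-! ### Oscillation of the sample paths. -/

namespace GPTS

section Derivative

variable {d : ℕ} {X : Set (E d)} {Ω : Type*} [MeasurableSpace Ω] {k : E d → E d → ℝ} {v : ℝ≥0}
  {f : Ω → C(X, ℝ)} {ε : ℕ → Ω → ℝ} {P : Measure Ω} {a b : ℝ}

/-- Mean value inequality in the `ℓ¹` metric, from a bound on the partial derivatives. -/
lemma abs_sub_le_of_partial_le {C : Set (E d)} (hC : Convex ℝ C) {F : E d → ℝ}
    {F' : E d → E d →L[ℝ] ℝ} (hF : ∀ z ∈ C, HasFDerivWithinAt F (F' z) C z) {u : ℝ}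
    (hu : ∀ z ∈ C, ∀ j, |F' z (EuclideanSpace.single j 1)| ≤ u) {p q : E d} (hp : p ∈ C)
    (hq : q ∈ C) : |F p - F q| ≤ u * ∑ j, |p j - q j| := by
  let c : ℝ → E d := fun s => q + s • (p - q)
  have hcC : MapsTo c (Icc 0 1) C := fun s hs => by
    have := hC hq hp (sub_nonneg.2 hs.2) hs.1 (by ring)
    convert this using 1
    simp only [c, smul_sub, sub_smul, one_smul]
    abel
  have hc : ∀ s, HasDerivWithinAt c (p - q) (Icc 0 1) s := fun s => by
    have := ((hasDerivAt_id s).smul_const (p - q)).const_add q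
    exact (this.congr_deriv (one_smul ℝ _)).hasDerivWithinAt
  have h1 : ∀ s ∈ Icc (0 : ℝ) 1, HasDerivWithinAt (F ∘ c) (F' (c s) (p - q)) (Icc 0 1) s :=
    fun s hs => (hF _ (hcC hs)).comp_hasDerivWithinAt s (hc s) hcC
  have h2 : ∀ s ∈ Icc (0 : ℝ) 1, ‖F' (c s) (p - q)‖ ≤ u * ∑ j, |p j - q j| := fun s hs => by
    have h3 : p - q = ∑ j, (p j - q j) • EuclideanSpace.single j (1 : ℝ) := by
      have := (EuclideanSpace.basisFun (Fin d) ℝ).sum_repr (p - q)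
      simpa using this.symm
    rw [h3, map_sum, Finset.mul_sum, Real.norm_eq_abs]
    refine (Finset.abs_sum_le_sum_abs _ _).trans (Finset.sum_le_sum fun j _ => ?_)
    rw [map_smul, smul_eq_mul, abs_mul, mul_comm]
    exact mul_le_mul_of_nonneg_right (hu _ (hcC hs) j) (abs_nonneg _)
  have h4 := (convex_Icc (0 : ℝ) 1).norm_image_sub_le_of_norm_hasDerivWithin_le h1 h2
    (left_mem_Icc.2 zero_le_one) (right_mem_Icc.2 zero_le_one)
  simpa [c] using h4

namespace DerivativeTail

/-- If no partial derivative exceeds `u`, the mean value inequality bounds the difference quotient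
by `u`; a union bound over the `d` coordinates gives the factor `d`. The points may be random, as
the derivative bound is uniform on the convex hull. -/
lemma tail_dist (h : DerivativeTail f P a b) {q q' : Ω → X} {δ : ℝ} (hδ : 0 < δ)
    (hq : ∀ ω, ∑ j, |(q ω : E d) j - (q' ω : E d) j| ≤ δ) {u : ℝ} (hu : 0 < u) :
    P {ω | u < |f ω (q ω) - f ω (q' ω)| / δ} ≤
      ENNReal.ofReal (a * d * Real.exp (-(u / b) ^ 2)) := by
  obtain ⟨F, F', hFf, hF, htail⟩ := h
  let B : Fin d → Set Ω := fun j =>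
    {ω | ∃ z ∈ convexHull ℝ X, u < |F' ω z (EuclideanSpace.single j 1)|}
  have hae : ({ω | u < |f ω (q ω) - f ω (q' ω)| / δ} : Set Ω) ≤ᵐ[P] (⋃ j, B j : Set Ω) := by
    filter_upwards [hF] with ω hω
    intro hmem
    by_contra hnot
    have hle : ∀ z ∈ convexHull ℝ X, ∀ j, |F' ω z (EuclideanSpace.single j 1)| ≤ u := by
      intro z hz j
      by_contra hlt
      exact hnot (mem_iUnion.2 ⟨j, z, hz, not_le.1 hlt⟩)
    have h1 := abs_sub_le_of_partial_le (convex_convexHull ℝ X) hω hle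
      (subset_convexHull ℝ X (q ω).2) (subset_convexHull ℝ X (q' ω).2)
    rw [hFf, hFf] at h1
    have h2 : |f ω (q ω) - f ω (q' ω)| / δ ≤ u := by
      rw [div_le_iff₀ hδ]
      exact h1.trans (mul_le_mul_of_nonneg_left (hq ω) hu.le)
    exact absurd hmem (not_lt.2 h2)
  calc P {ω | u < |f ω (q ω) - f ω (q' ω)| / δ} ≤ P (⋃ j, B j) := measure_mono_ae hae
    _ ≤ ∑ j, P (B j) := measure_iUnion_fintype_le _ _
    _ ≤ ∑ _j : Fin d, ENNReal.ofReal (a * Real.exp (-(u / b) ^ 2)) :=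
        Finset.sum_le_sum fun j _ => htail j u hu
    _ = _ := by
        rw [Finset.sum_const, Finset.card_univ, Fintype.card_fin, nsmul_eq_mul,
          ← ENNReal.ofReal_natCast, ← ENNReal.ofReal_mul (Nat.cast_nonneg _)]
        congr 1
        ring

/-- If the tail bound is smaller than one at the origin, then the paths are constant. -/
lemma ae_const (h : DerivativeTail f P a b) (hm : IsGPModel k v f ε P) (ha : 0 < a)
    (had : a * d < 1) : ∀ᵐ ω ∂P, ∀ p q : X, f ω p = f ω q := by
  have hpair : ∀ p q : X, ∀ᵐ ω ∂P, f ω p = f ω q := fun p q => by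
    have hδ : 0 < ∑ j, |(p : E d) j - (q : E d) j| + 1 := by positivity
    set δ := ∑ j, |(p : E d) j - (q : E d) j| + 1
    have hne : P {ω | f ω p ≠ f ω q} ≤ ENNReal.ofReal (a * d) := by
      -- The tail condition is available for positive levels only, so level zero is approached along
      -- `1 / (n + 1)`.
      have h1 : {ω | f ω p ≠ f ω q} = ⋃ n : ℕ, {ω | 1 / ((n : ℝ) + 1) < |f ω p - f ω q| / δ} := by
        ext ω
        simp only [mem_ofPred, mem_iUnion]
        constructor
        · intro hne
          exact exists_nat_one_div_lt (div_pos (abs_pos.2 (sub_ne_zero.2 hne)) hδ)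
        · rintro ⟨n, hn⟩ heq
          rw [heq, sub_self, abs_zero, zero_div] at hn
          have : (0 : ℝ) < 1 / ((n : ℝ) + 1) := by positivity
          linarith
      have hmono : Monotone fun n : ℕ => {ω | 1 / ((n : ℝ) + 1) < |f ω p - f ω q| / δ} := by
        intro m n hmn ω hω
        simp only [mem_ofPred] at hω ⊢
        refine lt_of_le_of_lt ?_ hω
        gcongr
      rw [h1, hmono.measure_iUnion]
      refine iSup_le fun n => ?_
      refine (h.tail_dist (q := fun _ => p) (q' := fun _ => q) hδ
        (fun _ => by simp only [δ]; linarith) (by positivity)).trans (ENNReal.ofReal_le_ofReal ?_)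
      have : Real.exp (-(1 / ((n : ℝ) + 1) / b) ^ 2) ≤ 1 :=
        Real.exp_le_one_iff.2 (neg_nonpos.2 (sq_nonneg _))
      exact mul_le_of_le_one_right (by positivity) this
    have hlt : P {ω | f ω p ≠ f ω q} < 1 := hne.trans_lt (by
      rw [← ENNReal.ofReal_one]
      exact (ENNReal.ofReal_lt_ofReal_iff one_pos).2 had)
    have hG := (hm.gaussian.hasGaussianLaw_fun_sub (s := p) (t := q))
    have hGm : Measurable fun ω => f ω p - f ω q :=
      ((measurable_eval_path p).comp hm.measurable_f).sub
        ((measurable_eval_path q).comp hm.measurable_f)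
    have hlaw := hG.map_eq_gaussianReal
    have hmean : P[fun ω => f ω p - f ω q] = 0 := by
      rw [integral_sub (hm.gaussian.hasGaussianLaw_eval p).integrable
        (hm.gaussian.hasGaussianLaw_eval q).integrable, hm.mean_zero, hm.mean_zero, sub_zero]
    rw [hmean] at hlaw
    have hset : {ω | f ω p ≠ f ω q} = (fun ω => f ω p - f ω q) ⁻¹' {0}ᶜ := by
      ext ω
      simp [sub_eq_zero]
    have hP : P {ω | f ω p ≠ f ω q} = (P.map fun ω => f ω p - f ω q) {0}ᶜ := by
      rw [hset, Measure.map_apply hGm (measurableSet_singleton 0).compl]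
    rw [hP, hlaw] at hlt
    -- The difference is a centred Gaussian variable: unless its variance vanishes it has no atom at
    -- zero, contrary to a probability below one of being nonzero.
    by_cases hs : (Var[fun ω => f ω p - f ω q; P]).toNNReal = 0
    · rw [hs, gaussianReal_zero_var] at hlaw
      have h0 : P {ω | f ω p ≠ f ω q} = 0 := by
        rw [hP, hlaw, Measure.dirac_apply' _ (measurableSet_singleton 0).compl]
        simp
      exact ae_iff.2 h0
    · exfalso
      have := nullSingletonClass_gaussianReal (μ := 0) hs
      have h1 : gaussianReal 0 (Var[fun ω => f ω p - f ω q; P]).toNNReal {0}ᶜ = 1 := by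
        rw [prob_compl_eq_one_iff (measurableSet_singleton 0)]
        exact measure_singleton 0
      exact absurd hlt (by rw [h1]; exact lt_irrefl _)
  rcases isEmpty_or_nonempty X with hX | hX
  · exact ae_of_all _ fun ω p => (hX.false p).elim
  have hall : ∀ᵐ ω ∂P, ∀ n m, f ω (TopologicalSpace.denseSeq X n) =
      f ω (TopologicalSpace.denseSeq X m) := by
    rw [ae_all_iff]
    intro n
    rw [ae_all_iff]
    exact fun m => hpair _ _
  filter_upwards [hall] with ω hω
  have hconst : (f ω : X → ℝ) = fun _ => f ω (TopologicalSpace.denseSeq X 0) :=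
    (f ω).continuous.ext_on (TopologicalSpace.denseRange_denseSeq X) continuous_const (by
      rintro _ ⟨n, rfl⟩
      exact hω n 0)
  intro p q
  rw [congrFun hconst p, congrFun hconst q]

variable [IsProbabilityMeasure P]

/-- The mean squared oscillation of the objective over `ℓ¹` distance `δ`. -/
theorem lintegral_sq_sub_le (h : DerivativeTail f P a b) (hm : IsGPModel k v f ε P) (ha : 0 < a)
    (hb : 0 < b) {δ : ℝ} (hδ : 0 < δ) {q q' : Ω → X} (hqm : AEMeasurable q P)
    (hqm' : AEMeasurable q' P) (hq : ∀ ω, ∑ j, |(q ω : E d) j - (q' ω : E d) j| ≤ δ) :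
    ∫⁻ ω, ENNReal.ofReal ((f ω (q ω) - f ω (q' ω)) ^ 2) ∂P ≤
      ENNReal.ofReal ((δ * (b * √(Real.log (a * d) + 1))) ^ 2) := by
  -- For `a * d < 1` the logarithm is negative and the claimed bound may even be zero; constancy of
  -- the paths then makes the left side vanish.
  by_cases had : a * d < 1
  · have h0 : ∫⁻ ω, ENNReal.ofReal ((f ω (q ω) - f ω (q' ω)) ^ 2) ∂P = 0 := by
      rw [lintegral_eq_zero_of_ae_eq_zero]
      filter_upwards [h.ae_const hm ha had] with ω hω
      rw [hω (q ω) (q' ω)]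
      simp
    rw [h0]
    exact zero_le
  · have had' : 1 ≤ a * d := not_lt.1 had
    have hWm : AEMeasurable (fun ω => |f ω (q ω) - f ω (q' ω)| / δ) P := by
      have h1 : ∀ {r : Ω → X}, AEMeasurable r P → AEMeasurable (fun ω => f ω (r ω)) P :=
        fun hr => measurable_uncurry_path.comp_aemeasurable
          (hm.measurable_f.aemeasurable.prodMk hr)
      exact (((h1 hqm).sub (h1 hqm')).abs).div_const δ
    have h1 := lintegral_sq_le_of_tail hWm (fun ω => by positivity) had' hb
      fun u hu => h.tail_dist hδ hq hu
    have h2 : ∀ ω, ENNReal.ofReal ((f ω (q ω) - f ω (q' ω)) ^ 2) = ENNReal.ofReal (δ ^ 2) *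
        ENNReal.ofReal ((|f ω (q ω) - f ω (q' ω)| / δ) ^ 2) := fun ω => by
      rw [← ENNReal.ofReal_mul (by positivity), div_pow, sq_abs]
      congr 1
      field_simp
    simp only [h2]
    rw [lintegral_const_mul'' _ (hWm.pow_const 2).ennreal_ofReal]
    refine (mul_le_mul_right h1 _).trans_eq ?_
    have hlog := Real.log_nonneg had'
    rw [← ENNReal.ofReal_mul (by positivity), mul_pow, mul_pow, Real.sq_sqrt (by linarith)]

end DerivativeTail

end Derivative

end GPTS

/-! ### The canonical metric of the standard kernels. -/

namespace GPTS

open Real in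
/-- The Bessel function as a Gamma mixture of exponentials. -/
lemma rpow_mul_besselK {ν z : ℝ} (hz : 0 < z) :
    2 ^ (1 - ν) * z ^ ν * besselK ν z =
      ∫ u in Ioi (0 : ℝ), exp (-u) * u ^ (ν - 1) * exp (-(z ^ 2 / (4 * u))) := by
  have hc : (0 : ℝ) < 4 / z ^ 2 := by positivity
  let h : ℝ → ℝ := fun t => exp (-t - z ^ 2 / (4 * t)) * t ^ (-(ν + 1))
  -- The substitution `t = z ^ 2 / (4 * u)`, carried out as an inversion followed by a scaling.
  have h1 := integral_comp_rpow_Ioi h (p := -1) (by norm_num)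
  have h2 := integral_comp_mul_left_Ioi (fun x => (|(-1 : ℝ)| * x ^ ((-1 : ℝ) - 1)) •
    h (x ^ (-1 : ℝ))) 0 hc
  rw [mul_zero, h1] at h2
  have h3 : ∫ t in Ioi (0 : ℝ), h t = (4 / z ^ 2) * ∫ x in Ioi (0 : ℝ),
      (|(-1 : ℝ)| * (4 / z ^ 2 * x) ^ ((-1 : ℝ) - 1)) • h ((4 / z ^ 2 * x) ^ (-1 : ℝ)) := by
    rw [h2, smul_eq_mul, mul_inv_cancel_left₀ hc.ne']
  rw [besselK, h3, ← integral_const_mul, ← integral_const_mul, ← integral_const_mul]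
  refine setIntegral_congr_fun measurableSet_Ioi fun u hu => ?_
  have hu : 0 < u := hu
  have hx : 0 < 4 / z ^ 2 * u := by positivity
  have e1 : (4 / z ^ 2 * u) ^ (-1 : ℝ) = z ^ 2 / (4 * u) := by
    rw [rpow_neg_one]
    field_simp
  have e2 : (4 / z ^ 2 * u) ^ ((-1 : ℝ) - 1) = (z ^ 2 / (4 * u)) ^ 2 := by
    rw [← e1, ← rpow_two ((4 / z ^ 2 * u) ^ (-1 : ℝ)), ← rpow_mul hx.le]
    norm_num
  have e3 : z ^ 2 / (4 * (z ^ 2 / (4 * u))) = u := by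
    field_simp
  have e4 : (z ^ 2 / (4 * u)) ^ (-(ν + 1)) = (z / 2) ^ (-2 * ν) * (z / 2) ^ (-2 : ℝ) * u ^ ν * u := by
    have : z ^ 2 / (4 * u) = (z / 2) ^ (2 : ℝ) * u ^ (-1 : ℝ) := by
      rw [rpow_neg_one, rpow_two]
      field_simp
      norm_num
    rw [this, mul_rpow (by positivity) (by positivity), ← rpow_mul (by positivity),
      ← rpow_mul hu.le, show (2 : ℝ) * -(ν + 1) = -2 * ν + -2 by ring,
      show (-1 : ℝ) * -(ν + 1) = ν + 1 by ring, rpow_add (by positivity), rpow_add hu, rpow_one]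
    ring
  have e5 : (2 : ℝ) ^ (1 - ν) * z ^ ν * ((z / 2) ^ ν * (z / 2) ^ (-2 * ν)) = 2 := by
    have : z ^ ν = (z / 2) ^ ν * 2 ^ ν := by
      rw [← mul_rpow (by positivity) (by positivity)]
      congr 1
      ring
    rw [this]
    have f1 : (2 : ℝ) ^ (1 - ν) * 2 ^ ν = 2 := by
      rw [← rpow_add two_pos, sub_add_cancel, rpow_one]
    have f2 : (z / 2) ^ ν * ((z / 2) ^ ν * (z / 2) ^ (-2 * ν)) = 1 := by
      rw [← rpow_add (by positivity), ← rpow_add (by positivity)]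
      rw [show ν + (ν + -2 * ν) = 0 by ring, rpow_zero]
    calc _ = ((2 : ℝ) ^ (1 - ν) * 2 ^ ν) *
        ((z / 2) ^ ν * ((z / 2) ^ ν * (z / 2) ^ (-2 * ν))) := by ring
      _ = 2 := by rw [f1, f2, mul_one]
  have e6 : u ^ (ν - 1) = u ^ ν / u := by rw [rpow_sub hu, rpow_one]
  have e7 : (z / 2) ^ (-2 : ℝ) = 4 / z ^ 2 := by
    rw [rpow_neg (by positivity), rpow_two]
    field_simp
    norm_num
  simp only [h, smul_eq_mul, e1, e2, e3, e4, e7, e6]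
  rw [show exp (-(z ^ 2 / (4 * u)) - u) = exp (-u) * exp (-(z ^ 2 / (4 * u))) by
    rw [← exp_add]; congr 1; ring]
  calc _ = ((2 : ℝ) ^ (1 - ν) * z ^ ν * ((z / 2) ^ ν * (z / 2) ^ (-2 * ν))) *
        (1 / 2 * (exp (-u) * exp (-(z ^ 2 / (4 * u)))) * (4 / z ^ 2 * |(-1)| *
          (z ^ 2 / (4 * u)) ^ 2 * (4 / z ^ 2) * u ^ ν * u)) := by ring
    _ = _ := by
      rw [e5, abs_neg, abs_one]
      field_simp

open Real in
/-- The Matérn profile is `1 - O(z²)`. -/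
lemma one_sub_matern_le {ν z : ℝ} (hν : 1 < ν) (hz : 0 < z) :
    1 - 2 ^ (1 - ν) / Gamma ν * z ^ ν * besselK ν z ≤ z ^ 2 / (4 * (ν - 1)) := by
  have hG : 0 < Gamma ν := Gamma_pos_of_pos (by linarith)
  have hG1 : Gamma ν = (ν - 1) * Gamma (ν - 1) := by
    have := Gamma_add_one (s := ν - 1) (by linarith)
    rwa [sub_add_cancel] at this
  have hI := GammaIntegral_convergent (s := ν) (by linarith)
  have hI1 := GammaIntegral_convergent (s := ν - 1) (by linarith)
  have hI2 : IntegrableOn (fun u => exp (-u) * u ^ (ν - 1) * exp (-(z ^ 2 / (4 * u))))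
      (Ioi (0 : ℝ)) := by
    refine hI.mono' (by fun_prop) ?_
    filter_upwards [ae_restrict_mem measurableSet_Ioi] with u hu
    have hu : 0 < u := hu
    rw [norm_of_nonneg (by positivity)]
    exact mul_le_of_le_one_right (by positivity)
      (exp_le_one_iff.2 (neg_nonpos.2 (by positivity)))
  have hle : Gamma ν - ∫ u in Ioi (0 : ℝ), exp (-u) * u ^ (ν - 1) * exp (-(z ^ 2 / (4 * u))) ≤
      z ^ 2 / 4 * Gamma (ν - 1) := by
    rw [Gamma_eq_integral (by linarith), Gamma_eq_integral (s := ν - 1) (by linarith),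
      ← integral_sub hI hI2, ← integral_const_mul]
    refine setIntegral_mono_on (hI.sub hI2) (hI1.const_mul _) measurableSet_Ioi fun u hu => ?_
    have hu : 0 < u := hu
    -- Bounding `1 - exp (-s)` by `s` costs a factor `1 / u`, which lowers the Gamma parameter to `ν
    -- - 1`; its integral converges because `ν > 1`.
    have h1 := add_one_le_exp (-(z ^ 2 / (4 * u)))
    have h2 : u ^ (ν - 1) = u ^ (ν - 1 - 1) * u := by
      rw [rpow_sub_one hu.ne' (ν - 1)]
      field_simp
    calc _ = exp (-u) * u ^ (ν - 1) * (1 - exp (-(z ^ 2 / (4 * u)))) := by ring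
      _ ≤ exp (-u) * u ^ (ν - 1) * (z ^ 2 / (4 * u)) :=
        mul_le_mul_of_nonneg_left (by linarith) (by positivity)
      _ = _ := by
        rw [h2]
        field_simp
  calc 1 - 2 ^ (1 - ν) / Gamma ν * z ^ ν * besselK ν z
      = (Gamma ν - 2 ^ (1 - ν) * z ^ ν * besselK ν z) / Gamma ν := by
        field_simp
    _ ≤ z ^ 2 / 4 * Gamma (ν - 1) / Gamma ν := by
        rw [rpow_mul_besselK hz]
        gcongr
    _ = z ^ 2 / (4 * (ν - 1)) := by
        rw [hG1]
        have := Gamma_pos_of_pos (s := ν - 1) (by linarith)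
        have : 0 < ν - 1 := by linarith
        field_simp

namespace StdKernel

lemma lipSigma_pos {K : StdKernel} (hK : K.Admissible) : 0 < K.lipSigma := by
  match K, hK with
  | linear, _ => exact one_pos
  | squaredExp ℓ, h =>
    have h : 0 < ℓ := h
    unfold lipSigma
    positivity
  | matern ν ℓ, h =>
    obtain ⟨h1, h2⟩ : 1 < ν ∧ 0 < ℓ := h
    have : 0 < ν - 1 := by linarith
    have : 0 < ν := by linarith
    unfold lipSigma
    positivity

/-- The canonical metric of a standard kernel is dominated by the Euclidean one. -/
theorem canonical_dist_le {d : ℕ} {K : StdKernel} (hK : K.Admissible) (p q : E d) :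
    √(K.toFun p p - 2 * K.toFun p q + K.toFun q q) ≤ K.lipSigma * ‖p - q‖ := by
  rw [Real.sqrt_le_left (mul_nonneg (lipSigma_pos hK).le (norm_nonneg _)), mul_pow]
  match K, hK with
  | linear, _ =>
    simp only [toFun, lipSigma]
    rw [@norm_sub_sq_real, real_inner_self_eq_norm_sq, real_inner_self_eq_norm_sq]
    linarith
  | squaredExp ℓ, h =>
    have h : 0 < ℓ := h
    simp only [toFun, lipSigma, sub_self, norm_zero]
    -- With `s = ‖p - q‖ ^ 2 / (2 * ℓ ^ 2)` the squared distance is `2 * (1 - exp (-s)) ≤ 2 * s`,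
    -- while `lipSigma` allows `4 * s`.
    have h1 := Real.add_one_le_exp (-‖p - q‖ ^ 2 / (2 * ℓ ^ 2))
    have h2 : (√2 / ℓ) ^ 2 * ‖p - q‖ ^ 2 = 4 * (‖p - q‖ ^ 2 / (2 * ℓ ^ 2)) := by
      rw [div_pow, Real.sq_sqrt two_pos.le]
      field_simp
      ring
    have h3 : 0 ≤ ‖p - q‖ ^ 2 / (2 * ℓ ^ 2) := by positivity
    rw [h2]
    rw [neg_div] at h1
    norm_num
    rw [neg_div]
    linarith
  | matern ν ℓ, h =>
    obtain ⟨h1, h2⟩ : 1 < ν ∧ 0 < ℓ := h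
    have h3 : 0 < ν - 1 := by linarith
    have hν : 0 < ν := by linarith
    by_cases hpq : p = q
    · subst hpq
      simp [toFun]
      norm_num
    · simp only [toFun, lipSigma, if_neg hpq, if_true]
      have hn : 0 < ‖p - q‖ := norm_pos_iff.2 (sub_ne_zero.2 hpq)
      have h4 := one_sub_matern_le h1 (z := √(2 * ν) * ‖p - q‖ / ℓ) (by positivity)
      have h5 : (√(2 * ν) * ‖p - q‖ / ℓ) ^ 2 / (4 * (ν - 1)) =
          1 / 2 * (‖p - q‖ ^ 2 / ℓ ^ 2 * (ν / (ν - 1))) := by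
        rw [div_pow, mul_pow, Real.sq_sqrt (by positivity)]
        field_simp
        norm_num
      have h6 : (√2 / ℓ * √(ν / (ν - 1))) ^ 2 * ‖p - q‖ ^ 2 =
          2 * (‖p - q‖ ^ 2 / ℓ ^ 2 * (ν / (ν - 1))) := by
        rw [mul_pow, div_pow, Real.sq_sqrt two_pos.le, Real.sq_sqrt (by positivity)]
        field_simp
      have h7 : 0 ≤ ‖p - q‖ ^ 2 / ℓ ^ 2 * (ν / (ν - 1)) := by positivity
      rw [h5] at h4
      rw [h6]
      linarith

end StdKernel

end GPTS

/-! ### The explicit bounds for finite and for compact domains. -/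

namespace GPTS

section Bounds

variable {d : ℕ} {X : Set (E d)} {v : ℝ≥0}

/-- This is what the choice of `β_T` is for: with `c` proportional to the number of points times `T
^ 2`, the summed excess over all points and rounds is at most a fraction of `√β`. -/
lemma stdPDF_sqrt_le {β c : ℝ} (hc : 0 < c) (hβ : 0 ≤ β)
    (h : 2 * Real.log (c / √(2 * Real.pi)) ≤ β) : stdPDF (√β) ≤ 1 / c := by
  have hs : 0 < √(2 * Real.pi) := by positivity
  have h1 : Real.exp (-(√β) ^ 2 / 2) ≤ √(2 * Real.pi) / c := by
    rw [Real.sq_sqrt hβ, ← Real.le_log_iff_exp_le (by positivity), ← inv_div c, Real.log_inv]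
    linarith
  rw [stdPDF, div_le_iff₀ hs]
  refine h1.trans_eq ?_
  ring

lemma Run.nonempty {k : E d → E d → ℝ} (A : Run X k v) : Nonempty X := by
  have : Nonempty A.Ω := nonempty_of_isProbabilityMeasure A.P
  exact ⟨A.x 0 (Classical.arbitrary _)⟩

theorem Run.integral_regret_sq_le_of_finite {k : E d → E d → ℝ} (A : Run X k v) (hv : 0 < v)
    (hX : X.Finite) {T : ℕ} (hT : 1 ≤ T) :
    Integrable (fun ω => A.regret T ω ^ 2) A.P ∧
    ∫ ω, A.regret T ω ^ 2 ∂A.P ≤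
      12 * C₁ v * T * (betaFinite X.ncard T + 1) * maxInfoGain X k v T
        + √(betaFinite X.ncard T) := by
  have := hX.to_subtype
  have := Fintype.ofFinite X
  have := A.nonempty
  have hcard : (Finset.univ : Finset X).card = X.ncard := by
    rw [Finset.card_univ, ← Nat.card_eq_fintype_card, Nat.card_coe_set_eq]
  have hβ : 1 ≤ betaFinite X.ncard T := le_max_left _ _
  -- A finite domain is its own grid, so there is no discretization error and no loss in the
  -- variance.
  obtain ⟨hint, hle⟩ := A.integral_regret_sq_le hv T (π := id) measurable_id
    (S := Finset.univ) (fun p => Finset.mem_univ _) (H := 0) hβ le_rfl (fun q _ => by simp)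
    (c₁ := 1) (c₂ := 0) zero_le_one le_rfl (fun t D p => by simp)
  refine ⟨hint, hle.trans ?_⟩
  have hn : (0 : ℝ) < X.ncard := by
    rw [← hcard]
    exact_mod_cast Finset.card_pos.2 Finset.univ_nonempty
  have hT0 : (0 : ℝ) < T := by exact_mod_cast hT
  have hφ : stdPDF (√(betaFinite X.ncard T)) ≤ 1 / (24 * X.ncard * T ^ 2) :=
    stdPDF_sqrt_le (by positivity) (by linarith) (le_max_right _ _)
  rw [hcard]
  have hC := (IsGPModel.C₁_pos hv).le
  have hγ := IsGPModel.maxInfoGain_nonneg X k v T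
  set β := betaFinite X.ncard T
  have hs : 0 ≤ √β := Real.sqrt_nonneg β
  have h1 : (T : ℝ) ^ 2 * (20 * (X.ncard * (√β * stdPDF (√β))) + 80 * 0) ≤ √β := by
    calc (T : ℝ) ^ 2 * (20 * (X.ncard * (√β * stdPDF (√β))) + 80 * 0)
        ≤ (T : ℝ) ^ 2 * (20 * (X.ncard * (√β * (1 / (24 * X.ncard * T ^ 2)))) + 80 * 0) := by
          gcongr
      _ = 20 / 24 * √β := by
          field_simp
          ring
      _ ≤ √β := by linarith
  have h2 : 0 ≤ T * (β + 1) * (C₁ v * maxInfoGain X k v T) := by positivity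
  linarith

/-- Also true for `d = 0`, where the ceiling is `0` and `0 ^ 0 = 1`. -/
lemma one_le_ceil_pow {r L : ℝ} (hr : 0 < r) (hL : 0 < L) {T : ℕ} (hT : 1 ≤ T) :
    (1 : ℝ) ≤ (⌈(d : ℝ) * r * L * T⌉₊ : ℝ) ^ d := by
  rcases Nat.eq_zero_or_pos d with rfl | hd
  · simp
  · have : (0 : ℝ) < (d : ℝ) * r * L * T := by
      have : (0 : ℝ) < T := by exact_mod_cast hT
      have : (0 : ℝ) < d := by exact_mod_cast hd
      positivity
    exact one_le_pow₀ (by exact_mod_cast Nat.ceil_pos.2 this)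

/-- Follows from `36 / √(2π) ≥ 12 ≥ e²`. The value `3` is what absorbs the additive constants in the
final bound on compact domains. -/
lemma three_le_betaContinuous {r L : ℝ} (hr : 0 < r) (hL : 0 < L) {T : ℕ} (hT : 1 ≤ T) :
    3 ≤ betaContinuous d r L T := by
  refine le_trans ?_ (le_max_right _ _)
  have hn := one_le_ceil_pow (d := d) hr hL hT
  have hT' : (1 : ℝ) ≤ (T : ℝ) ^ 2 := one_le_pow₀ (by exact_mod_cast hT)
  have hpi : √(2 * Real.pi) ≤ 3 := by
    rw [Real.sqrt_le_left (by norm_num)]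
    linarith [Real.pi_lt_four]
  have hs : 0 < √(2 * Real.pi) := by positivity
  have h1 : (12 : ℝ) ≤
      36 * (⌈(d : ℝ) * r * L * T⌉₊ : ℝ) ^ d * (T : ℝ) ^ 2 / √(2 * Real.pi) := by
    rw [le_div_iff₀ hs]
    have := mul_le_mul hn hT' zero_le_one (by positivity)
    linarith
  have h2 : (2 : ℝ) ≤ Real.log 12 := by
    rw [Real.le_log_iff_exp_le (by norm_num), show (2 : ℝ) = 1 + 1 by norm_num, Real.exp_add]
    have := Real.exp_one_lt_d9
    have := Real.exp_pos 1
    nlinarith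
  have h3 := Real.log_le_log (by norm_num) h1
  linarith

theorem Run.integral_regret_sq_le_of_compact {K : StdKernel} (hK : K.Admissible)
    (A : Run X K.toFun v) (hv : 0 < v) {r a b : ℝ} (hr : 0 < r) (ha : 0 < a) (hb : 0 < b)
    (hX : ∀ x ∈ X, ∀ j, x j ∈ Icc 0 r) (htail : DerivativeTail A.f A.P a b) {T : ℕ}
    (hT : 1 ≤ T) :
    Integrable (fun ω => A.regret T ω ^ 2) A.P ∧
    ∫ ω, A.regret T ω ^ 2 ∂A.P ≤
      27 + √(betaContinuous d r (lipConst d K a b) T)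
        + 18 * T * (betaContinuous d r (lipConst d K a b) T + 1)
          * (2 + C₁ v * maxInfoGain X K.toFun v T) := by
  have := A.nonempty
  have hLσ : K.lipSigma ≤ lipConst d K a b := le_max_left _ _
  have hLb : b * √(Real.log (a * d) + 1) ≤ lipConst d K a b := le_max_right _ _
  set L := lipConst d K a b
  have hL : 0 < L := (StdKernel.lipSigma_pos hK).trans_le hLσ
  have hT1 : (1 : ℝ) ≤ T := by exact_mod_cast hT
  have hT0 : (0 : ℝ) < T := by linarith
  set n := ⌈(d : ℝ) * r * L * T⌉₊ with hn
  have hdpos : d ≠ 0 → (0 : ℝ) < d * r * L * T := fun h => by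
    have : (0 : ℝ) < d := by exact_mod_cast Nat.pos_of_ne_zero h
    positivity
  obtain ⟨π, S, hπ, hS, hScard, hdist⟩ := exists_grid hr hX (n := n)
    fun h => Nat.ceil_pos.2 (hdpos h)
  -- The number of cells per axis is chosen for this: `d` coordinates, each off by at most `r / n`,
  -- sum to at most `1 / (L * T)`.
  have hl1 : ∀ p : X, ∑ j, |(p : E d) j - (π p : E d) j| ≤ 1 / (L * T) := fun p => by
    refine (Finset.sum_le_sum fun j _ => hdist p j).trans ?_
    rw [Finset.sum_const, Finset.card_univ, Fintype.card_fin, nsmul_eq_mul]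
    by_cases hd : d = 0
    · rw [hd, Nat.cast_zero, zero_mul]
      positivity
    · have hnpos : (0 : ℝ) < n := by exact_mod_cast Nat.ceil_pos.2 (hdpos hd)
      rw [← mul_div_assoc, div_le_div_iff₀ hnpos (by positivity), one_mul]
      refine le_trans (le_of_eq (by ring)) (Nat.le_ceil ((d : ℝ) * r * L * T))
  have hδ : 0 < 1 / (L * T) := by positivity
  have hvar : ∀ (t : ℕ) (D : Fin t → X × ℝ) (p : X),
      varAt K.toFun v D (π p) ≤ 9 / 5 * varAt K.toFun v D p + 9 / 4 / (T : ℝ) ^ 2 := by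
    intro t D p
    have h1 := A.model.isGP.abs_sqrt_postCov_sub_le measurable_eval_path hv t
      (fun i => (D i).1) p (π p)
    have h2 : √(K.toFun (p : E d) p - 2 * K.toFun (p : E d) (π p) +
        K.toFun (π p : E d) (π p)) ≤ 1 / T := by
      refine (StdKernel.canonical_dist_le hK (p : E d) (π p : E d)).trans ?_
      have h3 : ‖(p : E d) - π p‖ ≤ 1 / (L * T) :=
        (norm_le_sum_abs _).trans (hl1 p)
      calc K.lipSigma * ‖(p : E d) - π p‖ ≤ L * (1 / (L * T)) :=
            mul_le_mul hLσ h3 (norm_nonneg _) hL.le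
        _ = 1 / T := by field_simp
    have h4 := A.model.varAt_nonneg hv D p
    have h5 := A.model.varAt_nonneg hv D (π p)
    have h6 : |√(varAt K.toFun v D p) - √(varAt K.toFun v D (π p))| ≤ 1 / T := h1.trans h2
    have h7 : √(varAt K.toFun v D (π p)) ≤ √(varAt K.toFun v D p) + 1 / T := by
      linarith [(abs_le.1 h6).1]
    have h8 := pow_le_pow_left₀ (Real.sqrt_nonneg _) h7 2
    rw [Real.sq_sqrt h5] at h8
    -- Young's inequality with weights `1 + 4 / 5` and `1 + 5 / 4`; the first, times `10`, gives the
    -- `18` of the theorem.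
    have h9 : (√(varAt K.toFun v D p) + 1 / T) ^ 2 ≤
        9 / 5 * √(varAt K.toFun v D p) ^ 2 + 9 / 4 * (1 / T) ^ 2 := by
      nlinarith [sq_nonneg (2 * √(varAt K.toFun v D p) - 5 / 2 * (1 / T))]
    rw [Real.sq_sqrt h4] at h9
    refine (h8.trans h9).trans_eq ?_
    ring
  have herr : ∀ q : A.Ω → X, AEMeasurable q A.P →
      ∫⁻ ω, ENNReal.ofReal ((A.f ω (q ω) - A.f ω (π (q ω))) ^ 2) ∂A.P ≤
        ENNReal.ofReal (1 / (T : ℝ) ^ 2) := fun q hq => by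
    refine (htail.lintegral_sq_sub_le A.model ha hb hδ hq (hπ.comp_aemeasurable hq)
      fun ω => hl1 (q ω)).trans (ENNReal.ofReal_le_ofReal ?_)
    calc (1 / (L * T) * (b * √(Real.log (a * d) + 1))) ^ 2 ≤ (1 / (L * T) * L) ^ 2 := by
          gcongr
      _ = 1 / (T : ℝ) ^ 2 := by field_simp
  have hβ3 : 3 ≤ betaContinuous d r L T := three_le_betaContinuous hr hL hT
  have hβlog : 2 * Real.log (36 * (n : ℝ) ^ d * (T : ℝ) ^ 2 / √(2 * Real.pi)) ≤
    betaContinuous d r L T := le_max_right _ _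
  have hn1 : (1 : ℝ) ≤ (n : ℝ) ^ d := one_le_ceil_pow hr hL hT
  set β := betaContinuous d r L T
  obtain ⟨hint, hle⟩ := A.integral_regret_sq_le hv T hπ hS (by linarith : 1 ≤ β) (by positivity)
    herr (by norm_num) (by positivity) hvar
  refine ⟨hint, hle.trans ?_⟩
  have hφ : stdPDF (√β) ≤ 1 / (36 * (n : ℝ) ^ d * T ^ 2) :=
    stdPDF_sqrt_le (by positivity) (by linarith) hβlog
  have hS' : (S.card : ℝ) ≤ (n : ℝ) ^ d := by exact_mod_cast hScard
  have hs : 0 ≤ √β := Real.sqrt_nonneg β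
  have hφ0 := (stdPDF_pos (√β)).le
  have h1 : (T : ℝ) ^ 2 * (20 * (S.card * (√β * stdPDF (√β))) + 80 * (1 / (T : ℝ) ^ 2)) ≤
      √β + 80 := by
    calc (T : ℝ) ^ 2 * (20 * (S.card * (√β * stdPDF (√β))) + 80 * (1 / (T : ℝ) ^ 2))
        ≤ (T : ℝ) ^ 2 * (20 * ((n : ℝ) ^ d * (√β * (1 / (36 * (n : ℝ) ^ d * T ^ 2)))) +
          80 * (1 / (T : ℝ) ^ 2)) := by
          gcongr
      _ = 20 / 36 * √β + 80 := by
          field_simp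
      _ ≤ √β + 80 := by linarith
  have h2 : 10 * T * (β + 1) * (9 / 5 * (C₁ v * maxInfoGain X K.toFun v T) +
      T * (9 / 4 / (T : ℝ) ^ 2)) =
      18 * T * (β + 1) * (C₁ v * maxInfoGain X K.toFun v T) + 45 / 2 * (β + 1) := by
    field_simp
    ring
  -- It remains to see `45 / 2 * (β + 1) + 80 ≤ 27 + 36 * T * (β + 1)`, that is, `53 ≤ 27 / 2 * (β +
  -- 1)` for `T = 1`, which holds since `β ≥ 3`.
  have h3 : β + 1 ≤ T * (β + 1) := le_mul_of_one_le_left (by linarith) hT1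
  rw [h2]
  linarith

end Bounds

end GPTS

/-! ### Orders of magnitude and the high probability bound. -/

namespace GPTS

section Order

variable {d : ℕ} {X : Set (E d)} {v : ℝ≥0} {k : E d → E d → ℝ}

/-- Polynomial growth inside the logarithm; additive constants are absorbed because `log T ≥ log 2`
from `T = 2` on. -/
lemma exists_le_mul_log {u : ℕ → ℝ} {c : ℝ} {m : ℕ} (hc : 1 ≤ c) (hu0 : ∀ T, 0 ≤ u T)
    (hu : ∀ T, 1 ≤ T → u T ≤ c * (T : ℝ) ^ m) :
    ∃ C : ℝ, 0 < C ∧ ∀ T : ℕ, 2 ≤ T → max 1 (2 * Real.log (u T)) ≤ C * Real.log T := by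
  have hlog2 : 0 < Real.log 2 := Real.log_pos one_lt_two
  have hlogc : 0 ≤ Real.log c := Real.log_nonneg hc
  refine ⟨1 / Real.log 2 + 2 * Real.log c / Real.log 2 + 2 * m, by positivity, fun T hT => ?_⟩
  have hT2 : (2 : ℝ) ≤ T := by exact_mod_cast hT
  have hlogT : Real.log 2 ≤ Real.log T := Real.log_le_log two_pos hT2
  have hlogT0 : 0 < Real.log T := hlog2.trans_le hlogT
  have h1 : 1 ≤ 1 / Real.log 2 * Real.log T := by
    rw [one_div, inv_mul_eq_div, le_div_iff₀ hlog2]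
    linarith
  have h2 : 2 * Real.log c ≤ 2 * Real.log c / Real.log 2 * Real.log T := by
    rw [div_mul_eq_mul_div, le_div_iff₀ hlog2]
    exact mul_le_mul_of_nonneg_left hlogT (by positivity)
  have h3 : Real.log (u T) ≤ Real.log c + m * Real.log T := by
    rcases (hu0 T).eq_or_lt with h0 | h0
    · rw [← h0, Real.log_zero]
      positivity
    · rw [← Real.log_pow, ← Real.log_mul (by positivity) (by positivity)]
      exact Real.log_le_log h0 (hu T (by lia))
  have h4 : 0 ≤ 2 * Real.log c / Real.log 2 * Real.log T := by positivity
  have h5 : 0 ≤ m * Real.log T := by positivity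
  rw [add_mul, add_mul, mul_assoc 2 (m : ℝ)]
  exact max_le (by linarith) (by linarith)

lemma isBigO_log_of_le {β : ℕ → ℝ} (h0 : ∀ T, 0 ≤ β T) {C : ℝ}
    (h : ∀ T : ℕ, 2 ≤ T → β T ≤ C * Real.log T) : β =O[atTop] fun T : ℕ => Real.log T := by
  refine IsBigO.of_bound C (eventually_atTop.2 ⟨2, fun T hT => ?_⟩)
  rw [Real.norm_of_nonneg (h0 T), Real.norm_of_nonneg (Real.log_natCast_nonneg T)]
  exact h T hT

lemma exists_betaFinite_le (n : ℕ) :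
    ∃ C : ℝ, 0 < C ∧ ∀ T : ℕ, 2 ≤ T → betaFinite n T ≤ C * Real.log T := by
  refine exists_le_mul_log (c := 24 * n + 1) (m := 2) (by linarith [Nat.cast_nonneg (α := ℝ) n])
    (fun T => by positivity) fun T _ => ?_
  have hpi : 1 ≤ √(2 * Real.pi) := Real.one_le_sqrt.2 (by linarith [Real.pi_gt_three])
  refine (div_le_self (by positivity) hpi).trans ?_
  gcongr
  linarith

lemma exists_betaContinuous_le (d : ℕ) {r L : ℝ} (hr : 0 < r) (hL : 0 < L) :
    ∃ C : ℝ, 0 < C ∧ ∀ T : ℕ, 2 ≤ T → betaContinuous d r L T ≤ C * Real.log T := by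
  have h1 : 1 ≤ (d : ℝ) * r * L + 1 := by
    have : 0 ≤ (d : ℝ) * r * L := by positivity
    linarith
  refine exists_le_mul_log (c := 36 * ((d : ℝ) * r * L + 1) ^ d) (m := d + 2)
    (by linarith [one_le_pow₀ (n := d) h1]) (fun T => by positivity) fun T hT => ?_
  have hpi : 1 ≤ √(2 * Real.pi) := Real.one_le_sqrt.2 (by linarith [Real.pi_gt_three])
  have hT1 : (1 : ℝ) ≤ T := by exact_mod_cast hT
  refine (div_le_self (by positivity) hpi).trans ?_
  have h2 : (⌈(d : ℝ) * r * L * T⌉₊ : ℝ) ≤ ((d : ℝ) * r * L + 1) * T := by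
    refine (Nat.ceil_lt_add_one (by positivity)).le.trans ?_
    linarith
  calc 36 * (⌈(d : ℝ) * r * L * T⌉₊ : ℝ) ^ d * (T : ℝ) ^ 2
      ≤ 36 * (((d : ℝ) * r * L + 1) * T) ^ d * (T : ℝ) ^ 2 := by gcongr
    _ = _ := by rw [mul_pow]; ring

/-- Chebyshev's inequality, in the form of a high probability bound. -/
lemma one_sub_le_measure_le_mul_sqrt {Ω : Type*} [MeasurableSpace Ω] {P : Measure Ω}
    [IsProbabilityMeasure P] {R : Ω → ℝ} (hint : Integrable (fun ω => R ω ^ 2) P) {C s δ : ℝ}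
    (hC : 1 ≤ C) (hs : 0 ≤ s) (hδ : 0 < δ) (hle : ∫ ω, R ω ^ 2 ∂P ≤ C * s) :
    ENNReal.ofReal (1 - δ) ≤ P {ω | R ω ≤ C * √(s / δ)} := by
  have hcompl : P {ω | R ω ≤ C * √(s / δ)}ᶜ ≤ ENNReal.ofReal δ := by
    -- For `s = 0` Markov's inequality says nothing, but the second moment vanishes and so does `R`
    -- almost surely.
    rcases hs.eq_or_lt with rfl | hs
    · rw [mul_zero] at hle
      have h0 := (integral_eq_zero_iff_of_nonneg (fun ω => sq_nonneg _) hint).1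
        (hle.antisymm (integral_nonneg fun ω => sq_nonneg _))
      refine le_of_eq_of_le (measure_mono_null (fun ω hω => ?_) (ae_iff.1 h0)) zero_le
      intro h
      have : R ω = 0 := by simpa using h
      exact hω (by simp [this])
    · have h1 := mul_meas_ge_le_integral_of_nonneg (ae_of_all _ fun ω => sq_nonneg (R ω)) hint
        (C ^ 2 * (s / δ))
      have h2 : {ω | R ω ≤ C * √(s / δ)}ᶜ ⊆ {ω | C ^ 2 * (s / δ) ≤ R ω ^ 2} := fun ω hω => by
        have h3 : C * √(s / δ) < R ω := not_le.1 hω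
        have h4 := pow_le_pow_left₀ (by positivity) h3.le 2
        rwa [mul_pow, Real.sq_sqrt (by positivity)] at h4
      have h5 : P.real {ω | C ^ 2 * (s / δ) ≤ R ω ^ 2} ≤ δ := by
        have h6 : 0 < C * (s / δ) := by positivity
        have h7 : C * (s / δ) * P.real {ω | C ^ 2 * (s / δ) ≤ R ω ^ 2} ≤ C * (s / δ) * δ := by
          calc _ ≤ C ^ 2 * (s / δ) * P.real {ω | C ^ 2 * (s / δ) ≤ R ω ^ 2} := by
                gcongr
                exact le_self_pow₀ hC two_ne_zero
            _ ≤ C * s := h1.trans hle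
            _ = _ := by field_simp
        exact le_of_mul_le_mul_left h7 h6
      refine (measure_mono h2).trans ?_
      rw [← ofReal_measureReal]
      exact ENNReal.ofReal_le_ofReal h5
  rw [ENNReal.ofReal_sub _ hδ.le, ENNReal.ofReal_one]
  refine tsub_le_iff_right.2 ?_
  -- Subadditivity suffices here, so no measurability of the event is needed.
  calc (1 : ℝ≥0∞) = P univ := measure_univ.symm
    _ ≤ P {ω | R ω ≤ C * √(s / δ)} + P {ω | R ω ≤ C * √(s / δ)}ᶜ := by
        rw [← union_compl_self {ω | R ω ≤ C * √(s / δ)}]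
        exact measure_union_le _ _
    _ ≤ _ := by gcongr

/-- Querying `p` in every round, only the information of the first round is kept. This lower bound
is independent of `T` and lets `γ_T` absorb additive constants. -/
lemma Run.log_le_maxInfoGain (A : Run X k v) (hv : 0 < v) (p : X) {T : ℕ} (hT : 1 ≤ T) :
    Real.log (1 + k p p / v) / 2 ≤ maxInfoGain X k v T := by
  refine le_trans ?_ (A.model.sum_log_le_maxInfoGain hv T fun _ => p)
  refine Finset.single_le_sum (f := fun t => Real.log (1 + postCov v (fun p q : X => k p q) t
    (fun _ => p) p p / v) / 2) (fun t _ => ?_) (Finset.mem_range.2 hT)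
  have h1 := A.model.isGP.postCov_nonneg measurable_eval_path hv t (fun _ => p) p
  have h2 : 0 ≤ postCov v (fun p q : X => k p q) t (fun _ => p) p p / v := by positivity
  exact div_nonneg (Real.log_nonneg (by linarith)) two_pos.le

/-- A degenerate objective vanishes, and so does its regret. -/
lemma Run.regret_ae_eq_zero (A : Run X k v) (hk : ∀ p : X, k p p ≤ 0) (T : ℕ) :
    A.regret T =ᵐ[A.P] 0 := by
  have := A.nonempty
  have hpt : ∀ p : X, ∀ᵐ ω ∂A.P, A.f ω p = 0 := fun p => by
    have hL2 : MemLp (fun ω => A.f ω p) 2 A.P := (A.model.gaussian.hasGaussianLaw_eval p).memLp_two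
    have hvar : Var[fun ω => A.f ω p; A.P] = 0 := by
      refine le_antisymm ?_ (variance_nonneg _ _)
      rw [← covariance_self hL2.aemeasurable, A.model.covariance]
      exact hk p
    have h := ae_eq_integral_of_variance_eq_zero hL2 hvar
    simpa only [A.model.mean_zero] using h
  filter_upwards [ae_all_iff.2 fun n => hpt (TopologicalSpace.denseSeq X n)] with ω hω
  have h0 : (A.f ω : X → ℝ) = fun _ => 0 :=
    (A.f ω).continuous.ext_on (TopologicalSpace.denseRange_denseSeq X) continuous_const (by
      rintro _ ⟨n, rfl⟩
      exact hω n)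
  simp [Run.regret, h0]

/-- Order-of-magnitude conclusions from an explicit bound on the second moment of the regret. -/
theorem regretOrder_of_integral_regret_sq_le (hv : 0 < v) {β : ℕ → ℝ} (hβ : ∀ T, 0 ≤ β T)
    {Cβ : ℝ} (hCβ : 0 < Cβ) (hlog : ∀ T : ℕ, 2 ≤ T → β T ≤ Cβ * Real.log T)
    {Q : Run.{u} X k v → Prop} {c₁ c₂ : ℝ} (hc₁ : 0 ≤ c₁) (hc₂ : 0 ≤ c₂)
    (h : ∀ A : Run.{u} X k v, Q A → ∀ T : ℕ, 1 ≤ T → Integrable (fun ω => A.regret T ω ^ 2) A.P ∧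
      ∫ ω, A.regret T ω ^ 2 ∂A.P ≤ T * β T * (c₁ * maxInfoGain X k v T + c₂)) :
    RegretOrder.{u} X k v β Q := by
  obtain ⟨B, hB, hbound⟩ : ∃ B : ℝ, 0 ≤ B ∧ ∀ A : Run.{u} X k v, Q A → ∀ T : ℕ, 1 ≤ T →
      ∫ ω, A.regret T ω ^ 2 ∂A.P ≤ B * (T * β T * maxInfoGain X k v T) := by
    -- Either some prior variance is positive, and then `γ_T` is bounded away from zero by a number
    -- depending only on `k`, `v` and `p`, or the objective vanishes and there is no regret.
    by_cases hk : ∃ p : X, 0 < k p p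
    · obtain ⟨p, hp⟩ := hk
      have hv' : (0 : ℝ) < v := hv
      have hg : 0 < Real.log (1 + k p p / v) / 2 := by
        have : 0 < k p p / v := by positivity
        exact div_pos (Real.log_pos (by linarith)) two_pos
      set g := Real.log (1 + k p p / v) / 2
      refine ⟨c₁ + c₂ / g, by positivity, fun A hA T hT => (h A hA T hT).2.trans ?_⟩
      have h1 : g ≤ maxInfoGain X k v T := A.log_le_maxInfoGain hv p hT
      have h2 : c₂ ≤ c₂ / g * maxInfoGain X k v T := by
        rw [div_mul_eq_mul_div, le_div_iff₀ hg]
        exact mul_le_mul_of_nonneg_left h1 hc₂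
      have h3 := mul_nonneg (Nat.cast_nonneg (α := ℝ) T) (hβ T)
      calc T * β T * (c₁ * maxInfoGain X k v T + c₂)
          ≤ T * β T * (c₁ * maxInfoGain X k v T + c₂ / g * maxInfoGain X k v T) := by gcongr
        _ = _ := by ring
    · push Not at hk
      refine ⟨0, le_rfl, fun A _ T _ => ?_⟩
      rw [zero_mul, integral_eq_zero_of_ae]
      filter_upwards [A.regret_ae_eq_zero hk T] with ω hω
      simp [hω]
  have hC : 1 ≤ B * (1 + Cβ) + 1 := by
    have := mul_nonneg hB (by linarith : 0 ≤ 1 + Cβ)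
    linarith
  -- One constant for all three claims: it is at least `B`, at least `B * Cβ`, and at least `1` as
  -- the tail bound requires.
  refine ⟨B * (1 + Cβ) + 1, by linarith, fun A hA T hT => ?_⟩
  have hγ := IsGPModel.maxInfoGain_nonneg X k v T
  have hlogT : 0 ≤ Real.log T := Real.log_natCast_nonneg T
  have hT0 : (0 : ℝ) ≤ T := Nat.cast_nonneg T
  have h1 := hbound A hA T (by lia)
  have h2 : ∫ ω, A.regret T ω ^ 2 ∂A.P ≤
      (B * (1 + Cβ) + 1) * (T * maxInfoGain X k v T * Real.log T) := by
    calc _ ≤ B * (T * (Cβ * Real.log T) * maxInfoGain X k v T) := by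
          refine h1.trans ?_
          gcongr
          exact hlog T hT
      _ = (B * Cβ) * (T * maxInfoGain X k v T * Real.log T) := by ring
      _ ≤ _ := by
          gcongr
          linarith
  refine ⟨h1.trans ?_, h2, fun δ hδ _ => ?_⟩
  · have := hβ T
    gcongr
    nlinarith
  · exact one_sub_le_measure_le_mul_sqrt (h A hA T (by lia)).1 hC (by positivity) hδ h2

lemma sqrt_le_self_of_one_le {β : ℝ} (h : 1 ≤ β) : √β ≤ β :=
  (Real.sqrt_le_left (by linarith)).2 (le_self_pow₀ h two_ne_zero)

end Order

end GPTS

theorem theorem2 {d : ℕ} (X : Set (GPTS.E d)) (v : ℝ≥0) (hv : 0 < v) :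
    -- finite domain, arbitrary kernel
    (∀ k : GPTS.E d → GPTS.E d → ℝ, X.Finite →
      (∀ (A : GPTS.Run.{u} X k v) (T : ℕ), 1 ≤ T →
        Integrable (fun ω => A.regret T ω ^ 2) A.P ∧
        ∫ ω, A.regret T ω ^ 2 ∂A.P ≤
          12 * GPTS.C₁ v * T * (GPTS.betaFinite X.ncard T + 1) * GPTS.maxInfoGain X k v T
            + Real.sqrt (GPTS.betaFinite X.ncard T)) ∧
      (fun T : ℕ => GPTS.betaFinite X.ncard T) =O[atTop] (fun T : ℕ => Real.log T) ∧
      GPTS.RegretOrder.{u} X k v (GPTS.betaFinite X.ncard) (fun _ => True)) ∧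
    -- compact domain in a cube, with the tail condition on the derivatives
    (∀ (K : GPTS.StdKernel) (r a b : ℝ), K.Admissible → 0 < r → 0 < a → 0 < b →
      IsCompact X → (∀ x ∈ X, ∀ j, x j ∈ Icc 0 r) →
      (∀ A : GPTS.Run.{u} X K.toFun v, GPTS.DerivativeTail A.f A.P a b → ∀ T : ℕ, 1 ≤ T →
        Integrable (fun ω => A.regret T ω ^ 2) A.P ∧
        ∫ ω, A.regret T ω ^ 2 ∂A.P ≤
          27 + Real.sqrt (GPTS.betaContinuous d r (GPTS.lipConst d K a b) T)
            + 18 * T * (GPTS.betaContinuous d r (GPTS.lipConst d K a b) T + 1)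
              * (2 + GPTS.C₁ v * GPTS.maxInfoGain X K.toFun v T)) ∧
      (fun T : ℕ => GPTS.betaContinuous d r (GPTS.lipConst d K a b) T)
        =O[atTop] (fun T : ℕ => Real.log T) ∧
      GPTS.RegretOrder.{u} X K.toFun v (GPTS.betaContinuous d r (GPTS.lipConst d K a b))
        (fun A => GPTS.DerivativeTail A.f A.P a b)) := by
  have hC := (GPTS.IsGPModel.C₁_pos hv).le
  constructor
  · intro k hX
    have hβ1 : ∀ T, 1 ≤ GPTS.betaFinite X.ncard T := fun T => le_max_left _ _
    have hβ0 : ∀ T, 0 ≤ GPTS.betaFinite X.ncard T := fun T => zero_le_one.trans (hβ1 T)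
    obtain ⟨Cβ, hCβ, hlog⟩ := GPTS.exists_betaFinite_le X.ncard
    have hmain := fun (A : GPTS.Run.{u} X k v) (T : ℕ) (hT : 1 ≤ T) =>
      A.integral_regret_sq_le_of_finite hv hX hT
    refine ⟨hmain, GPTS.isBigO_log_of_le hβ0 hlog,
      -- `β + 1 ≤ 2 * β` doubles the `12`, and `√β ≤ T * β` accounts for `c₂`.
      GPTS.regretOrder_of_integral_regret_sq_le hv hβ0 hCβ hlog (c₁ := 24 * GPTS.C₁ v) (c₂ := 1)
        (by positivity) zero_le_one fun A _ T hT => ⟨(hmain A T hT).1, (hmain A T hT).2.trans ?_⟩⟩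
    have hγ := GPTS.IsGPModel.maxInfoGain_nonneg X k v T
    have hT1 : (1 : ℝ) ≤ T := by exact_mod_cast hT
    have h1 := hβ1 T
    have h2 := GPTS.sqrt_le_self_of_one_le h1
    set β := GPTS.betaFinite X.ncard T
    calc 12 * GPTS.C₁ v * T * (β + 1) * GPTS.maxInfoGain X k v T + √β
        ≤ 12 * GPTS.C₁ v * T * (β + β) * GPTS.maxInfoGain X k v T + T * β := by
          gcongr
          exact h2.trans (le_mul_of_one_le_left (by linarith) hT1)
      _ = _ := by ring
  · intro K r a b hK hr ha hb _ hX
    have hL : 0 < GPTS.lipConst d K a b := (GPTS.StdKernel.lipSigma_pos hK).trans_le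
      (le_max_left _ _)
    have hβ1 : ∀ T, 1 ≤ GPTS.betaContinuous d r (GPTS.lipConst d K a b) T :=
      fun T => le_max_left _ _
    have hβ0 : ∀ T, 0 ≤ GPTS.betaContinuous d r (GPTS.lipConst d K a b) T :=
      fun T => zero_le_one.trans (hβ1 T)
    obtain ⟨Cβ, hCβ, hlog⟩ := GPTS.exists_betaContinuous_le d hr hL
    have hmain := fun (A : GPTS.Run.{u} X K.toFun v) (hA : GPTS.DerivativeTail A.f A.P a b)
      (T : ℕ) (hT : 1 ≤ T) => A.integral_regret_sq_le_of_compact hK hv hr ha hb hX hA hT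
    refine ⟨hmain, GPTS.isBigO_log_of_le hβ0 hlog,
      -- With `β + 1 ≤ 2 * β` the terms without `γ_T` are at most `27 + 1 + 72 = 100` times `T * β`.
      GPTS.regretOrder_of_integral_regret_sq_le hv hβ0 hCβ hlog (c₁ := 36 * GPTS.C₁ v)
        (c₂ := 100) (by positivity) (by norm_num)
        fun A hA T hT => ⟨(hmain A hA T hT).1, (hmain A hA T hT).2.trans ?_⟩⟩
    have hγ := GPTS.IsGPModel.maxInfoGain_nonneg X K.toFun v T
    have hT1 : (1 : ℝ) ≤ T := by exact_mod_cast hT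
    have h1 := hβ1 T
    have h2 := GPTS.sqrt_le_self_of_one_le h1
    set β := GPTS.betaContinuous d r (GPTS.lipConst d K a b) T
    have h3 : β ≤ T * β := le_mul_of_one_le_left (by linarith) hT1
    calc 27 + √β + 18 * T * (β + 1) * (2 + GPTS.C₁ v * GPTS.maxInfoGain X K.toFun v T)
        ≤ 27 * (T * β) + T * β +
          18 * T * (β + β) * (2 + GPTS.C₁ v * GPTS.maxInfoGain X K.toFun v T) := by
          gcongr
          · linarith
          · linarith
      _ = _ := by ring
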